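/- Let $K_n^3$ be the complete $3$-uniform hypergraph on $n$ labelled vertices, and let $L_n$ be its Levi graph, i.e. the bipartite graph whose vertices are the $n$ vertices and the $\binom n3$ edges of $K_n^3$, a vertex being adjacent to the edges that contain it. An embedding of $K_n^3$ is a $2$-cell embedding of $L_n$ in a closed surface, described by an embedding scheme (a cyclic rotation at each vertex of $L_n$ and a sign $\pm1$ on each edge of $L_n$). Two embeddings are equivalent if their schemes are switching equivalent (reverse the rotations at the vertices of some set $U$ and change the signs of the edges with exactly one end in $U$); equivalently, if a homeomorphism of the surfaces takes one to the other. Embeddings $\phi_1,\phi_2$ are isomorphic if $\phi_1$ is equivalent to $\phi_2\circ\alpha$ for some automorphism $\alpha$ of $L_n$. An orientable (non-orientable) embedding has minimum genus if its surface has the least Euler genus among all orientable (non-orientable) surfaces in which $L_n$ has a $2$-cell embedding. **Theorem.** There is a function $\varepsilon(n)\to 0$ such that * for every even $n\ge 4$ there are at least $2^{(\frac14-\varepsilon(n))\,n^2\log_2 n}$ pairwise non-isomorphic minimum genus embeddings of $K_n^3$ in the orientable surface of Euler genus $\tfrac1{12}(n-2)(n+3)(n-4)$; * for every even $n\ge 6$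 there are at least $2^{(\frac14-\varepsilon(n))\,n^2\log_2 n}$ pairwise non-isomorphic minimum genus embeddings of $K_n^3$ in the non-orientable surface of Euler genus $\tfrac1{12}(n-2)(n+3)(n-4)$. -/

import Mathlib

open Filter Topology

/-- The complete `k`-uniform hypergraph on `n` labelled vertices. -/
def completeUniformHypergraph (n k : ℕ) : Hypergraph (Fin n) where
  vertexSet := Set.univ
  edgeSet := {e | e.ncard = k}
  subset_vertexSet_of_mem_edgeSet' := fun e _ => Set.subset_univ e

/-- The Levi graph of a hypergraph: the bipartite graph on the disjoint union of the vertices and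
the hyperedges, in which a vertex is adjacent to the hyperedges that contain it. -/
def leviGraph {α : Type*} (H : Hypergraph α) : SimpleGraph (H.vertexSet ⊕ H.edgeSet) where
  Adj
    | .inl v, .inr e => (v : α) ∈ (e : Set α)
    | .inr e, .inl v => (v : α) ∈ (e : Set α)
    | _, _ => False
  symm := ⟨by rintro (v | e) (w | f) h <;> exact h⟩
  loopless := ⟨by rintro (v | e) h <;> exact h⟩

/-- The action of a graph automorphism on darts (oriented edges). -/
def autDart {V : Type*} {G : SimpleGraph V} (α : G ≃g G) : Equiv.Perm G.Dart where
  toFun d := ⟨(α d.fst, α d.snd), α.map_adj_iff.2 d.adj⟩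
  invFun d := ⟨(α.symm d.fst, α.symm d.snd), α.symm.map_adj_iff.2 d.adj⟩
  left_inv d := by ext <;> simp
  right_inv d := by ext <;> simp

/-- An embedding scheme of a graph, representing a 2-cell embedding in a closed surface: a cyclic
permutation of the darts leaving each vertex (the local rotation; it is the same as a
cyclic permutation of the neighbours), and a signature, which gives each edge a sign `1` or `-1`. -/
structure EmbeddingScheme {V : Type*} (G : SimpleGraph V) where
  /-- `rot d` is the dart that follows `d` in the local rotation at the tail `d.fst` of `d`. -/
  rot : Equiv.Perm G.Dart
  rot_fst : ∀ d, (rot d).fst = d.fst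
  /-- The rotation at a vertex is a single cycle through all the darts that leave the vertex. -/
  rot_sameCycle : ∀ d d' : G.Dart, d.fst = d'.fst → rot.SameCycle d d'
  /-- The signature: a sign for each edge, read off from either of its two darts. -/
  sign : G.Dart → ℤˣ
  sign_symm : ∀ d, sign d.symm = sign d

namespace EmbeddingScheme

/-- Switching equivalence: reverse the local rotations at the vertices of a set `U` and change the
signs of the edges with exactly one end in `U`. Two schemes of a connected graph describe
equivalent (homeomorphic) embeddings exactly if they are switching equivalent. -/
def Equivalent {V : Type*} {G : SimpleGraph V} (φ ψ : EmbeddingScheme G) : Prop :=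
  ∃ U : Set V,
    (∀ d : G.Dart, (d.fst ∈ U → ψ.rot d = φ.rot⁻¹ d) ∧ (d.fst ∉ U → ψ.rot d = φ.rot d)) ∧
    (∀ d : G.Dart, ((d.fst ∈ U ↔ d.snd ∈ U) → ψ.sign d = φ.sign d) ∧
      (¬(d.fst ∈ U ↔ d.snd ∈ U) → ψ.sign d = -φ.sign d))

/-- The embedding `φ ∘ α` for an automorphism `α` of the graph. -/
def comp {V : Type*} {G : SimpleGraph V} (φ : EmbeddingScheme G) (α : G ≃g G) :
    EmbeddingScheme G where
  rot := (autDart α)⁻¹ * φ.rot * autDart α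
  rot_fst d := by
    change α.symm (φ.rot (autDart α d)).fst = d.fst
    rw [φ.rot_fst]
    exact α.symm_apply_apply d.fst
  rot_sameCycle d d' h := by
    have key : φ.rot.SameCycle (autDart α d) (autDart α d') :=
      φ.rot_sameCycle _ _ (congrArg α h)
    have h2 := (Equiv.Perm.sameCycle_conj (f := φ.rot) (g := (autDart α)⁻¹)
      (x := d) (y := d')).2 (by simpa using key)
    simpa using h2
  sign d := φ.sign (autDart α d)
  sign_symm d := φ.sign_symm (autDart α d)

/-- `φ` and `ψ` are isomorphic embeddings if `φ` is equivalent to `ψ ∘ α` for some automorphism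
`α` of the graph. -/
def Isomorphic {V : Type*} {G : SimpleGraph V} (φ ψ : EmbeddingScheme G) : Prop :=
  ∃ α : G ≃g G, φ.Equivalent (ψ.comp α)

/-- The surface is orientable exactly if some equivalent scheme has only positive signs. -/
def IsOrientable {V : Type*} {G : SimpleGraph V} (φ : EmbeddingScheme G) : Prop :=
  ∃ ψ : EmbeddingScheme G, φ.Equivalent ψ ∧ ∀ d, ψ.sign d = 1

/-- A flag `(d, s)` stands for the side `s` of the edge of `d`, near the tail `v` of `d`: the side
towards `rot d` if `s = 1`, and towards `rot⁻¹ d` if `s = -1`. Two flags are adjacent if they lie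
in the same face corner, `(d, s)` and `(rot ^ s d, -s)`, or if they are the two ends of
the same side of an edge; the latter keeps its name `s` up to the factor `-1` (because the edge is
seen in the opposite direction) and the sign of the edge. -/
def FlagAdj {V : Type*} {G : SimpleGraph V} (φ : EmbeddingScheme G) (a b : G.Dart × ℤˣ) : Prop :=
  b = ((φ.rot ^ (a.2 : ℤ)) a.1, -a.2) ∨ b = (a.1.symm, -(a.2 * φ.sign a.1))

/-- The faces: the classes of the equivalence relation on flags that flag adjacency generates. -/
def Face {V : Type*} {G : SimpleGraph V} (φ : EmbeddingScheme G) : Type _ :=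
  Quot φ.FlagAdj

/-- The Euler genus of the surface of an embedding scheme of a finite connected graph with at least
one edge, from Euler's formula `|V| - |E| + |F| = 2 - (Euler genus)`. -/
noncomputable def eulerGenus {V : Type*} {G : SimpleGraph V} (φ : EmbeddingScheme G) : ℤ :=
  2 - ((Nat.card V : ℤ) - (Nat.card G.edgeSet : ℤ) + (Nat.card φ.Face : ℤ))

/-- Minimum genus: no embedding of the graph in a surface of the same kind (orientable or
non-orientable) has a smaller Euler genus. -/
def IsMinimumGenus {V : Type*} {G : SimpleGraph V} (φ : EmbeddingScheme G) : Prop :=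
  ∀ ψ : EmbeddingScheme G, (ψ.IsOrientable ↔ φ.IsOrientable) → φ.eulerGenus ≤ ψ.eulerGenus

end EmbeddingScheme

/-! A face of an embedding of the Levi graph has at least four edges, because the graph is bipartite
and simple and has no vertex of degree one. So an embedding in which all faces are quadrangles has
the most faces, and hence the least Euler genus among all surfaces, orientable or not.

A quadrangular face has the form `v, vwx, w, vwy`. The faces therefore match, for every pair `vw`,
the remaining points with each other: this is the involution `next v w`. Around `v` the triple `vxw`
is followed by `vwy` with `y = next v w x`, so the rotation at `v` is a closed trail in the complete
graph on the other points. Conversely, a `TransitionSystem` without fixed points yields a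
quadrangular embedding as soon as there is only one trail, up to reversal, at each point
(`IsUnicursal`); the rotation at a hyperedge is a cyclic order of three points. The surface is
orientable if and only if an alternating sign of ordered triples changes at every transition
(`IsOriented`, `exists_isCompatible`).

Oriented systems exist for every even `n ≥ 4`, by induction from `n` to `n + 2`. At each new point
the trail is an explicit Euler tour on the old points and the other new point. At each old point the
new arcs form short detours that are spliced into the old trail.

One oriented system gives many. Conjugation of `next v w` with a permutation of the positive points
of `vw` cuts and reglues only the trails at `v` and `w`. Given `x` and three further positive
points, either two of the three follow each other in the same order on both trails, and a
three-cycle keeps both trails connected, or the orders are opposite, and a double transposition does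
(`exists_reroute`). Thus every pair, whatever was done at the others, admits about `n / 6` choices,
which gives roughly `(n / 6) ^ (n ^ 2 / 2)` oriented systems (`exists_finset`). A final twist at one
reserved pair reverses parts of two trails and destroys orientability, but no trail falls apart
(`exists_twist`).

For `n ≥ 6` an automorphism of the Levi graph is a permutation of the points, and an embedding
determines its transition system. So an isomorphism class accounts for at most `n!` systems. The
exponent `1/2` obtained above exceeds the required `1/4` by so much that the factor `n!` and the
denominator `6` are absorbed, and `ε` vanishes for all large `n`. -/

open Equiv

/-! ### Cutting a cycle of a permutation and regluing the pieces -/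

section CutAndPaste

variable {X : Type*} {f g : Perm X} {C : X → X} {a : X}

/-- A stretch of an `f`-cycle that `C` fixes remains connected under `C ∘ f`. -/
lemma sameCycle_segment (hC : ∀ y, f.SameCycle a y → g y = C (f y)) {i j : ℕ} (hij : i ≤ j)
    (hfix : ∀ k, i < k → k ≤ j → C ((f ^ k) a) = (f ^ k) a) :
    g.SameCycle ((f ^ i) a) ((f ^ j) a) := by
  induction j, hij using Nat.le_induction with
  | base => exact .refl _ _
  | succ j hij ih =>
    refine (ih fun k h1 h2 => hfix k h1 (by omega)).trans ?_
    have : g ((f ^ j) a) = (f ^ (j + 1)) a := by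
      rw [hC _ ⟨j, by simp⟩, ← Perm.mul_apply, ← pow_succ', hfix (j + 1) (by omega) le_rfl]
    rw [← this]
    exact Perm.sameCycle_apply_right.2 (.refl _ _)

lemma sameCycle_link (hC : ∀ y, f.SameCycle a y → g y = C (f y)) {i : ℕ} (hi : 0 < i) :
    g.SameCycle ((f ^ (i - 1)) a) (C ((f ^ i) a)) := by
  obtain ⟨k, rfl⟩ : ∃ k, i = k + 1 := ⟨i - 1, by omega⟩
  have : g ((f ^ k) a) = C ((f ^ (k + 1)) a) := by
    rw [hC _ ⟨k, by simp⟩, ← Perm.mul_apply, ← pow_succ']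
  rw [← this]
  exact Perm.sameCycle_apply_right.2 (.refl _ _)

/-- The cycle is cut before the positions `0`, `p`, `q`, and `C` glues the pieces in the order
first, third, second. The inverse three-cycle would close up each piece separately, so the sense of
rotation matters. -/
lemma sameCycle_of_three_cycle (hC : ∀ y, f.SameCycle a y → g y = C (f y)) {L p q : ℕ}
    (hp : 0 < p) (hpq : p < q)
    (hfix : ∀ k, 0 < k → k < L → k ≠ p → k ≠ q → C ((f ^ k) a) = (f ^ k) a)
    (h1 : C ((f ^ p) a) = (f ^ q) a) (h2 : C ((f ^ q) a) = a) (hq : q < L) {k : ℕ} (hk : k < L) :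
    g.SameCycle a ((f ^ k) a) := by
  have s1 : ∀ k < p, g.SameCycle a ((f ^ k) a) := fun k hk => by
    simpa using sameCycle_segment hC (Nat.zero_le k)
      fun l _ _ => hfix l (by omega) (by omega) (by omega) (by omega)
  have s2 : ∀ k, p ≤ k → k < q → g.SameCycle ((f ^ p) a) ((f ^ k) a) := fun k h hk =>
    sameCycle_segment hC h fun l _ _ => hfix l (by omega) (by omega) (by omega) (by omega)
  have s3 : ∀ k, q ≤ k → k < L → g.SameCycle ((f ^ q) a) ((f ^ k) a) := fun k h hk =>
    sameCycle_segment hC h fun l _ _ => hfix l (by omega) (by omega) (by omega) (by omega)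
  have l1 := sameCycle_link hC hp
  have l2 := sameCycle_link hC (hp.trans hpq)
  rw [h1] at l1
  rw [h2] at l2
  rcases lt_or_ge k p with h | h
  · exact s1 k h
  rcases lt_or_ge k q with h' | h'
  · exact l2.symm.trans ((s2 _ (by omega) (by omega)).symm.trans (s2 k h h'))
  · exact (s1 _ (by omega)).trans (l1.trans (s3 k h' hk))

/-- The four pieces are run through in the order first, fourth, third, second. The pattern, which
exchanges `0` with `q` and `p` with `r`, is symmetric under reversal of the order of `p`, `q`, `r`;
a three-cycle lacks this symmetry. -/
lemma sameCycle_of_double_transposition (hC : ∀ y, f.SameCycle a y → g y = C (f y)) {L p q r : ℕ}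
    (hp : 0 < p) (hpq : p < q) (hqr : q < r)
    (hfix : ∀ k, 0 < k → k < L → k ≠ p → k ≠ q → k ≠ r → C ((f ^ k) a) = (f ^ k) a)
    (h1 : C ((f ^ p) a) = (f ^ r) a) (h2 : C ((f ^ q) a) = a) (h3 : C ((f ^ r) a) = (f ^ p) a)
    (hr : r < L) {k : ℕ} (hk : k < L) :
    g.SameCycle a ((f ^ k) a) := by
  have s1 : ∀ k < p, g.SameCycle a ((f ^ k) a) := fun k hk => by
    simpa using sameCycle_segment hC (Nat.zero_le k)
      fun l _ _ => hfix l (by omega) (by omega) (by omega) (by omega) (by omega)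
  have s2 : ∀ k, p ≤ k → k < q → g.SameCycle ((f ^ p) a) ((f ^ k) a) := fun k h hk =>
    sameCycle_segment hC h fun l _ _ => hfix l (by omega) (by omega) (by omega) (by omega) (by omega)
  have s3 : ∀ k, q ≤ k → k < r → g.SameCycle ((f ^ q) a) ((f ^ k) a) := fun k h hk =>
    sameCycle_segment hC h fun l _ _ => hfix l (by omega) (by omega) (by omega) (by omega) (by omega)
  have s4 : ∀ k, r ≤ k → k < L → g.SameCycle ((f ^ r) a) ((f ^ k) a) := fun k h hk =>
    sameCycle_segment hC h fun l _ _ => hfix l (by omega) (by omega) (by omega) (by omega) (by omega)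
  have l1 := sameCycle_link hC hp
  have l2 := sameCycle_link hC (hp.trans hpq)
  have l3 := sameCycle_link hC (hp.trans (hpq.trans hqr))
  rw [h1] at l1
  rw [h2] at l2
  rw [h3] at l3
  have b2 : ∀ k, p ≤ k → k < q → g.SameCycle a ((f ^ k) a) := fun k h hk =>
    l2.symm.trans ((s2 _ (by omega) (by omega)).symm.trans (s2 k h hk))
  rcases lt_or_ge k p with h | h
  · exact s1 k h
  rcases lt_or_ge k q with h' | h'
  · exact b2 k h h'
  rcases lt_or_ge k r with h'' | h''
  · exact (b2 p le_rfl hpq).trans (l3.symm.trans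
      ((s3 _ (by omega) (by omega)).symm.trans (s3 k h' h'')))
  · exact (s1 _ (by omega)).trans (l1.trans (s4 k h'' hk))

lemma exists_lt_minimalPeriod [Finite X] {y : X} (h : f.SameCycle a y) :
    ∃ k < Function.minimalPeriod f a, (f ^ k) a = y := by
  obtain ⟨i, hi⟩ := h.exists_nat_pow_eq
  have hper : 0 < Function.minimalPeriod f a :=
    Function.minimalPeriod_pos_of_mem_periodicPts (f.injective.mem_periodicPts a)
  refine ⟨i % Function.minimalPeriod f a, Nat.mod_lt _ hper, ?_⟩
  rw [← hi, ← Perm.iterate_eq_pow, ← Perm.iterate_eq_pow, Function.iterate_mod_minimalPeriod_eq]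

lemma pow_injOn_minimalPeriod {i j : ℕ} (hi : i < Function.minimalPeriod f a)
    (hj : j < Function.minimalPeriod f a) (h : (f ^ i) a = (f ^ j) a) : i = j := by
  rw [← Perm.iterate_eq_pow, ← Perm.iterate_eq_pow] at h
  exact Function.iterate_injOn_Iio_minimalPeriod hi hj h

end CutAndPaste

/-! ### Transition systems and their closed trails -/

/-- For every pair `v, w` an involution `next v w` of the points, which fixes `v` and `w`. In a
quadrangular embedding of the Levi graph of the complete 3-uniform hypergraph, the triples `vwx` and
`vw(next v w x)` share a face corner at the pair `vw`. -/
@[ext]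
structure TransitionSystem (V : Type*) where
  next : V → V → V → V
  next_comm : ∀ v w x, next v w x = next w v x
  next_next : ∀ v w x, next v w (next v w x) = x
  next_left : ∀ v w, next v w v = v
  next_self : ∀ v x, next v v x = x

/-- The ordered pair `a` is an arc of the complete graph on the points other than `v`. -/
def IsArc {V : Type*} (v : V) (a : V × V) : Prop := a.1 ≠ v ∧ a.2 ≠ v ∧ a.1 ≠ a.2

lemma IsArc.swap {V : Type*} {v : V} {a : V × V} (h : IsArc v a) : IsArc v a.swap :=
  ⟨h.2.1, h.1, h.2.2.symm⟩

/-- `o` changes sign if two distinct arguments are exchanged. -/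
def IsAlternating {V : Type*} (o : V → V → V → ℤˣ) : Prop :=
  ∀ v w x, v ≠ w → x ≠ v → x ≠ w → o w v x = -o v w x ∧ o v x w = -o v w x

lemma IsAlternating.neg {V : Type*} {o : V → V → V → ℤˣ} (h : IsAlternating o) :
    IsAlternating fun v w x => -o v w x := fun v w x h1 h2 h3 => by
  simp [(h v w x h1 h2 h3).1, (h v w x h1 h2 h3).2]

namespace TransitionSystem

variable {V : Type*} (T : TransitionSystem V)

lemma next_right (v w : V) : T.next v w w = w := by rw [T.next_comm, T.next_left]

lemma next_ne_left {v w x : V} (h : x ≠ v) : T.next v w x ≠ v := fun h' => h <| by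
  rw [← T.next_next v w x, h', T.next_left]

lemma next_ne_right {v w x : V} (h : x ≠ w) : T.next v w x ≠ w := fun h' => h <| by
  rw [← T.next_next v w x, h', T.next_right]

/-- The passage from one arc to the next in the closed trails at `v`. -/
def turn (v : V) : Perm (V × V) where
  toFun a := (a.2, T.next v a.2 a.1)
  invFun a := (T.next v a.1 a.2, a.1)
  left_inv a := by simp [T.next_next]
  right_inv a := by simp [T.next_next]

@[simp] lemma turn_apply (v : V) (a : V × V) : T.turn v a = (a.2, T.next v a.2 a.1) := rfl

@[simp] lemma turn_inv_apply (v : V) (a : V × V) : (T.turn v)⁻¹ a = (T.next v a.1 a.2, a.1) := rfl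

lemma isArc_turn {v : V} {a : V × V} (h : IsArc v a) : IsArc v (T.turn v a) :=
  ⟨h.2.1, T.next_ne_left h.1, (T.next_ne_right h.2.2).symm⟩

lemma isArc_turn_inv {v : V} {a : V × V} (h : IsArc v a) : IsArc v ((T.turn v)⁻¹ a) :=
  ⟨T.next_ne_left h.2.1, h.1, T.next_ne_right h.2.2.symm⟩

lemma sameCycle_swap {v : V} {a b : V × V} (h : (T.turn v).SameCycle a b) :
    (T.turn v).SameCycle a.swap b.swap := by
  have key : Equiv.prodComm V V * T.turn v * (Equiv.prodComm V V)⁻¹ = (T.turn v)⁻¹ := by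
    ext1 a
    rfl
  have := h.conj (g := Equiv.prodComm V V)
  rw [key, Perm.sameCycle_inv] at this
  exact this

lemma induction_sameCycle {v : V} {P : V × V → Prop} {a b : V × V}
    (h : (T.turn v).SameCycle a b) (ha : P a) (h1 : ∀ a, P a → P (T.turn v a))
    (h2 : ∀ a, P a → P ((T.turn v)⁻¹ a)) : P b := by
  obtain ⟨i, rfl⟩ := h
  induction i with
  | zero => simpa
  | succ i ih => rw [add_comm, zpow_add, zpow_one, Perm.mul_apply]; exact h1 _ ih
  | pred i ih => rw [sub_eq_neg_add, zpow_add, zpow_neg_one, Perm.mul_apply]; exact h2 _ ih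

lemma isArc_of_sameCycle {v : V} {a b : V × V} (h : (T.turn v).SameCycle a b) (ha : IsArc v a) :
    IsArc v b :=
  T.induction_sameCycle h ha (fun _ => T.isArc_turn) fun _ => T.isArc_turn_inv

/-- Neighbouring triples have opposite signs. -/
def IsCompatible (o : V → V → V → ℤˣ) : Prop :=
  ∀ v w x, v ≠ w → x ≠ v → x ≠ w → o v w (T.next v w x) = -o v w x

/-- At each point, there is one closed trail up to reversal. -/
def IsUnicursal : Prop :=
  ∀ v a b, IsArc v a → IsArc v b → (T.turn v).SameCycle a b ∨ (T.turn v).SameCycle a b.swap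

/-- All arcs at `v` with the same sign are in the same closed trail. -/
def IsUnicursalAt (o : V → V → V → ℤˣ) (v : V) : Prop :=
  ∀ a b, IsArc v a → IsArc v b → o v a.1 a.2 = o v b.1 b.2 → (T.turn v).SameCycle a b

variable {T} {o : V → V → V → ℤˣ}

lemma IsCompatible.neg (h : T.IsCompatible o) : T.IsCompatible fun v w x => -o v w x :=
  fun v w x h1 h2 h3 => by simp [h v w x h1 h2 h3]

lemma IsCompatible.next_ne (h : T.IsCompatible o) {v w x : V} (h1 : v ≠ w) (h2 : x ≠ v)
    (h3 : x ≠ w) : T.next v w x ≠ x := fun h' => by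
  have := h v w x h1 h2 h3
  rw [h'] at this
  exact units_ne_neg_self _ this

lemma IsUnicursalAt.neg {v : V} (h : T.IsUnicursalAt o v) :
    T.IsUnicursalAt (fun v w x => -o v w x) v :=
  fun a b ha hb hab => h a b ha hb (neg_injective hab)

lemma sign_turn (ho : IsAlternating o) (hT : T.IsCompatible o) {v : V} {a : V × V}
    (ha : IsArc v a) : o v (T.turn v a).1 (T.turn v a).2 = o v a.1 a.2 := by
  obtain ⟨h1, h2, h3⟩ := ha
  simp only [turn_apply]
  rw [hT v a.2 a.1 h2.symm h1 h3, (ho v a.1 a.2 h1.symm h2 h3.symm).2, neg_neg]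

lemma sign_of_sameCycle (ho : IsAlternating o) (hT : T.IsCompatible o) {v : V} {a b : V × V}
    (h : (T.turn v).SameCycle a b) (ha : IsArc v a) : o v b.1 b.2 = o v a.1 a.2 := by
  refine (T.induction_sameCycle (P := fun b => IsArc v b ∧ o v b.1 b.2 = o v a.1 a.2) h
    ⟨ha, rfl⟩ (fun b hb => ⟨T.isArc_turn hb.1, ?_⟩) fun b hb => ⟨T.isArc_turn_inv hb.1, ?_⟩).2
  · rw [sign_turn ho hT hb.1, hb.2]
  · have := sign_turn ho hT (T.isArc_turn_inv hb.1)
    simp only [Perm.coe_inv, apply_symm_apply] at this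
    rw [Perm.coe_inv, ← this, hb.2]

lemma sign_swap (ho : IsAlternating o) {v : V} {a : V × V} (ha : IsArc v a) :
    o v a.swap.1 a.swap.2 = -o v a.1 a.2 :=
  (ho v a.1 a.2 ha.1.symm ha.2.1 ha.2.2.symm).2

/-- Reversal of arcs changes the sign and maps trails to trails, so it is enough to reach the arcs
of one sign from one arc. -/
lemma IsUnicursalAt.of_root (ho : IsAlternating o) {v : V} (r : V × V)
    (h : ∀ b, IsArc v b → o v b.1 b.2 = o v r.1 r.2 → (T.turn v).SameCycle r b) :
    T.IsUnicursalAt o v := fun a b ha hb hab => by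
  rcases Int.units_eq_one_or (o v a.1 a.2 * o v r.1 r.2) with h1 | h1
  · have h2 : o v a.1 a.2 = o v r.1 r.2 := by
      rw [mul_eq_one_iff_eq_inv, Int.units_inv_eq_self] at h1; exact h1
    exact (h a ha h2).symm.trans (h b hb (hab ▸ h2))
  · have h2 : o v a.1 a.2 = -o v r.1 r.2 := by
      rw [Int.units_ne_iff_eq_neg.symm]
      intro h3
      rw [h3, Int.units_mul_self] at h1
      exact absurd h1 (by decide)
    have e := (h a.swap ha.swap (by rw [sign_swap ho ha, h2, neg_neg])).symm.trans
      (h b.swap hb.swap (by rw [sign_swap ho hb, ← hab, h2, neg_neg]))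
    simpa using T.sameCycle_swap e

lemma isUnicursal_of_forall (ho : IsAlternating o) (h : ∀ v, T.IsUnicursalAt o v) :
    T.IsUnicursal := fun v a b ha hb => by
  rcases eq_or_ne (o v a.1 a.2) (o v b.1 b.2) with h1 | h1
  · exact .inl (h v a b ha hb h1)
  · refine .inr (h v a b.swap ha hb.swap ?_)
    rw [sign_swap ho hb]
    exact (Int.units_ne_iff_eq_neg.1 h1)

variable [DecidableEq V]

/-- Conjugation of the involution at the pair `v, w` with a permutation that fixes `v` and `w`. -/
def reroute (T : TransitionSystem V) (v w : V) (hvw : v ≠ w) (c : Perm V) (hv : c v = v)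
    (hw : c w = w) : TransitionSystem V where
  next a b x := if s(a, b) = s(v, w) then c (T.next a b (c⁻¹ x)) else T.next a b x
  next_comm a b x := by rw [Sym2.eq_swap, T.next_comm, T.next_comm a b]
  next_next a b x := by
    split_ifs <;> simp [T.next_next]
  next_left a b := by
    have hv' : c⁻¹ v = v := by rw [Perm.inv_eq_iff_eq, hv]
    have hw' : c⁻¹ w = w := by rw [Perm.inv_eq_iff_eq, hw]
    split_ifs with h
    · rcases Sym2.eq_iff.1 h with ⟨rfl, rfl⟩ | ⟨rfl, rfl⟩
      · rw [hv', T.next_left, hv]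
      · rw [hw', T.next_left, hw]
    · exact T.next_left a b
  next_self a x := by
    split_ifs with h
    · rcases Sym2.eq_iff.1 h with ⟨rfl, rfl⟩ | ⟨rfl, rfl⟩ <;> exact absurd rfl hvw
    · exact T.next_self a x

variable {v w : V} {hvw : v ≠ w} {c : Perm V} {hv : c v = v} {hw : c w = w}

lemma reroute_of_ne {a b : V} (x : V) (h : s(a, b) ≠ s(v, w)) :
    (T.reroute v w hvw c hv hw).next a b x = T.next a b x := if_neg h

lemma reroute_left (x : V) :
    (T.reroute v w hvw c hv hw).next v w x = c (T.next v w (c⁻¹ x)) := if_pos rfl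

lemma reroute_right (x : V) :
    (T.reroute v w hvw c hv hw).next w v x = c (T.next w v (c⁻¹ x)) := if_pos Sym2.eq_swap

end TransitionSystem

/-! ### Rerouting the trails at a single pair -/

namespace TransitionSystem

variable {V : Type*} [Finite V] {T T' : TransitionSystem V} {o : V → V → V → ℤˣ} {v w : V}
  {c : Perm V}

/-- The action of `c` on the arcs that leave `w`. -/
def arcMap [DecidableEq V] (w : V) (c : Perm V) (a : V × V) : V × V :=
  if a.1 = w then (w, c a.2) else a

/-- `T'` arises from `T` by conjugation of the involution at `v, w` with `c`, where `c` moves only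
points `x` for which `vwx` is positive; the condition concerns the trails at `v` only. -/
structure ReroutesAt (T T' : TransitionSystem V) (o : V → V → V → ℤˣ) (v w : V) (c : Perm V) :
    Prop where
  alternating : IsAlternating o
  compatible : T.IsCompatible o
  ne : v ≠ w
  unicursal : T.IsUnicursalAt o v
  next_eq : ∀ x, T'.next v w x = c (T.next v w (c⁻¹ x))
  next_of_ne : ∀ u x, u ≠ w → T'.next v u x = T.next v u x
  support : ∀ x, c x ≠ x → x ≠ v ∧ x ≠ w ∧ o v w x = 1

variable [DecidableEq V]

omit [Finite V] in
-- A positive arc enters `w` from a point that is negative for `vw`, and `c` fixes it. Hence of the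
-- two factors of the conjugation only the outer `c` acts, on the arc that leaves `w`.
lemma ReroutesAt.turn_eq (h : ReroutesAt T T' o v w c) {a : V × V} (ha : IsArc v a)
    (h1 : o v a.1 a.2 = 1) : T'.turn v a = arcMap w c (T.turn v a) := by
  obtain ⟨y, u⟩ := a
  by_cases hu : u = w
  · subst hu
    have hy : c⁻¹ y = y := by
      rw [Perm.inv_eq_iff_eq]
      by_contra hy
      have h2 := (h.support y fun e => hy e.symm).2.2
      have h3 := (h.alternating v y u ha.1.symm ha.2.1 ha.2.2.symm).2
      simp only at h1
      rw [h2, h1] at h3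
      exact absurd h3 (by decide)
    simp [arcMap, h.next_eq, hy]
  · simp [arcMap, hu, h.next_of_ne _ _ hu]

lemma ReroutesAt.of_cycle (h : ReroutesAt T T' o v w c) {x : V} (hxv : x ≠ v) (hxw : x ≠ w)
    (hx : o v w x = 1)
    (hC : (∀ y, (T.turn v).SameCycle (w, x) y → T'.turn v y = arcMap w c (T.turn v y)) →
      ∀ k < Function.minimalPeriod (T.turn v) (w, x),
        (T'.turn v).SameCycle (w, x) ((T.turn v ^ k) (w, x))) :
    T'.IsUnicursalAt o v := by
  have ha : IsArc v (w, x) := ⟨h.ne.symm, hxv, hxw.symm⟩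
  refine .of_root h.alternating (w, x) fun b hb hbo => ?_
  obtain ⟨k, hk, rfl⟩ := exists_lt_minimalPeriod (h.unicursal _ _ ha hb hbo.symm)
  refine hC (fun y hy => h.turn_eq (T.isArc_of_sameCycle hy ha) ?_) k hk
  rw [sign_of_sameCycle h.alternating h.compatible hy ha]
  exact hx

lemma ReroutesAt.three_cycle (h : ReroutesAt T T' o v w c) {x y z : V} {p q : ℕ} (hxv : x ≠ v)
    (hxw : x ≠ w) (hx : o v w x = 1) (hp : 0 < p) (hpq : p < q)
    (hq : q < Function.minimalPeriod (T.turn v) (w, x))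
    (hy : (T.turn v ^ p) (w, x) = (w, y)) (hz : (T.turn v ^ q) (w, x) = (w, z))
    (cy : c y = z) (cz : c z = x) (hc : ∀ t, t ≠ x → t ≠ y → t ≠ z → c t = t) :
    T'.IsUnicursalAt o v := by
  refine h.of_cycle hxv hxw hx fun hC k hk => sameCycle_of_three_cycle (p := p) (q := q) hC hp hpq
    (fun k h0 hk h1 h2 => ?_) (by simp [arcMap, hy, hz, cy]) (by simp [arcMap, hz, cz]) hq hk
  unfold arcMap
  split_ifs with e
  · have key : ∀ t j, j < Function.minimalPeriod (T.turn v) (w, x) → k ≠ j →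
        -- Positions within one period are distinct, so the arc at position `k` ends in none of the
        -- points that `c` moves.
        (T.turn v ^ j) (w, x) = (w, t) → ((T.turn v ^ k) (w, x)).2 ≠ t := by
      rintro t j hj hkj ht rfl
      refine hkj (pow_injOn_minimalPeriod hk hj ?_)
      rw [ht]; ext <;> simp [e]
    rw [hc _ (key x 0 (by omega) (by omega) rfl) (key y p (by omega) h1 hy) (key z q hq h2 hz)]
    ext <;> simp [e]
  · rfl

lemma ReroutesAt.double_transposition (h : ReroutesAt T T' o v w c) {x y z t : V} {p q r : ℕ}
    (hxv : x ≠ v) (hxw : x ≠ w) (hx : o v w x = 1) (hp : 0 < p) (hpq : p < q) (hqr : q < r)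
    (hr : r < Function.minimalPeriod (T.turn v) (w, x))
    (hy : (T.turn v ^ p) (w, x) = (w, y)) (hz : (T.turn v ^ q) (w, x) = (w, z))
    (ht : (T.turn v ^ r) (w, x) = (w, t)) (cy : c y = t) (cz : c z = x) (ct : c t = y)
    (hc : ∀ s, s ≠ x → s ≠ y → s ≠ z → s ≠ t → c s = s) :
    T'.IsUnicursalAt o v := by
  refine h.of_cycle hxv hxw hx fun hC k hk => sameCycle_of_double_transposition
    (p := p) (q := q) (r := r) hC hp hpq hqr
    (fun k h0 hk h1 h2 h3 => ?_) (by simp [arcMap, hy, ht, cy]) (by simp [arcMap, hz, cz])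
    (by simp [arcMap, hy, ht, ct]) hr hk
  unfold arcMap
  split_ifs with e
  · have key : ∀ s j, j < Function.minimalPeriod (T.turn v) (w, x) → k ≠ j →
        (T.turn v ^ j) (w, x) = (w, s) → ((T.turn v ^ k) (w, x)).2 ≠ s := by
      rintro s j hj hkj hs rfl
      refine hkj (pow_injOn_minimalPeriod hk hj ?_)
      rw [hs]; ext <;> simp [e]
    rw [hc _ (key x 0 (by omega) (by omega) rfl) (key y p (by omega) h1 hy)
      (key z q (by omega) h2 hz) (key t r hr h3 ht)]
    ext <;> simp [e]
  · rfl

/-- The position of the arcs `(w, y)` in the positive trail at `v`, from `(w, x)` on. -/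
lemma exists_position (h : T.IsUnicursalAt o v) (hvw : v ≠ w) {x : V} (hxv : x ≠ v) (hxw : x ≠ w)
    (hx : o v w x = 1) : ∃ p : V → ℕ, ∀ y, y ≠ v → y ≠ w → o v w y = 1 →
      p y < Function.minimalPeriod (T.turn v) (w, x) ∧ (T.turn v ^ p y) (w, x) = (w, y) ∧
      (y ≠ x → 0 < p y) := by
  have : ∀ y, ∃ p : ℕ, y ≠ v → y ≠ w → o v w y = 1 →
      p < Function.minimalPeriod (T.turn v) (w, x) ∧ (T.turn v ^ p) (w, x) = (w, y) := fun y => by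
    by_cases hy : y ≠ v ∧ y ≠ w ∧ o v w y = 1
    · obtain ⟨p, hp⟩ := exists_lt_minimalPeriod (h (w, x) (w, y) ⟨hvw.symm, hxv, hxw.symm⟩
        ⟨hvw.symm, hy.1, hy.2.1.symm⟩ (hx.trans hy.2.2.symm))
      exact ⟨p, fun _ _ _ => hp⟩
    · exact ⟨0, fun h1 h2 h3 => absurd ⟨h1, h2, h3⟩ hy⟩
  choose p hp using this
  refine ⟨p, fun y h1 h2 h3 => ⟨(hp y h1 h2 h3).1, (hp y h1 h2 h3).2, fun hyx => ?_⟩⟩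
  rw [Nat.pos_iff_ne_zero]
  intro h0
  have := (hp y h1 h2 h3).2
  rw [h0] at this
  simp at this
  exact hyx this.symm

/-- A compatible system with one closed trail in each direction at each point. -/
structure IsOriented (T : TransitionSystem V) (o : V → V → V → ℤˣ) : Prop where
  compatible : T.IsCompatible o
  unicursal : ∀ v, T.IsUnicursalAt o v

section Reroute

variable {hvw : v ≠ w} {hv : c v = v} {hw : c w = w}

omit [Finite V] in
lemma reroutesAt_left (ho : IsAlternating o) (hT : T.IsOriented o)
    (hc : ∀ x, c x ≠ x → x ≠ v ∧ x ≠ w ∧ o v w x = 1) :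
    ReroutesAt T (T.reroute v w hvw c hv hw) o v w c where
  alternating := ho
  compatible := hT.compatible
  ne := hvw
  unicursal := hT.unicursal v
  next_eq x := reroute_left x
  next_of_ne u x hu := reroute_of_ne x fun e => by
    rcases Sym2.eq_iff.1 e with ⟨-, e⟩ | ⟨e, -⟩
    exacts [hu e, hvw e]
  support := hc

omit [Finite V] in
-- Exchanging `v` and `w` reverses the sign. With the sign negated, the points moved by `c` are
-- positive seen from `w` too, and the results for `v` apply.
lemma reroutesAt_right (ho : IsAlternating o) (hT : T.IsOriented o)
    (hc : ∀ x, c x ≠ x → x ≠ v ∧ x ≠ w ∧ o v w x = 1) :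
    ReroutesAt T (T.reroute v w hvw c hv hw) (fun v w x => -o v w x) w v c where
  alternating := ho.neg
  compatible := hT.compatible.neg
  ne := hvw.symm
  unicursal := (hT.unicursal w).neg
  next_eq x := reroute_right x
  next_of_ne u x hu := reroute_of_ne x fun e => by
    rcases Sym2.eq_iff.1 e with ⟨e, -⟩ | ⟨-, e⟩
    exacts [hvw e.symm, hu e]
  support x hx := by
    obtain ⟨h1, h2, h3⟩ := hc x hx
    exact ⟨h2, h1, by rw [(ho v w x hvw h1 h2).1, neg_neg, h3]⟩

omit [Finite V] in
-- `c` permutes points of equal sign, so compatibility survives; trails at points other than `v` and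
-- `w` do not use the changed involution.
lemma IsOriented.reroute (ho : IsAlternating o) (hT : T.IsOriented o)
    (hc : ∀ x, c x ≠ x → x ≠ v ∧ x ≠ w ∧ o v w x = 1)
    (h1 : (T.reroute v w hvw c hv hw).IsUnicursalAt o v)
    (h2 : (T.reroute v w hvw c hv hw).IsUnicursalAt (fun v w x => -o v w x) w) :
    (T.reroute v w hvw c hv hw).IsOriented o := by
  have hcO : ∀ x, x ≠ v → x ≠ w → o v w (c x) = o v w x := fun x hxv hxw => by
    by_cases hx : c x = x
    · rw [hx]
    · rw [(hc x hx).2.2, (hc (c x) fun e => hx (c.injective e)).2.2]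
  have hci : ∀ x, x ≠ v → x ≠ w → o v w (c⁻¹ x) = o v w x := fun x hxv hxw => by
    have h3 : c⁻¹ x ≠ v := by rwa [Ne, Perm.inv_eq_iff_eq, hv]
    have h4 : c⁻¹ x ≠ w := by rwa [Ne, Perm.inv_eq_iff_eq, hw]
    have := hcO (c⁻¹ x) h3 h4
    simpa using this.symm
  have key : ∀ x, x ≠ v → x ≠ w →
      o v w ((T.reroute v w hvw c hv hw).next v w x) = -o v w x := fun x hxv hxw => by
    have h3 : c⁻¹ x ≠ v := by rwa [Ne, Perm.inv_eq_iff_eq, hv]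
    have h4 : c⁻¹ x ≠ w := by rwa [Ne, Perm.inv_eq_iff_eq, hw]
    rw [reroute_left, hcO _ (T.next_ne_left h3) (T.next_ne_right h4),
      hT.compatible v w _ hvw h3 h4, hci x hxv hxw]
  constructor
  · intro a b x hab hxa hxb
    by_cases e : s(a, b) = s(v, w)
    · rcases Sym2.eq_iff.1 e with ⟨rfl, rfl⟩ | ⟨rfl, rfl⟩
      · exact key x hxa hxb
      · have e1 := (ho b a x hab.symm hxb hxa).1
        have e2 := (ho b a _ hab.symm
          ((T.reroute b a hvw c hv hw).next_ne_left hxb (w := a))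
          ((T.reroute b a hvw c hv hw).next_ne_right hxa (v := b))).1
        rw [TransitionSystem.next_comm, e2, e1, key x hxb hxa]
    · rw [reroute_of_ne x e, hT.compatible a b x hab hxa hxb]
  · intro u
    by_cases hu : u = v
    · rwa [hu]
    by_cases hu' : u = w
    · subst hu'
      simpa using h2.neg
    have : (T.reroute v w hvw c hv hw).turn u = T.turn u := by
      ext1 a
      have : s(u, a.2) ≠ s(v, w) := fun e => by
        rcases Sym2.eq_iff.1 e with ⟨e, -⟩ | ⟨e, -⟩
        exacts [hu e, hu' e]
      simp [reroute_of_ne _ this]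
    unfold IsUnicursalAt
    rw [this]
    exact hT.unicursal u

end Reroute

/-- The involution at a pair `v, w` can be changed such that the partner of `T.next v w x` is one of
three given points instead of `x`. -/
theorem IsOriented.exists_reroute (ho : IsAlternating o) (hT : T.IsOriented o) (hvw : v ≠ w)
    {x y₁ y₂ y₃ : V} (hO : ∀ y ∈ ({x, y₁, y₂, y₃} : Set V), y ≠ v ∧ y ≠ w ∧ o v w y = 1)
    (h1 : y₁ ≠ x) (h2 : y₂ ≠ x) (h3 : y₃ ≠ x) (h12 : y₁ ≠ y₂) (h13 : y₁ ≠ y₃) (h23 : y₂ ≠ y₃) :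
    ∃ (c : Perm V) (hv : c v = v) (hw : c w = w), (T.reroute v w hvw c hv hw).IsOriented o ∧
      (∀ t, c t ≠ t → t ≠ v ∧ t ≠ w ∧ o v w t = 1) ∧ c x ∈ ({y₁, y₂, y₃} : Set V) := by
  obtain ⟨hxv, hxw, hx⟩ := hO x (by simp)
  have ho' : ∀ t, t ≠ v → t ≠ w → -o w v t = o v w t := fun t h1 h2 => by
    rw [(ho v w t hvw h1 h2).1, neg_neg]
  have hx' : -o w v x = 1 := (ho' x hxv hxw).trans hx
  obtain ⟨p, hp⟩ := exists_position (hT.unicursal v) hvw hxv hxw hx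
  obtain ⟨q, hq⟩ := exists_position (o := fun v w x => -o v w x) (hT.unicursal w).neg hvw.symm
    hxw hxv hx'
  have hpinj : ∀ y z, y ≠ v → y ≠ w → o v w y = 1 → z ≠ v → z ≠ w → o v w z = 1 → y ≠ z →
      p y ≠ p z := by
    intro y z a1 a2 a3 b1 b2 b3 hyz e
    have e1 := (hp y a1 a2 a3).2.1
    rw [e, (hp z b1 b2 b3).2.1] at e1
    simp at e1
    exact hyz e1.symm
  have hqinj : ∀ y z, y ≠ v → y ≠ w → o v w y = 1 → z ≠ v → z ≠ w → o v w z = 1 → y ≠ z →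
      q y ≠ q z := by
    intro y z a1 a2 a3 b1 b2 b3 hyz e
    have e1 := (hq y a2 a1 ((ho' y a1 a2).trans a3)).2.1
    rw [e, (hq z b2 b1 ((ho' z b1 b2).trans b3)).2.1] at e1
    simp at e1
    exact hyz e1.symm
  -- If `y` comes before `z` on both trails, counted from `x`, then the three-cycle `x → y → z → x`
  -- has the right sense at both ends of the pair.
  have three : ∀ y z, y ≠ v → y ≠ w → o v w y = 1 → z ≠ v → z ≠ w → o v w z = 1 → y ≠ x → z ≠ x →
      p y < p z → q y < q z →
      ∃ (c : Perm V) (hv : c v = v) (hw : c w = w), (T.reroute v w hvw c hv hw).IsOriented o ∧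
        (∀ t, c t ≠ t → t ≠ v ∧ t ≠ w ∧ o v w t = 1) ∧ c x = y := by
    intro y z a1 a2 a3 b1 b2 b3 hyx hzx hpyz hqyz
    have hyz : y ≠ z := by rintro rfl; omega
    obtain ⟨y1, y2, y3⟩ := hp y a1 a2 a3
    obtain ⟨y1', y2', y3'⟩ := hq y a2 a1 ((ho' y a1 a2).trans a3)
    obtain ⟨z1, z2, z3⟩ := hp z b1 b2 b3
    obtain ⟨z1', z2', z3'⟩ := hq z b2 b1 ((ho' z b1 b2).trans b3)
    have hfix : ∀ t, t ≠ x → t ≠ y → t ≠ z → (swap x y * swap y z) t = t := fun t e1 e2 e3 => by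
      simp [swap_apply_of_ne_of_ne, e1, e2, e3]
    have cx : (swap x y * swap y z) x = y := by
      simp [swap_apply_of_ne_of_ne hyx.symm hzx.symm]
    have cy : (swap x y * swap y z) y = z := by
      simp [swap_apply_of_ne_of_ne hzx hyz.symm]
    have cz : (swap x y * swap y z) z = x := by simp
    generalize swap x y * swap y z = c at *
    have hc : ∀ t, c t ≠ t → t ≠ v ∧ t ≠ w ∧ o v w t = 1 := fun t ht => by
      by_contra hcon
      exact ht (hfix t (by rintro rfl; exact hcon ⟨hxv, hxw, hx⟩)
        (by rintro rfl; exact hcon ⟨a1, a2, a3⟩) (by rintro rfl; exact hcon ⟨b1, b2, b3⟩))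
    have hv := hfix v hxv.symm a1.symm b1.symm
    have hw := hfix w hxw.symm a2.symm b2.symm
    refine ⟨c, hv, hw, hT.reroute ho hc ?_ ?_, hc, cx⟩
    · exact (reroutesAt_left ho hT hc).three_cycle hxv hxw hx (y3 hyx) hpyz z1 y2 z2 cy cz hfix
    · exact (reroutesAt_right ho hT hc).three_cycle hxw hxv hx' (y3' hyx) hqyz z1' y2' z2' cy cz
        hfix
  -- With the points in their order at `v`, either two neighbours have the same order at `w`, or all
  -- three are reversed there. In the latter case the double transposition that exchanges `x` with
  -- `y₂` and `y₁` with `y₃` works at both ends, by its symmetry under reversal.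
  have sorted : ∀ y₁ y₂ y₃, (∀ y ∈ ({x, y₁, y₂, y₃} : Set V), y ≠ v ∧ y ≠ w ∧ o v w y = 1) →
      y₁ ≠ x → y₂ ≠ x → y₃ ≠ x → y₁ ≠ y₂ → y₁ ≠ y₃ → y₂ ≠ y₃ → p y₁ < p y₂ → p y₂ < p y₃ →
      ∃ (c : Perm V) (hv : c v = v) (hw : c w = w), (T.reroute v w hvw c hv hw).IsOriented o ∧
        (∀ t, c t ≠ t → t ≠ v ∧ t ≠ w ∧ o v w t = 1) ∧ (c x = y₁ ∨ c x = y₂ ∨ c x = y₃) := by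
    clear h1 h2 h3 h12 h13 h23 hO y₁ y₂ y₃
    intro y₁ y₂ y₃ hO h1 h2 h3 h12 h13 h23 hp12 hp23
    obtain ⟨a1, a2, a3⟩ := hO y₁ (by simp)
    obtain ⟨b1, b2, b3⟩ := hO y₂ (by simp)
    obtain ⟨d1, d2, d3⟩ := hO y₃ (by simp)
    rcases lt_or_ge (q y₁) (q y₂) with hq12 | hq12
    · obtain ⟨c, hv, hw, A, B, D⟩ := three y₁ y₂ a1 a2 a3 b1 b2 b3 h1 h2 hp12 hq12
      exact ⟨c, hv, hw, A, B, .inl D⟩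
    rcases lt_or_ge (q y₂) (q y₃) with hq23 | hq23
    · obtain ⟨c, hv, hw, A, B, D⟩ := three y₂ y₃ b1 b2 b3 d1 d2 d3 h2 h3 hp23 hq23
      exact ⟨c, hv, hw, A, B, .inr (.inl D)⟩
    replace hq12 := lt_of_le_of_ne hq12 (hqinj _ _ a1 a2 a3 b1 b2 b3 h12).symm
    replace hq23 := lt_of_le_of_ne hq23 (hqinj _ _ b1 b2 b3 d1 d2 d3 h23).symm
    obtain ⟨e1, e2, e3⟩ := hp y₁ a1 a2 a3
    obtain ⟨e1', e2', e3'⟩ := hq y₁ a2 a1 ((ho' y₁ a1 a2).trans a3)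
    obtain ⟨f1, f2, f3⟩ := hp y₂ b1 b2 b3
    obtain ⟨f1', f2', f3'⟩ := hq y₂ b2 b1 ((ho' y₂ b1 b2).trans b3)
    obtain ⟨g1, g2, g3⟩ := hp y₃ d1 d2 d3
    obtain ⟨g1', g2', g3'⟩ := hq y₃ d2 d1 ((ho' y₃ d1 d2).trans d3)
    have hfix : ∀ t, t ≠ x → t ≠ y₁ → t ≠ y₂ → t ≠ y₃ → (swap x y₂ * swap y₁ y₃) t = t :=
      fun t e1 e2 e3 e4 => by simp [swap_apply_of_ne_of_ne, e1, e2, e3, e4]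
    have cx : (swap x y₂ * swap y₁ y₃) x = y₂ := by
      simp [swap_apply_of_ne_of_ne h1.symm h3.symm]
    have c1 : (swap x y₂ * swap y₁ y₃) y₁ = y₃ := by
      simp [swap_apply_of_ne_of_ne h3 h23.symm]
    have c2 : (swap x y₂ * swap y₁ y₃) y₂ = x := by
      simp [swap_apply_of_ne_of_ne h12.symm h23]
    have c3 : (swap x y₂ * swap y₁ y₃) y₃ = y₁ := by
      simp [swap_apply_of_ne_of_ne h1 h12]
    generalize swap x y₂ * swap y₁ y₃ = c at *
    have hc : ∀ t, c t ≠ t → t ≠ v ∧ t ≠ w ∧ o v w t = 1 := fun t ht => by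
      by_contra hcon
      exact ht (hfix t (by rintro rfl; exact hcon ⟨hxv, hxw, hx⟩)
        (by rintro rfl; exact hcon ⟨a1, a2, a3⟩) (by rintro rfl; exact hcon ⟨b1, b2, b3⟩)
        (by rintro rfl; exact hcon ⟨d1, d2, d3⟩))
    have hv := hfix v hxv.symm a1.symm b1.symm d1.symm
    have hw := hfix w hxw.symm a2.symm b2.symm d2.symm
    refine ⟨c, hv, hw, hT.reroute ho hc ?_ ?_, hc, .inr (.inl cx)⟩
    · exact (reroutesAt_left ho hT hc).double_transposition hxv hxw hx (e3 h1) hp12 hp23 g1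
        e2 f2 g2 c1 c2 c3 hfix
    · exact (reroutesAt_right ho hT hc).double_transposition hxw hxv hx' (g3' h3) hq23 hq12 e1'
        g2' f2' e2' c3 c2 c1 fun t e1 e2 e3 e4 => hfix t e1 e4 e3 e2
  obtain ⟨a1, a2, a3⟩ := hO y₁ (by simp)
  obtain ⟨b1, b2, b3⟩ := hO y₂ (by simp)
  obtain ⟨d1, d2, d3⟩ := hO y₃ (by simp)
  have n12 := hpinj _ _ a1 a2 a3 b1 b2 b3 h12
  have n13 := hpinj _ _ a1 a2 a3 d1 d2 d3 h13
  have n23 := hpinj _ _ b1 b2 b3 d1 d2 d3 h23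
  have fin : ∀ z₁ z₂ z₃, ({z₁, z₂, z₃} : Set V) = {y₁, y₂, y₃} →
      z₁ ≠ x → z₂ ≠ x → z₃ ≠ x → z₁ ≠ z₂ → z₁ ≠ z₃ → z₂ ≠ z₃ → p z₁ < p z₂ → p z₂ < p z₃ →
      ∃ (c : Perm V) (hv : c v = v) (hw : c w = w), (T.reroute v w hvw c hv hw).IsOriented o ∧
      (∀ t, c t ≠ t → t ≠ v ∧ t ≠ w ∧ o v w t = 1) ∧ c x ∈ ({y₁, y₂, y₃} : Set V) := by
    intro z₁ z₂ z₃ e i1 i2 i3 i4 i5 i6 i7 i8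
    rw [← e] at hO ⊢
    simpa using sorted z₁ z₂ z₃ hO i1 i2 i3 i4 i5 i6 i7 i8
  rcases lt_or_gt_of_ne n12 with i | i <;> rcases lt_or_gt_of_ne n13 with j | j <;>
    rcases lt_or_gt_of_ne n23 with k | k
  · exact fin y₁ y₂ y₃ rfl h1 h2 h3 h12 h13 h23 i k
  · exact fin y₁ y₃ y₂ (by ext; simp; tauto) h1 h3 h2 h13 h12 h23.symm j k
  · omega
  · exact fin y₃ y₁ y₂ (by ext; simp; tauto) h3 h1 h2 h13.symm h23.symm h12 j i
  · exact fin y₂ y₁ y₃ (by ext; simp; tauto) h2 h1 h3 h12.symm h23 h13 i j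
  · omega
  · exact fin y₂ y₃ y₁ (by ext; simp; tauto) h2 h3 h1 h23 h12.symm h13.symm k j
  · exact fin y₃ y₂ y₁ (by ext; simp; tauto) h3 h2 h1 h23.symm h13.symm h12.symm k i

end TransitionSystem

/-! ### Counting oriented systems -/

namespace TransitionSystem

variable {V : Type*} [Fintype V] [DecidableEq V] {T T' : TransitionSystem V} {o : V → V → V → ℤˣ}
  {v w : V}

/-- `next v w` is a bijection between the positive and the negative points of the pair. -/
lemma IsCompatible.card_positive (hT : T.IsCompatible o) (hvw : v ≠ w) :
    2 * (Finset.univ.filter fun x => x ≠ v ∧ x ≠ w ∧ o v w x = 1).card + 2 = Fintype.card V := by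
  have h1 : (Finset.univ.filter fun x => x ≠ v ∧ x ≠ w ∧ o v w x = 1).card =
      (Finset.univ.filter fun x => x ≠ v ∧ x ≠ w ∧ o v w x ≠ 1).card := by
    refine Finset.card_bij' (fun x _ => T.next v w x) (fun x _ => T.next v w x) ?_ ?_
      (fun x _ => T.next_next v w x) (fun x _ => T.next_next v w x)
    · intro x hx
      simp only [Finset.mem_filter, Finset.mem_univ, true_and] at hx ⊢
      refine ⟨T.next_ne_left hx.1, T.next_ne_right hx.2.1, ?_⟩
      rw [hT v w x hvw hx.1 hx.2.1, hx.2.2]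
      decide
    · intro x hx
      simp only [Finset.mem_filter, Finset.mem_univ, true_and] at hx ⊢
      refine ⟨T.next_ne_left hx.1, T.next_ne_right hx.2.1, ?_⟩
      rw [hT v w x hvw hx.1 hx.2.1, Int.units_ne_iff_eq_neg.1 hx.2.2, neg_neg]
  have h2 := Finset.card_filter_add_card_filter_not
    (s := Finset.univ.filter fun x => x ≠ v ∧ x ≠ w) (fun x => o v w x = 1)
  simp only [Finset.filter_filter, and_assoc] at h2
  rw [← h1] at h2
  have h3 : (Finset.univ.filter fun x => x ≠ v ∧ x ≠ w).card + 2 = Fintype.card V := by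
    have : (Finset.univ.filter fun x => x ≠ v ∧ x ≠ w) = ({v, w} : Finset V)ᶜ := by
      ext x; simp
    rw [this, Finset.card_compl, Finset.card_pair hvw]
    have := Finset.card_le_univ ({v, w} : Finset V)
    rw [Finset.card_pair hvw] at this
    omega
  omega

/-- There are many ways to change an oriented system at a single pair. -/
lemma IsOriented.exists_injective (ho : IsAlternating o) (hT : T.IsOriented o) (hvw : v ≠ w) {A : ℕ}
    (hA : 6 * A + 4 ≤ Fintype.card V) :
    ∃ F : Fin A → TransitionSystem V, Function.Injective F ∧ ∀ j, (F j).IsOriented o ∧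
      ∀ a b x, s(a, b) ≠ s(v, w) → (F j).next a b x = T.next a b x := by
  have hcard := hT.compatible.card_positive hvw
  set O := Finset.univ.filter fun x => x ≠ v ∧ x ≠ w ∧ o v w x = 1
  -- One point to be moved and `A` disjoint groups of three targets; `6 * A + 4 ≤ n` says exactly
  -- that they fit into the `(n - 2) / 2` positive points.
  have hO : Fintype.card (Fin (3 * A + 1)) ≤ Fintype.card O := by
    simp only [Fintype.card_fin, Fintype.card_coe]; omega
  obtain ⟨e⟩ := Function.Embedding.nonempty_of_card_le hO
  have he : ∀ i, (e i : V) ≠ v ∧ (e i : V) ≠ w ∧ o v w (e i) = 1 := fun i => by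
    have := (e i).2
    rwa [Finset.mem_filter, and_iff_right (Finset.mem_univ _)] at this
  have hne : ∀ i j, i ≠ j → (e i : V) ≠ e j := fun i j hij h =>
    hij (e.injective (Subtype.ext h))
  have key : ∀ j : Fin A, ∃ T' : TransitionSystem V, (T'.IsOriented o ∧
      ∀ a b x, s(a, b) ≠ s(v, w) → T'.next a b x = T.next a b x) ∧
      ∃ i : Fin (3 * A + 1), T'.next v w (T.next v w (e 0)) = e i ∧
        3 * (j : ℕ) < i ∧ (i : ℕ) ≤ 3 * j + 3 := by
    intro j
    have hj := j.2
    obtain ⟨c, hv, hw, h1, h2, h3⟩ := hT.exists_reroute ho hvw (x := e 0)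
      (y₁ := e ⟨3 * j + 1, by omega⟩) (y₂ := e ⟨3 * j + 2, by omega⟩)
      (y₃ := e ⟨3 * j + 3, by omega⟩)
      (by rintro y (rfl | rfl | rfl | rfl) <;> exact he _)
      (hne _ _ (by simp [Fin.ext_iff])) (hne _ _ (by simp [Fin.ext_iff]))
      (hne _ _ (by simp [Fin.ext_iff])) (hne _ _ (by simp)) (hne _ _ (by simp))
      (hne _ _ (by simp))
    refine ⟨_, ⟨h1, fun a b x => reroute_of_ne x⟩, ?_⟩
    -- The old partner of `e 0` is negative, hence fixed by `c`, so its new partner is `c (e 0)`, a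
    -- point of the `j`-th group. Different groups give different systems.
    have hc : c⁻¹ (T.next v w (e 0)) = T.next v w (e 0) := by
      rw [Perm.inv_eq_iff_eq]
      by_contra hcon
      have := (h2 _ fun e => hcon e.symm).2.2
      rw [hT.compatible v w _ hvw (he 0).1 (he 0).2.1, (he 0).2.2] at this
      exact absurd this (by decide)
    rw [reroute_left, hc, T.next_next]
    rcases h3 with h3 | h3 | h3
    · exact ⟨_, h3, by simp, by simp⟩
    · exact ⟨_, h3, by simp, by simp⟩
    · exact ⟨_, h3, by simp, by simp⟩
  choose F hF i hi using key
  refine ⟨F, fun j k hjk => ?_, hF⟩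
  have h1 := hi j
  have h2 := hi k
  rw [← hjk, h1.1] at h2
  have : i j = i k := e.injective (Subtype.ext h2.1)
  rw [← this] at h2
  ext
  omega

/-- Changing an oriented system at the pairs of a set `P`, one after the other. -/
theorem IsOriented.exists_finset (ho : IsAlternating o) (hT : T.IsOriented o) {A : ℕ}
    (hA : 6 * A + 4 ≤ Fintype.card V) (P : Finset (Sym2 V)) (hP : ∀ e ∈ P, ¬ e.IsDiag) :
    ∃ S : Finset (TransitionSystem V), A ^ P.card ≤ S.card ∧ (∀ T ∈ S, T.IsOriented o) ∧
      ∀ T₁ ∈ S, ∀ T₂ ∈ S, (∀ a b x, s(a, b) ∈ P → T₁.next a b x = T₂.next a b x) → T₁ = T₂ := by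
  classical
  induction P using Finset.induction_on with
  | empty => exact ⟨{T}, by simp, by simpa using hT, by simp⟩
  | insert e P he ih =>
    obtain ⟨S, hS, hS1, hS2⟩ := ih fun e he => hP e (Finset.mem_insert_of_mem he)
    induction e using Sym2.ind with | _ v w
    have hvw : v ≠ w := fun h => hP s(v, w) (Finset.mem_insert_self _ _) (by simpa using h)
    have key : ∀ T : S, ∃ F : Fin A → TransitionSystem V, Function.Injective F ∧
        ∀ j, (F j).IsOriented o ∧
        ∀ a b x, s(a, b) ≠ s(v, w) → (F j).next a b x = T.1.next a b x :=
      fun T => (hS1 T.1 T.2).exists_injective ho hvw hA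
    choose F hF1 hF2 using key
    -- A change at `vw` leaves the values at the earlier pairs alone, and these already determine
    -- the system it started from.
    have hinj : ∀ (T₁ : S) (j₁ : Fin A) (T₂ : S) (j₂ : Fin A),
        (∀ a b x, s(a, b) ∈ insert s(v, w) P → (F T₁ j₁).next a b x = (F T₂ j₂).next a b x) →
        T₁ = T₂ := fun T₁ j₁ T₂ j₂ h => by
      refine Subtype.ext (hS2 _ T₁.2 _ T₂.2 fun a b x hab => ?_)
      have hne : s(a, b) ≠ s(v, w) := fun h' => he (h' ▸ hab)
      rw [← (hF2 T₁ j₁).2 a b x hne, ← (hF2 T₂ j₂).2 a b x hne]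
      exact h a b x (Finset.mem_insert_of_mem hab)
    let G : S × Fin A → TransitionSystem V := fun p => F p.1 p.2
    have hG : Function.Injective G := by
      rintro ⟨T₁, j₁⟩ ⟨T₂, j₂⟩ h
      obtain rfl : T₁ = T₂ := hinj T₁ j₁ T₂ j₂ fun a b x _ => by
        rw [show F T₁ j₁ = F T₂ j₂ from h]
      exact congrArg _ (hF1 T₁ (show F T₁ j₁ = F T₁ j₂ from h))
    refine ⟨Finset.univ.image G, ?_, ?_, ?_⟩
    · rw [Finset.card_image_of_injective _ hG, Finset.card_insert_of_notMem he, pow_succ]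
      simpa using Nat.mul_le_mul_right A hS
    · simp only [Finset.mem_image, Finset.mem_univ, true_and]
      rintro _ ⟨p, rfl⟩
      exact (hF2 p.1 p.2).1
    · simp only [Finset.mem_image, Finset.mem_univ, true_and]
      rintro _ ⟨⟨T₁, j₁⟩, rfl⟩ _ ⟨⟨T₂, j₂⟩, rfl⟩ h
      obtain rfl := hinj T₁ j₁ T₂ j₂ h
      ext a b x
      by_cases hab : s(a, b) = s(v, w)
      · exact h a b x (hab ▸ Finset.mem_insert_self _ _)
      · exact ((hF2 T₁ j₁).2 a b x hab).trans ((hF2 T₁ j₂).2 a b x hab).symm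

/-! ### A twist that destroys orientability -/

section Twist

/-- Reconnecting two of the transitions at the pair `v, w` such that the part of the trail at `v`
between them is reversed. -/
lemma IsOriented.unicursal_of_reversal (ho : IsAlternating o) (hT : T.IsCompatible o)
    (hU : T.IsUnicursalAt o v) (hvw : v ≠ w) {x y : V} (hxv : x ≠ v) (hxw : x ≠ w)
    (hx : o v w x = 1) (hyv : y ≠ v) (hyw : y ≠ w) (hy : o v w y = 1) (hxy : y ≠ x)
    (hnext : ∀ z, T'.next v w z = swap (T.next v w x) y (T.next v w (swap (T.next v w x) y z)))
    (hne : ∀ u z, u ≠ w → T'.next v u z = T.next v u z) :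
    ∃ r, ∀ a, IsArc v a → (T'.turn v).SameCycle r a ∨ (T'.turn v).SameCycle r a.swap := by
  obtain ⟨pos, hpos⟩ := exists_position hU hvw hxv hxw hx
  obtain ⟨h1, h2, h3⟩ := hpos y hyv hyw hy
  replace h3 := h3 hxy
  set p := pos y
  set f := T.turn v
  set L := Function.minimalPeriod f (w, x)
  have hL : (f ^ L) (w, x) = (w, x) := by
    rw [← Perm.iterate_eq_pow]; exact Function.iterate_minimalPeriod
  have nx : o v w (T.next v w x) = -1 := by rw [hT v w x hvw hxv hxw, hx]
  have ny : o v w (T.next v w y) = -1 := by rw [hT v w y hvw hyv hyw, hy]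
  have hpm : ∀ {a b}, o v w a = 1 → o v w b = -1 → a ≠ b := by
    rintro a b ha hb rfl; rw [ha] at hb; exact absurd hb (by decide)
  have hnxy : T.next v w y ≠ T.next v w x := fun h => hxy <| by
    rw [← T.next_next v w y, h, T.next_next]
  -- On the positive trail the new successor differs from the old one at two places only. There it
  -- jumps to an arc of the opposite trail, because the partners of `x` and `y` are negative.
  let C : V × V → V × V := fun a => if a = (w, x) then (w, T.next v w y) else
    if a = (w, y) then (w, T.next v w x) else a
  have ha : IsArc v (w, x) := ⟨hvw.symm, hxv, hxw.symm⟩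
  have hC : ∀ a, f.SameCycle (w, x) a → T'.turn v a = C (f a) := by
    rintro ⟨z, u⟩ hz
    have hz' := T.isArc_of_sameCycle hz ha
    have hoz := (sign_of_sameCycle ho hT hz ha).trans hx
    by_cases hu : u = w
    · subst hu
      have hoz' : o v u z = -1 := by
        rw [(ho v z u hz'.1.symm hz'.2.1 hz'.2.2.symm).2, hoz]
      have e1 : z ≠ y := (hpm hy hoz').symm
      simp only [turn_apply, f, C, Prod.mk.injEq, true_and, hnext]
      by_cases e2 : z = T.next v u x
      · subst e2
        rw [swap_apply_left, T.next_next, if_pos rfl,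
          swap_apply_of_ne_of_ne hnxy (hpm hy ny).symm]
      · rw [swap_apply_of_ne_of_ne e2 e1]
        have e3 : T.next v u z ≠ x := fun h => e2 (by rw [← h, T.next_next])
        have e4 : T.next v u z ≠ T.next v u x := by
          refine hpm ?_ nx
          rw [hT v u z hvw hz'.1 hz'.2.2, hoz', neg_neg]
        rw [if_neg e3]
        by_cases e5 : T.next v u z = y
        · rw [if_pos e5, e5, swap_apply_right]
        · rw [if_neg e5, swap_apply_of_ne_of_ne e4 e5]
    · simp [f, C, hne _ _ hu, hu]
  have hfix : ∀ k, 0 < k → k < L → k ≠ p → C ((f ^ k) (w, x)) = (f ^ k) (w, x) := by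
    intro k h0 hk hkp
    simp only [C]
    rw [if_neg, if_neg]
    · rw [← h2]; exact fun h => hkp (pow_injOn_minimalPeriod hk h1 h)
    · exact fun h => h0.ne' (pow_injOn_minimalPeriod (a := (w, x)) hk (by omega) h)
  have s1 : ∀ k < p, (T'.turn v).SameCycle (w, x) ((f ^ k) (w, x)) := fun k hk => by
    simpa using sameCycle_segment hC (Nat.zero_le k)
      fun l _ _ => hfix l (by omega) (by omega) (by omega)
  have s2 : ∀ k, p ≤ k → k < L → (T'.turn v).SameCycle (w, y) ((f ^ k) (w, x)) := fun k h hk => by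
    rw [← h2]
    exact sameCycle_segment hC h fun l _ _ => hfix l (by omega) (by omega) (by omega)
  have link := sameCycle_link hC h3
  rw [h2] at link
  simp only [C, if_neg (show (w, y) ≠ (w, x) by simpa using hxy), if_true] at link
  have link' := sameCycle_link hC (Nat.zero_lt_of_lt h1)
  rw [hL] at link'
  simp only [C, if_true] at link'
  -- The arc just before `(w, y)` is the reverse of the arc to which `C` sends `(w, x)`, so that
  -- jump begins the first segment run backwards.
  have e : (f ^ (p - 1)) (w, x) = (T.next v w y, w) := by
    have : f ((f ^ (p - 1)) (w, x)) = (w, y) := by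
      rw [← Perm.mul_apply, ← pow_succ', Nat.sub_add_cancel h3, h2]
    exact (Perm.eq_inv_iff_eq (f := f)).2 this
  rw [e] at link
  have s1' := s1 _ (Nat.sub_lt h3 one_pos)
  rw [e] at s1'
  refine ⟨(w, y), ?_⟩
  -- Arcs from position `p` on are met as they are, arcs before position `p` are met reversed.
  have pos : ∀ a, IsArc v a → o v a.1 a.2 = 1 →
      (T'.turn v).SameCycle (w, y) a ∨ (T'.turn v).SameCycle (w, y) a.swap := by
    intro a har hao
    obtain ⟨k, hk, rfl⟩ := exists_lt_minimalPeriod (hU _ _ ha har (hx.trans hao.symm))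
    rcases lt_or_ge k p with h | h
    · refine .inr ((s2 (L - 1) (by omega) (by omega)).trans (link'.trans ?_))
      exact T'.sameCycle_swap (s1'.symm.trans (s1 k h))
    · exact .inl (s2 k h hk)
  intro a har
  rcases Int.units_eq_one_or (o v a.1 a.2) with h | h
  · exact pos a har h
  · have := pos a.swap har.swap (by rw [sign_swap ho har, h, neg_neg])
    rwa [Prod.swap_swap, or_comm] at this

omit [Fintype V] [DecidableEq V] in
lemma eq_or_eq_swap_of_root {r : V × V}
    (h : ∀ a, IsArc v a → (T.turn v).SameCycle r a ∨ (T.turn v).SameCycle r a.swap) (a b : V × V)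
    (ha : IsArc v a) (hb : IsArc v b) :
    (T.turn v).SameCycle a b ∨ (T.turn v).SameCycle a b.swap := by
  rcases h a ha with h1 | h1 <;> rcases h b hb with h2 | h2
  · exact .inl (h1.symm.trans h2)
  · exact .inr (h1.symm.trans h2)
  · exact .inr (by simpa using T.sameCycle_swap (h1.symm.trans h2))
  · exact .inl (by simpa using T.sameCycle_swap (h1.symm.trans h2))

/-- A change at the pair `v, w` that makes an oriented system non-orientable. -/
theorem IsOriented.exists_twist (ho : IsAlternating o) (hT : T.IsOriented o) (hvw : v ≠ w)
    (hV : 6 ≤ Fintype.card V) : ∃ T' : TransitionSystem V, T'.IsUnicursal ∧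
      (∀ a b x, a ≠ b → x ≠ a → x ≠ b → T'.next a b x ≠ x) ∧
      (∀ o', IsAlternating o' → ¬ T'.IsCompatible o') ∧
      ∀ a b x, s(a, b) ≠ s(v, w) → T'.next a b x = T.next a b x := by
  have hcard := hT.compatible.card_positive hvw
  obtain ⟨x, hx, y, hy, hxy⟩ := Finset.one_lt_card.1 (show
    1 < (Finset.univ.filter fun x => x ≠ v ∧ x ≠ w ∧ o v w x = 1).card by omega)
  simp only [Finset.mem_filter, Finset.mem_univ, true_and] at hx hy
  obtain ⟨hxv, hxw, hx⟩ := hx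
  obtain ⟨hyv, hyw, hy⟩ := hy
  have ho' : ∀ t, t ≠ v → t ≠ w → -o w v t = o v w t := fun t h1 h2 => by
    rw [(ho v w t hvw h1 h2).1, neg_neg]
  have hv : swap (T.next v w x) y v = v :=
    swap_apply_of_ne_of_ne (T.next_ne_left hxv).symm hyv.symm
  have hw : swap (T.next v w x) y w = w :=
    swap_apply_of_ne_of_ne (T.next_ne_right hxw).symm hyw.symm
  -- With `x'`, `y'` the partners of `x`, `y`, the pairs `x x'` and `y y'` become `x y` and `x' y'`:
  -- points of equal sign are now matched.
  set T' := T.reroute v w hvw _ hv hw with hT'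
  have hturn : ∀ u, u ≠ v → u ≠ w → T'.turn u = T.turn u := fun u h1 h2 => by
    ext1 a
    have : s(u, a.2) ≠ s(v, w) := fun e => by
      rcases Sym2.eq_iff.1 e with ⟨e, -⟩ | ⟨e, -⟩
      exacts [h1 e, h2 e]
    simp [T', reroute_of_ne _ this]
  refine ⟨T', fun u => ?_, ?_, ?_, fun a b x => reroute_of_ne x⟩
  · by_cases h1 : u = v
    · subst h1
      obtain ⟨r, hr⟩ := unicursal_of_reversal (T' := T') ho hT.compatible (hT.unicursal u) hvw hxv
        hxw hx hyv hyw hy hxy.symm (fun z => reroute_left z) fun t z ht => reroute_of_ne z fun e => by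
          rcases Sym2.eq_iff.1 e with ⟨-, e⟩ | ⟨e, -⟩
          exacts [ht e, hvw e]
      exact eq_or_eq_swap_of_root hr
    by_cases h2 : u = w
    · subst h2
      obtain ⟨r, hr⟩ := unicursal_of_reversal (T' := T') ho.neg hT.compatible.neg
        (hT.unicursal u).neg hvw.symm hxw hxv ((ho' x hxv hxw).trans hx) hyw hyv
        ((ho' y hyv hyw).trans hy) hxy.symm
        (fun z => by rw [T.next_comm u v x]; exact reroute_right z)
        fun t z ht => reroute_of_ne z fun e => by
          rcases Sym2.eq_iff.1 e with ⟨e, -⟩ | ⟨-, e⟩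
          exacts [hvw e.symm, ht e]
      exact eq_or_eq_swap_of_root hr
    · rw [hturn u h1 h2]
      exact isUnicursal_of_forall ho hT.unicursal u
  · intro a b z hab hza hzb
    by_cases e : s(a, b) = s(v, w)
    · have : T'.next a b z = swap (T.next v w x) y (T.next a b ((swap (T.next v w x) y)⁻¹ z)) :=
        if_pos e
      rw [this]
      intro h
      rw [← Perm.eq_inv_iff_eq] at h
      refine hT.compatible.next_ne hab ?_ ?_ h <;> rw [Ne, Perm.inv_eq_iff_eq] <;>
        rcases Sym2.eq_iff.1 e with ⟨rfl, rfl⟩ | ⟨rfl, rfl⟩ <;> simpa [hv, hw]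
    · rw [show T'.next a b z = _ from reroute_of_ne z e]
      exact hT.compatible.next_ne hab hza hzb
  · intro o' hA hcomp
    -- At a point other than `v` and `w` the trails are unchanged, so there an orientation `o'` of
    -- the new system is a constant multiple of `o`.
    have ratio : ∀ u, u ≠ v → u ≠ w → ∀ a b, IsArc u a → IsArc u b →
        o' u a.1 a.2 * o u a.1 a.2 = o' u b.1 b.2 * o u b.1 b.2 := by
      intro u h1 h2 a b ha hb
      have same : ∀ b, IsArc u b → o u a.1 a.2 = o u b.1 b.2 →
          o' u a.1 a.2 * o u a.1 a.2 = o' u b.1 b.2 * o u b.1 b.2 := fun b hb hab => by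
        have := hT.unicursal u a b ha hb hab
        rw [← hturn u h1 h2] at this
        rw [sign_of_sameCycle hA hcomp this ha, hab]
      by_cases hab : o u a.1 a.2 = o u b.1 b.2
      · exact same b hb hab
      · rw [same b.swap hb.swap (by rw [sign_swap ho hb]; exact Int.units_ne_iff_eq_neg.1 hab),
          sign_swap ho hb, sign_swap hA hb, neg_mul_neg]
    -- At `x` the factor links the triples `vwx` and `vxy`, at `y` it links `vwy` and `vxy`. So `o'`
    -- agrees on `vwx` and `vwy`, as `o` does, although the new transition at `vw` from `x` to `y`
    -- demands opposite signs.
    have e1 := ratio x hxv hxw (v, w) (y, v) ⟨hxv.symm, hxw.symm, hvw⟩ ⟨hxy.symm, hxv.symm, hyv⟩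
    have e2 := ratio y hyv hyw (v, w) (x, v) ⟨hyv.symm, hyw.symm, hvw⟩ ⟨hxy, hyv.symm, hxv⟩
    have cyc : ∀ o : V → V → V → ℤˣ, IsAlternating o → ∀ z, z ≠ v → z ≠ w → o z v w = o v w z :=
      fun o ho z h1 h2 => by
        rw [(ho v z w h1.symm hvw.symm h2.symm).1, (ho v w z hvw h1 h2).2, neg_neg]
    simp only [cyc o ho _ hxv hxw, cyc o' hA _ hxv hxw, cyc o ho _ hyv hyw,
      cyc o' hA _ hyv hyw, (ho x y v hxy hxv.symm hyv.symm).1,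
      (hA x y v hxy hxv.symm hyv.symm).1, neg_mul_neg] at e1 e2
    rw [← e2, hx, hy, mul_one, mul_one] at e1
    have e3 : T'.next v w x = y := by
      rw [show T'.next v w x = _ from reroute_left x, swap_inv,
        swap_apply_of_ne_of_ne (hT.compatible.next_ne hvw hxv hxw).symm hxy, swap_apply_left]
    have := hcomp v w x hvw hxv hxw
    rw [e3, e1] at this
    exact units_ne_neg_self _ this

end Twist

end TransitionSystem

/-! ### The inductive step from `n` to `n + 2` points: sign, tour and new involutions -/

/-- The parity of `paritySum i j k` changes if two of the distinct numbers `i, j, k` are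
exchanged. -/
def paritySum (i j k : ℕ) : ℕ :=
  i + j + k + (if j < i then 1 else 0) + (if k < j then 1 else 0) + (if k < i then 1 else 0)

/-- The transitions of an Euler tour of the complete graph on `{0, …, n - 1}` and the point
`z ≥ n`, for even `n`: at the point `u`, the neighbours `w` and `tourNext n z u w` are
consecutive. -/
def tourNext (n z u w : ℕ) : ℕ :=
  if u = z then if w = 0 then n - 1 else if w = n - 1 then 0 else if w % 2 = 1 then w + 1 else w - 1
  else if u % 2 = 0 then
    if u + 1 < w ∧ w < n then if w % 2 = 0 then w + 1 else w - 1
    else if w = z then if u = 0 then 1 else 0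
    else if w = u + 1 then if u = 0 then z else u - 1
    else if w = 0 then z else if w % 2 = 0 then w - 1 else if w = u - 1 then u + 1 else w + 1
  else
    if u < w ∧ w < n then if w % 2 = 0 then w + 1 else w - 1
    else if w = z then u - 1
    else if w = u - 1 then z
    else if w % 2 = 0 then w + 1 else w - 1

/-- The edges at odd places of the tour `tourNext`, which starts at `z`. -/
def IsOddEdge (i j : ℕ) : Prop :=
  i % 2 = j % 2 ∨ (i = j + 1 ∧ i % 2 = 1) ∨ (j = i + 1 ∧ j % 2 = 1)

instance (i j : ℕ) : Decidable (IsOddEdge i j) := by unfold IsOddEdge; infer_instance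

lemma isOddEdge_comm {i j : ℕ} : IsOddEdge i j ↔ IsOddEdge j i := by
  unfold IsOddEdge; omega

lemma paritySum_comm_left {i j k : ℕ} (h : i ≠ j) :
    paritySum j i k % 2 ≠ paritySum i j k % 2 := by
  unfold paritySum; split_ifs <;> omega

lemma paritySum_comm_right {i j k : ℕ} (h : j ≠ k) :
    paritySum i k j % 2 ≠ paritySum i j k % 2 := by
  unfold paritySum; split_ifs <;> omega

section Tour

variable {n z u w : ℕ}

lemma tourNext_self (hn : Even n) (hw : w < n) : tourNext n z z w < n ∧
    tourNext n z z w ≠ w ∧ tourNext n z z (tourNext n z z w) = w ∧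
    tourNext n z z w % 2 ≠ w % 2 := by
  rw [Nat.even_iff] at hn
  generalize hy : tourNext n z z w = y
  unfold tourNext at *
  rw [if_pos rfl] at *
  split_ifs at * <;> omega

lemma tourNext_valid (hn : Even n) (hu : u < n) (hw : w < n ∨ w = z) (hz : n ≤ z) (huw : w ≠ u) :
    (tourNext n z u w < n ∨ tourNext n z u w = z) ∧ tourNext n z u w ≠ u ∧
    tourNext n z u w ≠ w := by
  rw [Nat.even_iff] at hn
  generalize hy : tourNext n z u w = y
  unfold tourNext at *
  split_ifs at hy <;> omega

set_option maxHeartbeats 1000000 in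
lemma tourNext_tourNext (hn : Even n) (hu : u < n) (hw : w < n ∨ w = z) (hz : n ≤ z)
    (huw : w ≠ u) : tourNext n z u (tourNext n z u w) = w := by
  rw [Nat.even_iff] at hn
  generalize hy : tourNext n z u w = y
  unfold tourNext at *
  have : u ≠ z := by omega
  rw [if_neg this] at *
  split_ifs at hy <;> first | omega | (split_ifs <;> omega)

/-- The root is a mere label, so the tours at the two new points agree on the old points up to the
name of the root. -/
lemma tourNext_congr {z' : ℕ} (hn : Even n) (hu : u < n) (hw : w < n) (hz : n ≤ z) (hz' : n ≤ z') :
    (tourNext n z u w < n ∧ tourNext n z' u w = tourNext n z u w) ∨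
      (tourNext n z u w = z ∧ tourNext n z' u w = z') := by
  rw [Nat.even_iff] at hn
  have h1 : u ≠ z := by omega
  have h2 : u ≠ z' := by omega
  have h3 : w ≠ z := by omega
  have h4 : w ≠ z' := by omega
  unfold tourNext
  simp only [if_neg h1, if_neg h2, if_neg h3, if_neg h4]
  split_ifs <;> omega

/-- Away from the root, each transition at an old point joins an odd edge to an even one. Detours
can therefore start and end at odd edges and turn round at even ones. -/
lemma isOddEdge_of_tourNext (hn : Even n) (hu : u < n) (hw : w < n) (hz : n ≤ z)
    (huw : w ≠ u) (h : tourNext n z u w < n) :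
    IsOddEdge u (tourNext n z u w) ↔ ¬ IsOddEdge u w := by
  rw [Nat.even_iff] at hn
  generalize hy : tourNext n z u w = y at *
  unfold tourNext IsOddEdge at *
  split_ifs at hy <;> omega

lemma isOddEdge_tourNext_root (hn : Even n) (hu : u < n) (hz : n ≤ z) :
    tourNext n z u z < n ∧ IsOddEdge u (tourNext n z u z) := by
  rw [Nat.even_iff] at hn
  generalize hy : tourNext n z u z = y at *
  unfold tourNext IsOddEdge at *
  split_ifs at hy <;> omega

/-- The tour leads from one kind of edges, as to the direction, to the other. -/
lemma paritySum_tourNext {p : ℕ} (hn : Even n) (hu : u < n) (hw : w < n) (hz : n ≤ z)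
    (huw : w ≠ u) (hp : n ≤ p) (h : tourNext n z u w < n) :
    paritySum p u (tourNext n z u w) % 2 ≠ paritySum p u w % 2 := by
  rw [Nat.even_iff] at hn
  generalize hy : tourNext n z u w = y at *
  unfold tourNext at hy
  have e1 : u < p := by omega
  have e2 : w < p := by omega
  have e3 : y < p := by omega
  unfold paritySum
  rw [if_pos e1, if_pos e2, if_pos e3]
  split_ifs at hy <;> split_ifs <;> omega

lemma paritySum_tourNext_root {p : ℕ} (hn : Even n) (hu : u < n) (hpz : p ≠ z)
    (hp : p = n ∨ p = n + 1) (hz : z = n ∨ z = n + 1) :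
    paritySum p u (tourNext n z u z) % 2 ≠ paritySum p u z % 2 := by
  have h := (isOddEdge_tourNext_root hn hu (show n ≤ z by omega)).1
  rw [Nat.even_iff] at hn
  generalize hy : tourNext n z u z = y at *
  unfold tourNext at hy
  have e1 : u < p := by omega
  have e2 : ¬ z < u := by omega
  have e3 : y < p := by omega
  unfold paritySum
  rw [if_pos e1, if_neg e2, if_pos e3]
  split_ifs at hy <;> split_ifs <;> omega

end Tour

section Extend

variable {n : ℕ} {f : ℕ → ℕ → ℕ → ℕ} {i j x : ℕ}

/-- The distinguished point outside `{i, j}` at whose transition new points are inserted. -/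
def splicePoint (i j : ℕ) : ℕ := if i ≠ 0 ∧ j ≠ 0 then 0 else if i ≠ 1 ∧ j ≠ 1 then 1 else 2

/-- The new point that is joined to `splicePoint i j`. -/
def splicePartner (n i j : ℕ) : ℕ :=
  if paritySum i j n % 2 = paritySum i j (splicePoint i j) % 2 then n + 1 else n

/-- The involution at `i, j` after the new points `n` and `n + 1` have been inserted. -/
def extendNext (n : ℕ) (f : ℕ → ℕ → ℕ → ℕ) (i j x : ℕ) : ℕ :=
  if n ≤ i ∧ n ≤ j then tourNext n n n x
  -- `2 * n + 1 - i` is the other new point. It is the root of the tour at `i`.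
  else if n ≤ i then tourNext n (2 * n + 1 - i) j x
  else if n ≤ j then tourNext n (2 * n + 1 - j) i x
  else if IsOddEdge i j then
    if x = splicePoint i j then splicePartner n i j
    else if x = f i j (splicePoint i j) then 2 * n + 1 - splicePartner n i j
    else if x = splicePartner n i j then splicePoint i j
    else if x = 2 * n + 1 - splicePartner n i j then f i j (splicePoint i j)
    else f i j x
  else if x < n then f i j x else 2 * n + 1 - x

lemma splicePoint_comm (i j : ℕ) : splicePoint j i = splicePoint i j := by
  unfold splicePoint; split_ifs <;> omega

lemma splicePoint_spec (h4 : 4 ≤ n) (i j : ℕ) :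
    splicePoint i j < n ∧ splicePoint i j ≠ i ∧ splicePoint i j ≠ j := by
  unfold splicePoint; split_ifs <;> omega

lemma splicePartner_comm (hij : i ≠ j) :
    splicePartner n j i = splicePartner n i j := by
  have h1 := paritySum_comm_left (k := n) hij
  have h2 := paritySum_comm_left (k := splicePoint i j) hij
  unfold splicePartner
  rw [splicePoint_comm]
  split_ifs <;> omega

lemma paritySum_succ (hi : i < n) (hj : j < n) :
    paritySum i j (n + 1) = paritySum i j n + 1 := by
  unfold paritySum; split_ifs <;> omega

/-- The triples that `i, j` form with `n` and with `n + 1` have opposite parity, so exactly one new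
point may be matched with the splice point; the other is left for the former partner of the splice
point. -/
lemma splicePartner_spec (hi : i < n) (hj : j < n) :
    (splicePartner n i j = n ∨ splicePartner n i j = n + 1) ∧
    paritySum i j (splicePartner n i j) % 2 ≠ paritySum i j (splicePoint i j) % 2 ∧
    paritySum i j (2 * n + 1 - splicePartner n i j) % 2 =
      paritySum i j (splicePoint i j) % 2 := by
  have := paritySum_succ hi hj
  unfold splicePartner
  split_ifs with h
  · rw [show 2 * n + 1 - (n + 1) = n by omega]; omega
  · rw [show 2 * n + 1 - n = n + 1 by omega]; omega

/-- The restriction of `f` to numbers less than `n` consists of involutions that change the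
parity of triples. -/
def IsParityChanging (n : ℕ) (f : ℕ → ℕ → ℕ → ℕ) : Prop :=
  ∀ i j x, i < n → j < n → x < n → i ≠ j → x ≠ i → x ≠ j → f i j x < n ∧ f i j x ≠ i ∧
    f i j x ≠ j ∧ f i j (f i j x) = x ∧ paritySum i j (f i j x) % 2 ≠ paritySum i j x % 2

lemma extendNext_comm (hf : ∀ i j x, f i j x = f j i x) (hij : i ≠ j) :
    extendNext n f i j x = extendNext n f j i x := by
  unfold extendNext
  by_cases hi : n ≤ i <;> by_cases hj : n ≤ j
  · simp [hi, hj]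
  · simp [hi, hj]
  · simp [hi, hj]
  · simp only [hi, hj, false_and, if_false, isOddEdge_comm (i := i), splicePoint_comm j i,
      hf i j, splicePartner_comm hij.symm]

lemma isParityChanging_extendNext (hn : Even n) (h4 : 4 ≤ n) (hf : IsParityChanging n f)
    (hcomm : ∀ i j x, f i j x = f j i x) : IsParityChanging (n + 2) (extendNext n f) := by
  -- A pair with a new point follows the tour, on either of its two kinds of transition: between old
  -- points, and through the root. The pairs with the new point in second place follow by symmetry.
  have outer : ∀ i j x, n ≤ i → i < n + 2 → j < n + 2 → x < n + 2 → i ≠ j → x ≠ i → x ≠ j →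
      extendNext n f i j x < n + 2 ∧ extendNext n f i j x ≠ i ∧ extendNext n f i j x ≠ j ∧
      extendNext n f i j (extendNext n f i j x) = x ∧
      paritySum i j (extendNext n f i j x) % 2 ≠ paritySum i j x % 2 := by
    intro i j x hni hi hj hx hij hxi hxj
    by_cases hnj : n ≤ j
    · have hxn : x < n := by omega
      obtain ⟨h1, h2, h3, h4⟩ := tourNext_self (z := n) hn hxn
      have key : ∀ y, extendNext n f i j y = tourNext n n n y := fun y => by
        simp [extendNext, hni, hnj]
      rw [key, key]
      refine ⟨by omega, by omega, by omega, h3, ?_⟩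
      unfold paritySum
      split_ifs <;> omega
    · have key : ∀ y, extendNext n f i j y = tourNext n (2 * n + 1 - i) j y := fun y => by
        simp [extendNext, hni, hnj]
      obtain ⟨h1, h2, h3⟩ := tourNext_valid (z := 2 * n + 1 - i) (u := j) (w := x) hn (by omega)
        (by omega) (by omega) hxj
      rw [key, key, tourNext_tourNext hn (by omega) (by omega) (by omega) hxj]
      refine ⟨by omega, by omega, by omega, rfl, ?_⟩
      rcases lt_or_ge x n with hxn | hxn
      · rcases h1 with h1 | h1
        · exact paritySum_tourNext hn (by omega) hxn (by omega) hxj hni h1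
        · have e := tourNext_tourNext (z := 2 * n + 1 - i) (u := j) (w := x) hn (by omega)
            (by omega) (by omega) hxj
          rw [h1] at e ⊢
          have := paritySum_tourNext_root (p := i) (z := 2 * n + 1 - i) (u := j) hn (by omega)
            (by omega) (by omega) (by omega)
          rw [e] at this
          exact this.symm
      · obtain rfl : x = 2 * n + 1 - i := by omega
        exact paritySum_tourNext_root hn (by omega) (by omega) (by omega) (by omega)
  intro i j x hi hj hx hij hxi hxj
  by_cases hni : n ≤ i
  · exact outer i j x hni hi hj hx hij hxi hxj
  by_cases hnj : n ≤ j
  · obtain ⟨h1, h2, h3, h4, h5⟩ := outer j i x hnj hj hi hx hij.symm hxj hxi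
    rw [extendNext_comm hcomm hij, extendNext_comm hcomm hij]
    refine ⟨h1, h3, h2, h4, ?_⟩
    have e1 := paritySum_comm_left (k := x) hij
    have e2 := paritySum_comm_left (k := extendNext n f j i x) hij
    omega
  rw [not_le] at hni hnj
  obtain ⟨a1, a2, a3⟩ := splicePoint_spec h4 i j
  obtain ⟨b1, b2, b3, b4, b5⟩ := hf i j _ hni hnj a1 hij a2 a3
  obtain ⟨p1, p2, p3⟩ := splicePartner_spec hni hnj
  have hfx := fun h => hf i j x hni hnj h hij hxi hxj
  have hsucc := paritySum_succ hni hnj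
  by_cases hodd : IsOddEdge i j
  · have key : ∀ y, extendNext n f i j y = if y = splicePoint i j then splicePartner n i j
        else if y = f i j (splicePoint i j) then 2 * n + 1 - splicePartner n i j
        else if y = splicePartner n i j then splicePoint i j
        else if y = 2 * n + 1 - splicePartner n i j then f i j (splicePoint i j)
        else f i j y := fun y => by
      simp only [extendNext, not_le.2 hni, not_le.2 hnj, if_false, false_and, if_pos hodd]
    have inj : x < n → f i j x = splicePoint i j → x = f i j (splicePoint i j) := fun h e => by
      rw [← e, (hfx h).2.2.2.1]
    have inj' : x < n → f i j x = f i j (splicePoint i j) → x = splicePoint i j := fun h e => by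
      rw [← (hfx h).2.2.2.1, e, b4]
    have hax : splicePoint i j ≠ f i j (splicePoint i j) := fun h => by rw [← h] at b5; omega
    generalize splicePoint i j = a at *
    generalize f i j a = b at *
    generalize splicePartner n i j = p at *
    by_cases c1 : x = a
    · subst c1
      have e : extendNext n f i j x = p := by rw [key, if_pos rfl]
      rw [e, key, if_neg (by omega), if_neg (by omega), if_pos rfl]
      exact ⟨by omega, by omega, by omega, rfl, p2⟩
    by_cases c2 : x = b
    · subst c2
      have e : extendNext n f i j x = 2 * n + 1 - p := by rw [key, if_neg c1, if_pos rfl]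
      rw [e, key, if_neg (by omega), if_neg (by omega), if_neg (by omega), if_pos rfl]
      exact ⟨by omega, by omega, by omega, rfl, by omega⟩
    by_cases c3 : x = p
    · subst c3
      have e : extendNext n f i j x = a := by rw [key, if_neg c1, if_neg c2, if_pos rfl]
      rw [e, key, if_pos rfl]
      exact ⟨by omega, by omega, by omega, rfl, by omega⟩
    by_cases c4 : x = 2 * n + 1 - p
    · have e : extendNext n f i j x = b := by rw [key, if_neg c1, if_neg c2, if_neg c3, if_pos c4]
      rw [e, key, if_neg (by omega), if_pos rfl]
      refine ⟨by omega, by omega, by omega, c4.symm, ?_⟩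
      rw [c4]
      omega
    · have hxn : x < n := by omega
      have e : extendNext n f i j x = f i j x := by
        rw [key, if_neg c1, if_neg c2, if_neg c3, if_neg c4]
      obtain ⟨f1, f2, f3, f4, f5⟩ := hfx hxn
      rw [e, key, if_neg fun h => c2 (inj hxn h), if_neg fun h => c1 (inj' hxn h),
        if_neg (by omega), if_neg (by omega)]
      exact ⟨by omega, f2, f3, f4, f5⟩
  · have key : ∀ y, extendNext n f i j y = if y < n then f i j y else 2 * n + 1 - y := fun y => by
      simp only [extendNext, not_le.2 hni, not_le.2 hnj, if_false, false_and, if_neg hodd]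
    rcases lt_or_ge x n with hxn | hxn
    · have e : extendNext n f i j x = f i j x := by rw [key, if_pos hxn]
      obtain ⟨f1, f2, f3, f4, f5⟩ := hfx hxn
      rw [e, key, if_pos f1]
      exact ⟨by omega, f2, f3, f4, f5⟩
    · have e : extendNext n f i j x = 2 * n + 1 - x := by rw [key, if_neg (by omega)]
      rw [e, key, if_neg (by omega)]
      refine ⟨by omega, by omega, by omega, by omega, ?_⟩
      rcases (show x = n ∨ x = n + 1 by omega) with rfl | rfl
      · rw [show 2 * x + 1 - x = x + 1 by omega]; omega
      · rw [show 2 * n + 1 - (n + 1) = n by omega]; omega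

/-- A family of involutions of the numbers less than `n` as a transition system. -/
def TransitionSystem.ofNat (n : ℕ) (f : ℕ → ℕ → ℕ → ℕ) (hf : IsParityChanging n f)
    (hcomm : ∀ i j x, i ≠ j → f i j x = f j i x) : TransitionSystem ℕ where
  next i j x := if i < n ∧ j < n ∧ x < n ∧ i ≠ j ∧ x ≠ i ∧ x ≠ j then f i j x else x
  next_comm i j x := by
    by_cases h : i < n ∧ j < n ∧ x < n ∧ i ≠ j ∧ x ≠ i ∧ x ≠ j
    · rw [if_pos h, if_pos (by omega), hcomm i j x h.2.2.2.1]
    · rw [if_neg h, if_neg (by omega)]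
  next_next i j x := by
    by_cases h : i < n ∧ j < n ∧ x < n ∧ i ≠ j ∧ x ≠ i ∧ x ≠ j
    · obtain ⟨a1, a2, a3, a4, a5, a6⟩ := h
      obtain ⟨h1, h2, h3, h4, -⟩ := hf i j x a1 a2 a3 a4 a5 a6
      rw [if_pos (⟨a1, a2, a3, a4, a5, a6⟩ : i < n ∧ j < n ∧ x < n ∧ i ≠ j ∧ x ≠ i ∧ x ≠ j),
        if_pos ⟨a1, a2, h1, a4, h2, h3⟩, h4]
    · rw [if_neg h, if_neg h]
  next_left i j := by simp
  next_self i x := by simp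

end Extend

/-! ### The extended trails at the old points -/

namespace TransitionSystem

/-- The restriction of `T` to the numbers less than `n` is an oriented system. -/
structure IsOrientedBelow (T : TransitionSystem ℕ) (n : ℕ) : Prop where
  parityChanging : IsParityChanging n T.next
  unicursal : ∀ v < n, ∀ a b : ℕ × ℕ, IsArc v a → IsArc v b → a.1 < n → a.2 < n → b.1 < n →
    b.2 < n → paritySum v a.1 a.2 % 2 = paritySum v b.1 b.2 % 2 → (T.turn v).SameCycle a b

variable {T : TransitionSystem ℕ} {n v : ℕ}

lemma below_of_sameCycle (hT : IsParityChanging n T.next) (hv : v < n) {a b : ℕ × ℕ}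
    (h : (T.turn v).SameCycle a b) (ha : IsArc v a) (ha1 : a.1 < n) (ha2 : a.2 < n) :
    IsArc v b ∧ b.1 < n ∧ b.2 < n ∧ paritySum v b.1 b.2 % 2 = paritySum v a.1 a.2 % 2 := by
  refine T.induction_sameCycle (P := fun b => IsArc v b ∧ b.1 < n ∧ b.2 < n ∧
    paritySum v b.1 b.2 % 2 = paritySum v a.1 a.2 % 2) h ⟨ha, ha1, ha2, rfl⟩ ?_ ?_
  · rintro ⟨x, y⟩ ⟨hb, hx, hy, hp⟩
    refine ⟨T.isArc_turn hb, hy, ?_, ?_⟩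
    · exact (hT v y x hv hy hx hb.2.1.symm hb.1 hb.2.2).1
    · have h1 := (hT v y x hv hy hx hb.2.1.symm hb.1 hb.2.2).2.2.2.2
      have h2 := paritySum_comm_right (i := v) hb.2.2
      simp only [turn_apply] at *
      omega
  · rintro ⟨x, y⟩ ⟨hb, hx, hy, hp⟩
    have hbi := T.isArc_turn_inv hb
    refine ⟨hbi, ?_, hx, ?_⟩
    · exact (hT v x y hv hx hy hb.1.symm hb.2.1 hb.2.2.symm).1
    · have h1 := (hT v x y hv hx hy hb.1.symm hb.2.1 hb.2.2.symm).2.2.2.2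
      have h2 := paritySum_comm_right (i := v) hbi.2.2
      simp only [turn_inv_apply] at *
      omega

section Extend

variable {T' : TransitionSystem ℕ} (hn : Even n) (h4 : 4 ≤ n)
  (hT' : ∀ i j x, i < n + 2 → j < n + 2 → x < n + 2 → i ≠ j → x ≠ i → x ≠ j →
    T'.next i j x = extendNext n T.next i j x)

include hT'

lemma sameCycle_step {x y u : ℕ} (hv : v < n + 2) (hx : x < n + 2) (hy : y < n + 2)
    (hxv : x ≠ v) (hyv : y ≠ v) (hxy : x ≠ y) (hu : extendNext n T.next v y x = u) :
    (T'.turn v).SameCycle (x, y) (y, u) := by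
  have : T'.turn v (x, y) = (y, u) := by
    rw [turn_apply, hT' v y x hv hy hx hyv.symm hxv hxy, hu]
  rw [← this]
  exact Perm.sameCycle_apply_right.2 (.refl _ _)

include hn

/-- Let `y'` be the other new point. If the tours match `j` at `v` with an old point `k`, then `vk`
is even and its involution exchanges `y` and `y'`; the trail at `v` runs `j, y, k, y', j`. If they
match `j` with the root, it runs `j, y, y', j`. -/
lemma sameCycle_detour (hv : v < n) {j y : ℕ} (hj : j < n) (hjv : j ≠ v) (hodd : IsOddEdge v j)
    (hy : n ≤ y) (hy' : y < n + 2) :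
    (T'.turn v).SameCycle (j, y) (2 * n + 1 - y, j) := by
  have e1 : extendNext n T.next v y j = tourNext n (2 * n + 1 - y) v j := by
    simp [extendNext, not_le.2 hv, hy]
  have e2 : ∀ x, extendNext n T.next v (2 * n + 1 - y) x = tourNext n y v x := fun x => by
    have : n ≤ 2 * n + 1 - y := by omega
    simp only [extendNext, not_le.2 hv, false_and, if_false, if_pos this]
    rw [show 2 * n + 1 - (2 * n + 1 - y) = y by omega]
  have s1 := sameCycle_step hT' (v := v) (x := j) (y := y) (by omega) (by omega) hy' hjv
    (by omega) (by omega) e1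
  obtain ⟨hk1, hk2, hk3⟩ := tourNext_valid (z := 2 * n + 1 - y) hn hv (.inl hj) (by omega) hjv
  have hinv := tourNext_tourNext (z := y) hn hv (.inl hj) (by omega) hjv
  rcases tourNext_congr (z := 2 * n + 1 - y) (z' := y) hn hv hj (by omega) hy with
    ⟨h1, h2⟩ | ⟨h1, h2⟩
  · have hodd' := (isOddEdge_of_tourNext (z := 2 * n + 1 - y) hn hv hj (by omega) hjv h1).not_left.2
      hodd
    rw [h2] at hinv
    generalize tourNext n (2 * n + 1 - y) v j = k at *
    have s2 := sameCycle_step hT' (v := v) (x := y) (y := k) (u := 2 * n + 1 - y) (by omega) hy'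
      (by omega) (by omega) (by omega) (by omega)
      (by simp only [extendNext, not_le.2 hv, not_le.2 h1, false_and, if_false, if_neg hodd',
            not_lt.2 hy])
    have s3 := sameCycle_step hT' (v := v) (x := k) (y := 2 * n + 1 - y) (u := j) (by omega)
      (by omega) (by omega) (by omega) (by omega) (by omega) (by rw [e2, hinv])
    exact s1.trans (s2.trans s3)
  · rw [h2] at hinv
    rw [h1] at s1
    exact s1.trans (sameCycle_step hT' (v := v) (x := y) (y := 2 * n + 1 - y) (u := j) (by omega)
      (by omega) (by omega) (by omega) (by omega) (by omega) (by rw [e2, hinv]))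

include h4

/-- Each old transition is either kept or, at the splice point of an odd pair and at its partner,
interrupted by a detour. The detour leaves `j` for one new point and comes back from the other,
whence the trail goes on as before. -/
lemma extend_sameCycle_of_sameCycle (hT : IsParityChanging n T.next) (hv : v < n) {a b : ℕ × ℕ}
    (h : (T.turn v).SameCycle a b) (ha : IsArc v a) (ha1 : a.1 < n) (ha2 : a.2 < n) :
    (T'.turn v).SameCycle a b := by
  have step : ∀ x j, IsArc v (x, j) → x < n → j < n →
      (T'.turn v).SameCycle (x, j) (j, T.next v j x) := by
    rintro x j ⟨hxv, hjv, hxj⟩ hx hj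
    simp only at hxv hjv hxj
    by_cases hodd : IsOddEdge v j
    · obtain ⟨a1, a2, a3⟩ := splicePoint_spec h4 v j
      obtain ⟨b1, b2, b3, b4, b5⟩ := hT v j _ hv hj a1 hjv.symm a2 a3
      obtain ⟨p1, -, -⟩ := splicePartner_spec hv hj
      have key : ∀ y, extendNext n T.next v j y =
          if y = splicePoint v j then splicePartner n v j
          else if y = T.next v j (splicePoint v j) then 2 * n + 1 - splicePartner n v j
          else if y = splicePartner n v j then splicePoint v j
          else if y = 2 * n + 1 - splicePartner n v j then T.next v j (splicePoint v j)
          else T.next v j y := fun y => by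
        simp only [extendNext, not_le.2 hv, not_le.2 hj, if_false, false_and, if_pos hodd]
      have hab : splicePoint v j ≠ T.next v j (splicePoint v j) := fun h => by
        rw [← h] at b5; omega
      have d1 := sameCycle_detour (T := T) hn hT' hv hj hjv hodd
        (y := splicePartner n v j) (by omega) (by omega)
      have d2 := sameCycle_detour (T := T) hn hT' hv hj hjv hodd
        (y := 2 * n + 1 - splicePartner n v j) (by omega) (by omega)
      rw [show 2 * n + 1 - (2 * n + 1 - splicePartner n v j) = splicePartner n v j by omega] at d2
      generalize splicePoint v j = a at *
      by_cases c1 : x = a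
      · subst c1
        have s1 := sameCycle_step hT' (v := v) (x := x) (y := j) (by omega) (by omega) (by omega)
          hxv hjv hxj (by rw [key, if_pos rfl])
        have s2 := sameCycle_step hT' (v := v) (x := 2 * n + 1 - splicePartner n v j) (y := j)
          (u := T.next v j x)
          (by omega) (by omega) (by omega) (by omega) hjv (by omega)
          (by rw [key, if_neg (by omega), if_neg (by omega), if_neg (by omega), if_pos rfl])
        exact s1.trans (d1.trans s2)
      by_cases c2 : x = T.next v j a
      · subst c2
        have s1 := sameCycle_step hT' (v := v) (x := T.next v j a) (y := j) (by omega) (by omega)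
          (by omega) hxv hjv hxj (by rw [key, if_neg hab.symm, if_pos rfl])
        have s2 := sameCycle_step hT' (v := v) (x := splicePartner n v j) (y := j) (u := a)
          (by omega) (by omega) (by omega) (by omega) hjv (by omega)
          (by rw [key, if_neg (by omega), if_neg (by omega), if_pos rfl])
        rw [b4]
        exact s1.trans (d2.trans s2)
      · exact sameCycle_step hT' (by omega) (by omega) (by omega) hxv hjv hxj
          (by rw [key, if_neg c1, if_neg c2, if_neg (by omega), if_neg (by omega)])
    · exact sameCycle_step hT' (by omega) (by omega) (by omega) hxv hjv hxj
        (by simp only [extendNext, not_le.2 hv, not_le.2 hj, if_false, false_and, if_neg hodd,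
              if_pos hx])
  refine (T.induction_sameCycle (P := fun b => (T.turn v).SameCycle a b ∧
    (T'.turn v).SameCycle a b) h ⟨.refl _ _, .refl _ _⟩ ?_ ?_).2
  · rintro ⟨x, j⟩ ⟨h1, h2⟩
    obtain ⟨e1, e2, e3, -⟩ := below_of_sameCycle hT hv h1 ha ha1 ha2
    exact ⟨Perm.sameCycle_apply_right.2 h1, h2.trans (step x j e1 e2 e3)⟩
  · rintro ⟨x, j⟩ ⟨h1, h2⟩
    have h3 : (T.turn v).SameCycle a ((T.turn v)⁻¹ (x, j)) := h1.trans ⟨-1, by simp⟩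
    obtain ⟨e1, e2, e3, -⟩ := below_of_sameCycle hT hv h3 ha ha1 ha2
    refine ⟨h3, h2.trans ?_⟩
    have := step _ _ e1 e2 e3
    simp only [next_next] at this
    exact this.symm

/-- Every arc with a new end lies on a detour. Those at odd pairs are next to an old arc; the others
lead to these in a few steps. -/
lemma exists_old_arc (hT : IsParityChanging n T.next) (hv : v < n) {a : ℕ × ℕ}
    (ha : IsArc v a) (ha1 : a.1 < n + 2) (ha2 : a.2 < n + 2) :
    ∃ b, IsArc v b ∧ b.1 < n ∧ b.2 < n ∧ (T'.turn v).SameCycle a b := by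
  have odd : ∀ j y, j < n → j ≠ v → n ≤ y → y < n + 2 → IsOddEdge v j →
      ∃ x, x < n ∧ x ≠ v ∧ x ≠ j ∧ extendNext n T.next v j x = y ∧
        extendNext n T.next v j y = x := by
    intro j y hj hjv hy hy' hodd
    obtain ⟨a1, a2, a3⟩ := splicePoint_spec h4 v j
    obtain ⟨b1, b2, b3, b4, b5⟩ := hT v j _ hv hj a1 hjv.symm a2 a3
    obtain ⟨p1, -, -⟩ := splicePartner_spec hv hj
    have key : ∀ y, extendNext n T.next v j y =
        if y = splicePoint v j then splicePartner n v j
        else if y = T.next v j (splicePoint v j) then 2 * n + 1 - splicePartner n v j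
        else if y = splicePartner n v j then splicePoint v j
        else if y = 2 * n + 1 - splicePartner n v j then T.next v j (splicePoint v j)
        else T.next v j y := fun y => by
      simp only [extendNext, not_le.2 hv, not_le.2 hj, if_false, false_and, if_pos hodd]
    have hab : splicePoint v j ≠ T.next v j (splicePoint v j) := fun h => by
      rw [← h] at b5; omega
    by_cases c : y = splicePartner n v j
    · exact ⟨_, a1, a2, a3, by rw [key, if_pos rfl, c],
        by rw [key, if_neg (by omega), if_neg (by omega), if_pos c]⟩
    · exact ⟨_, b1, b2, b3, by rw [key, if_neg hab.symm, if_pos rfl]; omega,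
        by rw [key, if_neg (by omega), if_neg (by omega), if_neg c, if_pos (by omega)]⟩
  have even : ∀ j y, j < n → n ≤ y → ¬ IsOddEdge v j →
      extendNext n T.next v j y = 2 * n + 1 - y := fun j y hj hy hodd => by
    simp only [extendNext, not_le.2 hv, not_le.2 hj, if_false, false_and, if_neg hodd,
      not_lt.2 hy]
  have new : ∀ y x, n ≤ y → extendNext n T.next v y x = tourNext n (2 * n + 1 - y) v x :=
    fun y x hy => by simp [extendNext, not_le.2 hv, hy]
  have c0 : ∀ j y, j < n → j ≠ v → n ≤ y → y < n + 2 → IsOddEdge v j →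
      ∃ b, IsArc v b ∧ b.1 < n ∧ b.2 < n ∧ (T'.turn v).SameCycle (j, y) b := by
    intro j y hj hjv hy hy' hodd
    obtain ⟨x, h1, h2, h3, h4, -⟩ := odd j y hj hjv hy hy' hodd
    exact ⟨(x, j), ⟨h2, hjv, h3⟩, h1, hj, (sameCycle_step hT' (by omega) (by omega) (by omega) h2
      hjv h3 h4).symm⟩
  have c1 : ∀ j y, j < n → j ≠ v → n ≤ y → y < n + 2 →
      ∃ b, IsArc v b ∧ b.1 < n ∧ b.2 < n ∧ (T'.turn v).SameCycle (j, y) b := by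
    intro j y hj hjv hy hy'
    by_cases hodd : IsOddEdge v j
    · exact c0 j y hj hjv hy hy' hodd
    have s1 := sameCycle_step hT' (v := v) (x := 2 * n + 1 - y) (y := j) (u := y) (by omega)
      (by omega) (by omega) (by omega) hjv (by omega) (by rw [even _ _ hj (by omega) hodd]; omega)
    obtain ⟨hk1, hk2, hk3⟩ := tourNext_valid (z := y) hn hv (.inl hj) (by omega) hjv
    have hinv := tourNext_tourNext (z := y) hn hv (.inl hj) (by omega) hjv
    have hkodd := fun h => (isOddEdge_of_tourNext (z := y) hn hv hj (by omega) hjv h).2 hodd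
    rcases hk1 with hk1 | hk1
    -- Going backwards from `(j, y)`: before it comes `(y', j)`, and before that `(k, y')` with `vk`
    -- odd, where `c0` applies.
    · replace hkodd := hkodd hk1
      generalize tourNext n y v j = k at *
      obtain ⟨b, h1, h2, h3, h4⟩ := c0 k (2 * n + 1 - y) hk1 hk2 (by omega) (by omega) hkodd
      refine ⟨b, h1, h2, h3, s1.symm.trans (Perm.SameCycle.trans ?_ h4)⟩
      refine (sameCycle_step hT' (by omega) (by omega) (by omega) hk2 (by omega) (by omega) ?_).symm
      rw [new _ _ (by omega), show 2 * n + 1 - (2 * n + 1 - y) = y by omega, hinv]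
    · rw [hk1] at hinv
      have := (isOddEdge_tourNext_root (z := y) hn hv hy).2
      rw [hinv] at this
      exact absurd this hodd
  have c2 : ∀ j y, j < n → j ≠ v → n ≤ y → y < n + 2 →
      ∃ b, IsArc v b ∧ b.1 < n ∧ b.2 < n ∧ (T'.turn v).SameCycle (y, j) b := by
    intro j y hj hjv hy hy'
    by_cases hodd : IsOddEdge v j
    · obtain ⟨x, h1, h2, h3, -, h4⟩ := odd j y hj hjv hy hy' hodd
      exact ⟨(j, x), ⟨hjv, h2, h3.symm⟩, hj, h1, sameCycle_step hT' (by omega) (by omega) (by omega)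
        (by omega) hjv (by omega) h4⟩
    · obtain ⟨b, h1, h2, h3, h4⟩ := c1 j (2 * n + 1 - y) hj hjv (by omega) (by omega)
      exact ⟨b, h1, h2, h3, (sameCycle_step hT' (by omega) (by omega) (by omega)
        (by omega) hjv (by omega) (even _ _ hj hy hodd)).trans h4⟩
  obtain ⟨x, y⟩ := a
  obtain ⟨hxv, hyv, hxy⟩ := ha
  simp only at *
  rcases lt_or_ge x n with hx | hx <;> rcases lt_or_ge y n with hy | hy
  · exact ⟨(x, y), ⟨hxv, hyv, hxy⟩, hx, hy, .refl _ _⟩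
  · exact c1 x y hx hxv hy ha2
  · exact c2 y x hy hyv hx ha1
  · have h5 := tourNext_valid (z := x) hn hv (.inr rfl) hx hxv
    obtain ⟨b, h1, h2, h3, h4⟩ := c2 (tourNext n x v x) y (isOddEdge_tourNext_root hn hv hx).1
      h5.2.1 hy ha2
    refine ⟨b, h1, h2, h3, Perm.SameCycle.trans ?_ h4⟩
    refine sameCycle_step hT' (by omega) (by omega) (by omega) hxv hyv hxy ?_
    rw [new y x hy, show 2 * n + 1 - y = x by omega]

lemma extend_unicursal_old (hT : T.IsOrientedBelow n) (hT2 : IsParityChanging (n + 2) T'.next)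
    (hv : v < n) (a b : ℕ × ℕ) (ha : IsArc v a) (hb : IsArc v b) (ha1 : a.1 < n + 2)
    (ha2 : a.2 < n + 2) (hb1 : b.1 < n + 2) (hb2 : b.2 < n + 2)
    (hab : paritySum v a.1 a.2 % 2 = paritySum v b.1 b.2 % 2) : (T'.turn v).SameCycle a b := by
  obtain ⟨a', h1, h2, h3, h5⟩ := exists_old_arc hn h4 hT' hT.1 hv ha ha1 ha2
  obtain ⟨b', k1, k2, k3, k5⟩ := exists_old_arc hn h4 hT' hT.1 hv hb hb1 hb2
  have h6 := (below_of_sameCycle hT2 (by omega) h5 ha ha1 ha2).2.2.2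
  have k6 := (below_of_sameCycle hT2 (by omega) k5 hb hb1 hb2).2.2.2
  exact h5.trans ((extend_sameCycle_of_sameCycle hn h4 hT' hT.1 hv
    (hT.2 v hv a' b' h1 k1 h2 h3 k2 k3 (by omega)) h1 h2 h3).trans k5.symm)

end Extend

end TransitionSystem

/-! ### The trails at the two new points -/

namespace TransitionSystem

variable {T T' : TransitionSystem ℕ} {n v : ℕ}

section TourValues

variable {z r k : ℕ}

lemma tourNext_even_even (hz : n ≤ z) (hr : 2 * r < n) (hk : k < r) :
    tourNext n z (2 * k) (2 * r) = 2 * r + 1 := by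
  rw [tourNext, if_neg (by omega), if_pos (by omega), if_pos (by omega), if_pos (by omega)]

lemma tourNext_odd_even (hz : n ≤ z) (hr : 2 * r + 1 < n) (hk : k < r) :
    tourNext n z (2 * r + 1) (2 * k) = 2 * k + 1 := by
  rw [tourNext, if_neg (by omega), if_neg (by omega), if_neg (by omega), if_neg (by omega),
    if_neg (by omega), if_pos (by omega)]

lemma tourNext_odd_odd (hz : n ≤ z) (hr : 2 * r + 1 < n) (hk : k < r) :
    tourNext n z (2 * k + 1) (2 * r + 1) = 2 * r := by
  rw [tourNext, if_neg (by omega), if_neg (by omega), if_pos (by omega), if_neg (by omega)]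
  omega

lemma tourNext_even_root (hz : n ≤ z) (hr : 2 * r < n) (h0 : 0 < r) :
    tourNext n z (2 * r) z = 0 := by
  rw [tourNext, if_neg (by omega), if_pos (by omega), if_neg (by omega), if_pos rfl,
    if_neg (by omega)]

lemma tourNext_zero_root (hz : n ≤ z) (h0 : 0 < n) : tourNext n z 0 z = 1 := by
  rw [tourNext, if_neg (by omega), if_pos (by omega), if_neg (by omega), if_pos rfl, if_pos rfl]

lemma tourNext_even_odd (hz : n ≤ z) (hr : 2 * r < n) (hk : k + 1 < r) :
    tourNext n z (2 * r) (2 * k + 1) = 2 * (k + 1) := by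
  rw [tourNext, if_neg (by omega), if_pos (by omega), if_neg (by omega), if_neg (by omega),
    if_neg (by omega), if_neg (by omega), if_neg (by omega), if_neg (by omega)]
  omega

lemma tourNext_even_pred (hz : n ≤ z) (hr : 2 * r < n) (h0 : 0 < r) :
    tourNext n z (2 * r) (2 * (r - 1) + 1) = 2 * r + 1 := by
  rw [tourNext, if_neg (by omega), if_pos (by omega), if_neg (by omega), if_neg (by omega),
    if_neg (by omega), if_neg (by omega), if_neg (by omega), if_pos (by omega)]

lemma tourNext_odd_pred (hz : n ≤ z) (hr : 2 * r + 1 < n) :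
    tourNext n z (2 * r + 1) (2 * r) = z := by
  rw [tourNext, if_neg (by omega), if_neg (by omega), if_neg (by omega), if_neg (by omega),
    if_pos (by omega)]

lemma tourNext_root_odd (hr : 2 * r + 2 < n) : tourNext n n n (2 * r + 1) = 2 * (r + 1) := by
  rw [tourNext, if_pos rfl, if_neg (by omega), if_neg (by omega), if_pos (by omega)]
  omega

end TourValues

/-- The parity condition selects one direction of every edge, the one in which the tour runs through
it. -/
lemma tour_arc_cases {z x y : ℕ} (hn : n % 2 = 0) (hv : v = n ∨ v = n + 1) (hz : z = 2 * n + 1 - v)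
    (hxv : x ≠ v) (hyv : y ≠ v) (hxy : x ≠ y) (hx : x < n + 2) (hy : y < n + 2)
    (hp : paritySum v x y % 2 = (v + 1) % 2) : (x = z ∧ y < n ∧ y % 2 = 0) ∨
      (x < n ∧ y = z ∧ x % 2 = 1) ∨ (x < y ∧ y < n ∧ x % 2 = 0 ∧ y % 2 = 1) ∨
      (x < y ∧ y < n ∧ x % 2 = 1 ∧ y % 2 = 0) ∨ (y < x ∧ x < n ∧ x % 2 = 0 ∧ y % 2 = 0) ∨
      (y < x ∧ x < n ∧ x % 2 = 1 ∧ y % 2 = 1) := by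
  unfold paritySum at hp
  rcases lt_or_ge x n with h1 | h1 <;> rcases lt_or_ge y n with h2 | h2
  · have e1 : x < v := by omega
    have e2 : y < v := by omega
    rw [if_pos e1, if_pos e2] at hp
    rcases lt_or_gt_of_ne hxy with h | h
    · rw [if_neg h.not_gt] at hp
      have : x % 2 ≠ y % 2 := by clear hv hz; omega
      clear hp hv hz
      rcases Nat.mod_two_eq_zero_or_one x with h3 | h3
      · exact .inr (.inr (.inl ⟨h, h2, h3, by omega⟩))
      · exact .inr (.inr (.inr (.inl ⟨h, h2, h3, by omega⟩)))
    · rw [if_pos h] at hp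
      have : x % 2 = y % 2 := by clear hv hz; omega
      clear hp hv hz
      rcases Nat.mod_two_eq_zero_or_one x with h3 | h3
      · exact .inr (.inr (.inr (.inr (.inl ⟨h, h1, h3, by omega⟩))))
      · exact .inr (.inr (.inr (.inr (.inr ⟨h, h1, h3, by omega⟩))))
  · have e1 : x < v := by omega
    have e2 : ¬ y < x := by omega
    rw [if_pos e1, if_neg e2] at hp
    refine .inr (.inl ⟨h1, by omega, ?_⟩)
    rcases hv with rfl | rfl
    · rw [show y = v + 1 by omega, if_neg (by omega)] at hp
      clear hxy hxv; omega
    · rw [show y = n by omega, if_pos (by omega)] at hp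
      clear hxy hxv; omega
  · have e1 : y < x := by omega
    have e2 : y < v := by omega
    rw [if_pos e1, if_pos e2] at hp
    refine .inl ⟨by omega, h2, ?_⟩
    rcases hv with rfl | rfl
    · rw [show x = v + 1 by omega, if_neg (by omega)] at hp
      clear hxy hyv; omega
    · rw [show x = n by omega, if_pos (by omega)] at hp
      clear hxy hyv; omega
  · exfalso; omega

/-- The tour is a succession of blocks, one for each `r` with `2r < n`: the closed walk `z, 2r, 0,
2r+1, 1, 2r, 2, 2r+1, 3, …, 2r-1, 2r, 2r+1, z`. Block `r` covers the edges that join `2r` and `2r+1`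
to each other, to the smaller points and to the root. -/
lemma extend_unicursal_new (hn : Even n) (h4 : 4 ≤ n)
    (hT' : ∀ i j x, i < n + 2 → j < n + 2 → x < n + 2 → i ≠ j → x ≠ i → x ≠ j →
      T'.next i j x = extendNext n T.next i j x)
    (hv : n ≤ v) (hv2 : v < n + 2) (a b : ℕ × ℕ) (ha : IsArc v a) (hb : IsArc v b)
    (ha1 : a.1 < n + 2) (ha2 : a.2 < n + 2) (hb1 : b.1 < n + 2) (hb2 : b.2 < n + 2)
    (hab : paritySum v a.1 a.2 % 2 = paritySum v b.1 b.2 % 2) : (T'.turn v).SameCycle a b := by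
  obtain ⟨z, hz⟩ : ∃ z, z = 2 * n + 1 - v := ⟨_, rfl⟩
  have hne := Nat.even_iff.1 hn
  have inner : ∀ x y u, x < n ∨ x = z → y < n → x ≠ y → tourNext n z y x = u →
      (T'.turn v).SameCycle (x, y) (y, u) := fun x y u hx hy hxy hu => by
    refine sameCycle_step hT' hv2 (by omega) (by omega) (by omega) (by omega) hxy ?_
    rw [← hu, hz]
    simp [extendNext, hv, not_le.2 hy]
  have root : ∀ x u, x < n → tourNext n n n x = u →
      (T'.turn v).SameCycle (x, z) (z, u) := fun x u hx hu => by
    refine sameCycle_step hT' hv2 (by omega) (by omega) (by omega) (by omega) (by omega) ?_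
    rw [← hu]
    have : n ≤ z := by omega
    simp [extendNext, hv, this]
  have block : ∀ r, 2 * r < n → (T'.turn v).SameCycle (z, 0) (z, 2 * r) →
      (∀ k, k < r → (T'.turn v).SameCycle (z, 0) (2 * r, 2 * k) ∧
        (T'.turn v).SameCycle (z, 0) (2 * k, 2 * r + 1) ∧
        (T'.turn v).SameCycle (z, 0) (2 * r + 1, 2 * k + 1) ∧
        (T'.turn v).SameCycle (z, 0) (2 * k + 1, 2 * r)) ∧
      (T'.turn v).SameCycle (z, 0) (2 * r, 2 * r + 1) ∧
      (T'.turn v).SameCycle (z, 0) (2 * r + 1, z) := by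
    intro r hr h0
    have round : ∀ k, k < r → (T'.turn v).SameCycle (z, 0) (2 * r, 2 * k) →
        (T'.turn v).SameCycle (z, 0) (2 * k, 2 * r + 1) ∧
        (T'.turn v).SameCycle (z, 0) (2 * r + 1, 2 * k + 1) ∧
        (T'.turn v).SameCycle (z, 0) (2 * k + 1, 2 * r) := by
      intro k hk h1
      have h2 := h1.trans (inner (2 * r) (2 * k) (2 * r + 1) (by omega) (by omega) (by omega)
        (tourNext_even_even (by omega) hr hk))
      have h3 := h2.trans (inner (2 * k) (2 * r + 1) (2 * k + 1) (by omega) (by omega) (by omega)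
        (tourNext_odd_even (by omega) (by omega) hk))
      have h4 := h3.trans (inner (2 * r + 1) (2 * k + 1) (2 * r) (by omega) (by omega) (by omega)
        (tourNext_odd_odd (by omega) (by omega) hk))
      exact ⟨h2, h3, h4⟩
    have first : ∀ k, k < r → (T'.turn v).SameCycle (z, 0) (2 * r, 2 * k) := by
      intro k
      induction k with
      | zero =>
        intro hk
        exact h0.trans (inner z (2 * r) 0 (by omega) (by omega) (by omega)
          (tourNext_even_root (by omega) hr hk))
      | succ k ih =>
        intro hk
        exact (round k (by omega) (ih (by omega))).2.2.trans (inner (2 * k + 1) (2 * r)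
          (2 * (k + 1)) (by omega) (by omega) (by omega)
          (tourNext_even_odd (by omega) hr hk))
    have last : (T'.turn v).SameCycle (z, 0) (2 * r, 2 * r + 1) := by
      rcases Nat.eq_zero_or_pos r with rfl | hpos
      · exact h0.trans (inner z (2 * 0) (2 * 0 + 1) (by omega) (by omega) (by omega)
          (tourNext_zero_root (by omega) (by omega)))
      · exact (round (r - 1) (by omega) (first _ (by omega))).2.2.trans
          (inner (2 * (r - 1) + 1) (2 * r) (2 * r + 1) (by omega) (by omega) (by omega)
          (tourNext_even_pred (by omega) hr hpos))
    exact ⟨fun k hk => ⟨first k hk, round k hk (first k hk)⟩, last,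
      last.trans (inner (2 * r) (2 * r + 1) z (by omega) (by omega) (by omega)
        (tourNext_odd_pred (by omega) (by omega)))⟩
  have start : ∀ r, 2 * r < n → (T'.turn v).SameCycle (z, 0) (z, 2 * r) := by
    intro r
    induction r with
    | zero => exact fun _ => .refl _ _
    | succ r ih =>
      intro hr
      exact (block r (by omega) (ih (by omega))).2.2.trans (root (2 * r + 1) _ (by omega)
        (tourNext_root_odd (by omega)))
  have main : ∀ x y, IsArc v (x, y) → x < n + 2 → y < n + 2 →
      paritySum v x y % 2 = (v + 1) % 2 → (T'.turn v).SameCycle (z, 0) (x, y) := by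
    rintro x y ⟨hxv, hyv, hxy⟩ hx hy hp
    simp only at hxv hyv hxy
    have key := tour_arc_cases hne (by omega) hz hxv hyv hxy hx hy hp
    rcases key with ⟨rfl, h1, h2⟩ | ⟨h1, rfl, h2⟩ | ⟨h1, h2, h3, h4⟩ | ⟨h1, h2, h3, h4⟩ |
      ⟨h1, h2, h3, h4⟩ | ⟨h1, h2, h3, h4⟩
    · have := start (y / 2) (by omega)
      rwa [show 2 * (y / 2) = y by omega] at this
    · have := (block (x / 2) (by omega) (start _ (by omega))).2.2
      rwa [show 2 * (x / 2) + 1 = x by omega] at this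
    · by_cases h : y = x + 1
      · have := (block (x / 2) (by omega) (start _ (by omega))).2.1
        rwa [show 2 * (x / 2) = x by omega, ← h] at this
      · have := ((block (y / 2) (by omega) (start _ (by omega))).1 (x / 2) (by omega)).2.1
        rwa [show 2 * (x / 2) = x by omega, show 2 * (y / 2) + 1 = y by omega] at this
    · have := ((block (y / 2) (by omega) (start _ (by omega))).1 (x / 2) (by omega)).2.2.2
      rwa [show 2 * (x / 2) + 1 = x by omega, show 2 * (y / 2) = y by omega] at this
    · have := ((block (x / 2) (by omega) (start _ (by omega))).1 (y / 2) (by omega)).1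
      rwa [show 2 * (x / 2) = x by omega, show 2 * (y / 2) = y by omega] at this
    · have := ((block (x / 2) (by omega) (start _ (by omega))).1 (y / 2) (by omega)).2.2.1
      rwa [show 2 * (x / 2) + 1 = x by omega, show 2 * (y / 2) + 1 = y by omega] at this
  by_cases h : paritySum v a.1 a.2 % 2 = (v + 1) % 2
  · exact (main a.1 a.2 ha ha1 ha2 h).symm.trans (main b.1 b.2 hb hb1 hb2 (hab ▸ h))
  · have e1 := paritySum_comm_right (i := v) ha.2.2
    have e2 := paritySum_comm_right (i := v) hb.2.2
    simpa using T'.sameCycle_swap ((main a.2 a.1 ha.swap ha2 ha1 (by omega)).symm.trans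
      (main b.2 b.1 hb.swap hb2 hb1 (by omega)))

lemma IsOrientedBelow.exists_extend (hn : Even n) (h4 : 4 ≤ n) (hT : T.IsOrientedBelow n) :
    ∃ T' : TransitionSystem ℕ, T'.IsOrientedBelow (n + 2) := by
  have hE := isParityChanging_extendNext hn h4 hT.1 T.next_comm
  let T' := ofNat (n + 2) (extendNext n T.next) hE fun i j x => extendNext_comm T.next_comm
  have hT' : ∀ i j x, i < n + 2 → j < n + 2 → x < n + 2 → i ≠ j → x ≠ i → x ≠ j →
      T'.next i j x = extendNext n T.next i j x :=
    fun i j x h1 h2 h3 h4 h5 h6 => if_pos ⟨h1, h2, h3, h4, h5, h6⟩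
  have hE' : IsParityChanging (n + 2) T'.next := fun i j x h1 h2 h3 h4 h5 h6 => by
    obtain ⟨a1, a2, a3, a4, a5⟩ := hE i j x h1 h2 h3 h4 h5 h6
    rw [hT' i j x h1 h2 h3 h4 h5 h6, hT' i j _ h1 h2 a1 h4 a2 a3]
    exact ⟨a1, a2, a3, a4, a5⟩
  refine ⟨T', hE', fun v hv a b ha hb ha1 ha2 hb1 hb2 hab => ?_⟩
  rcases lt_or_ge v n with h | h
  · exact extend_unicursal_old hn h4 hT' hT hE' h a b ha hb ha1 ha2 hb1 hb2 hab
  · exact extend_unicursal_new hn h4 hT' h hv a b ha hb ha1 ha2 hb1 hb2 hab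

lemma exists_isOrientedBelow_four : ∃ T : TransitionSystem ℕ, T.IsOrientedBelow 4 := by
  -- With four points the transition is forced: `6 - i - j - x` is the fourth point, as `0 + 1 + 2 +
  -- 3 = 6`.
  have hE : IsParityChanging 4 fun i j x => 6 - i - j - x := by
    have : ∀ i j x : Fin 4, (i : ℕ) ≠ j ∧ (x : ℕ) ≠ i ∧ (x : ℕ) ≠ j → 6 - (i : ℕ) - j - x < 4 ∧
        6 - i - j - x ≠ (i : ℕ) ∧ 6 - i - j - x ≠ (j : ℕ) ∧ 6 - i - j - (6 - i - j - x) = (x : ℕ) ∧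
        paritySum i j (6 - i - j - x) % 2 ≠ paritySum i j x % 2 := by decide
    exact fun i j x h1 h2 h3 h4 h5 h6 => this ⟨i, h1⟩ ⟨j, h2⟩ ⟨x, h3⟩ ⟨h4, h5, h6⟩
  let T := ofNat 4 _ hE fun i j x _ => by omega
  have hT : ∀ i j x, i < 4 → j < 4 → x < 4 → i ≠ j → x ≠ i → x ≠ j →
      T.next i j x = 6 - i - j - x :=
    fun i j x h1 h2 h3 h4 h5 h6 => if_pos ⟨h1, h2, h3, h4, h5, h6⟩
  refine ⟨T, fun i j x h1 h2 h3 h4 h5 h6 => ?_, ?_⟩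
  · obtain ⟨a1, a2, a3, a4, a5⟩ := hE i j x h1 h2 h3 h4 h5 h6
    rw [hT i j x h1 h2 h3 h4 h5 h6, hT i j _ h1 h2 a1 h4 a2 a3]
    exact ⟨a1, a2, a3, a4, a5⟩
  · rintro v hv ⟨x, y⟩ ⟨x', y'⟩ ⟨a1, a2, a3⟩ ⟨b1, b2, b3⟩ hx hy hx' hy' hab
    simp only at *
    have step : ∀ x y, x < 4 → y < 4 → x ≠ v → y ≠ v → x ≠ y →
        (T.turn v).SameCycle (x, y) (y, 6 - v - y - x) := fun x y h1 h2 h3 h4 h5 => by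
      have : T.turn v (x, y) = (y, 6 - v - y - x) := by
        rw [turn_apply, hT v y x hv h2 h1 h4.symm h3 h5]
      rw [← this]
      exact Perm.sameCycle_apply_right.2 (.refl _ _)
    have third : ∀ v x y : Fin 4, (x : ℕ) ≠ v ∧ (y : ℕ) ≠ v ∧ (x : ℕ) ≠ y →
        6 - (v : ℕ) - y - x < 4 ∧ 6 - v - y - x ≠ (v : ℕ) ∧ (y : ℕ) ≠ 6 - v - y - x := by decide
    have key : ∀ v x y x' y' : Fin 4, ((x : ℕ) ≠ v ∧ (y : ℕ) ≠ v ∧ (x : ℕ) ≠ y) ∧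
        ((x' : ℕ) ≠ v ∧ (y' : ℕ) ≠ v ∧ (x' : ℕ) ≠ y') ∧
        paritySum v x y % 2 = paritySum v x' y' % 2 →
        ((x' : ℕ) = x ∧ (y' : ℕ) = y) ∨ ((x' : ℕ) = y ∧ (y' : ℕ) = 6 - v - y - x) ∨
        ((x' : ℕ) = 6 - v - y - x ∧ (y' : ℕ) = 6 - v - (6 - v - y - x) - y) := by decide
    replace key := key ⟨v, hv⟩ ⟨x, hx⟩ ⟨y, hy⟩ ⟨x', hx'⟩ ⟨y', hy'⟩ ⟨⟨a1, a2, a3⟩, ⟨b1, b2, b3⟩, hab⟩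
    obtain ⟨t1, t2, t3⟩ := third ⟨v, hv⟩ ⟨x, hx⟩ ⟨y, hy⟩ ⟨a1, a2, a3⟩
    have s1 := step x y hx hy a1 a2 a3
    have s2 := s1.trans (step y (6 - v - y - x) hy t1 a2 t2 t3)
    simp only at key t1 t2 t3
    rcases key with ⟨rfl, rfl⟩ | ⟨rfl, rfl⟩ | ⟨rfl, rfl⟩
    · exact .refl _ _
    · exact s1
    · exact s2

lemma exists_isOrientedBelow (hn : Even n) (h4 : 4 ≤ n) :
    ∃ T : TransitionSystem ℕ, T.IsOrientedBelow n := by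
  obtain ⟨m, rfl⟩ := hn
  obtain ⟨k, rfl⟩ : ∃ k, m = k + 2 := ⟨m - 2, by omega⟩
  clear h4
  induction k with
  | zero => exact exists_isOrientedBelow_four
  | succ k ih =>
    obtain ⟨T, hT⟩ := ih
    have := hT.exists_extend ⟨k + 2, rfl⟩ (by omega)
    rwa [show k + 2 + (k + 2) + 2 = k + 1 + 2 + (k + 1 + 2) by omega] at this

end TransitionSystem

/-! ### Transfer of the construction to `Fin n` -/

/-- The alternating sign of a triple that comes from `paritySum`. -/
def paritySign (n : ℕ) (i j k : Fin n) : ℤˣ := (-1) ^ paritySum i j k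

lemma paritySign_eq_iff {n : ℕ} {i j k i' j' k' : Fin n} :
    paritySign n i j k = paritySign n i' j' k' ↔
      paritySum i j k % 2 = paritySum i' j' k' % 2 := by
  unfold paritySign
  rcases Nat.mod_two_eq_zero_or_one (paritySum i j k) with h | h <;>
    rcases Nat.mod_two_eq_zero_or_one (paritySum i' j' k') with h' | h' <;> rw [h, h']
  · simp [Even.neg_one_pow (Nat.even_iff.2 h), Even.neg_one_pow (Nat.even_iff.2 h')]
  · simp [Even.neg_one_pow (Nat.even_iff.2 h), Odd.neg_one_pow (Nat.odd_iff.2 h')]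
  · simp [Odd.neg_one_pow (Nat.odd_iff.2 h), Even.neg_one_pow (Nat.even_iff.2 h')]
  · simp [Odd.neg_one_pow (Nat.odd_iff.2 h), Odd.neg_one_pow (Nat.odd_iff.2 h')]

lemma isAlternating_paritySign (n : ℕ) : IsAlternating (paritySign n) := by
  intro v w x h1 h2 h3
  constructor
  · rw [← Int.units_ne_iff_eq_neg, Ne, paritySign_eq_iff]
    exact paritySum_comm_left fun h => h1 (Fin.ext h)
  · rw [← Int.units_ne_iff_eq_neg, Ne, paritySign_eq_iff]
    exact paritySum_comm_right fun h => h3 (Fin.ext h.symm)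

/-- There is an oriented system on every even number `n ≥ 4` of points. -/
theorem TransitionSystem.exists_isOriented {n : ℕ} (hn : Even n) (h4 : 4 ≤ n) :
    ∃ T : TransitionSystem (Fin n), T.IsOriented (paritySign n) := by
  obtain ⟨T, hT⟩ := exists_isOrientedBelow hn h4
  have hlt : ∀ i j x : Fin n, T.next i j x < n := fun i j x => by
    by_cases hij : i = j
    · rw [hij, T.next_self]; exact x.2
    by_cases hi : x = i
    · rw [hi, T.next_left]; exact i.2
    by_cases hj : x = j
    · rw [hj, T.next_right]; exact j.2
    · exact (hT.1 i j x i.2 j.2 x.2 (fun h => hij (Fin.ext h)) (fun h => hi (Fin.ext h))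
        fun h => hj (Fin.ext h)).1
  let S : TransitionSystem (Fin n) :=
    { next := fun i j x => ⟨T.next i j x, hlt i j x⟩
      next_comm := fun i j x => Fin.ext (T.next_comm i j x)
      next_next := fun i j x => Fin.ext (T.next_next i j x)
      next_left := fun i j => Fin.ext (T.next_left i j)
      next_self := fun i x => Fin.ext (T.next_self i x) }
  refine ⟨S, fun i j x hij hi hj => ?_, fun v a b ha hb hab => ?_⟩
  · rw [← Int.units_ne_iff_eq_neg, Ne, paritySign_eq_iff]
    exact (hT.1 i j x i.2 j.2 x.2 (fun h => hij (Fin.ext h)) (fun h => hi (Fin.ext h))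
      fun h => hj (Fin.ext h)).2.2.2.2
  · let ι : Fin n × Fin n → ℕ × ℕ := fun a => (a.1, a.2)
    have hι : Function.Injective ι := fun a b h => by
      simp only [ι, Prod.mk.injEq] at h
      exact Prod.ext (Fin.ext h.1) (Fin.ext h.2)
    have hturn : ∀ a, ι (S.turn v a) = T.turn v (ι a) := fun a => rfl
    have hinv : ∀ a, ι ((S.turn v)⁻¹ a) = (T.turn v)⁻¹ (ι a) := fun a => rfl
    have harc : ∀ a, IsArc v a → IsArc (v : ℕ) (ι a) := fun a ha =>
      ⟨fun h => ha.1 (Fin.ext h), fun h => ha.2.1 (Fin.ext h), fun h => ha.2.2 (Fin.ext h)⟩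
    have h := hT.2 v v.2 (ι a) (ι b) (harc a ha) (harc b hb) a.1.2 a.2.2 b.1.2 b.2.2
      (paritySign_eq_iff.1 hab)
    obtain ⟨c, hc1, hc2⟩ := T.induction_sameCycle
      (P := fun y => ∃ c, ι c = y ∧ (S.turn v).SameCycle a c) h ⟨a, rfl, .refl _ _⟩
      (by rintro _ ⟨c, rfl, hc⟩; exact ⟨_, hturn c, Perm.sameCycle_apply_right.2 hc⟩)
      (by rintro _ ⟨c, rfl, hc⟩; exact ⟨_, hinv c, hc.trans ⟨-1, by simp⟩⟩)
    rwa [hι hc1] at hc2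

/-! ### Ordered triples and the darts of the Levi graph -/

/-- Three distinct points, in order. -/
@[ext]
structure Triple (n : ℕ) where
  fst : Fin n
  snd : Fin n
  thd : Fin n
  fst_ne_snd : fst ≠ snd
  thd_ne_fst : thd ≠ fst
  thd_ne_snd : thd ≠ snd

namespace Triple

variable {n : ℕ}

/-- Exchange of the last two points. -/
def flip (t : Triple n) : Triple n :=
  ⟨t.fst, t.thd, t.snd, t.thd_ne_fst.symm, t.fst_ne_snd.symm, t.thd_ne_snd.symm⟩

@[simp] lemma flip_flip (t : Triple n) : t.flip.flip = t := rfl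

/-- Cyclic shift of the three points. -/
def shift : Perm (Triple n) where
  toFun t := ⟨t.snd, t.thd, t.fst, t.thd_ne_snd.symm, t.fst_ne_snd, t.thd_ne_fst.symm⟩
  invFun t := ⟨t.thd, t.fst, t.snd, t.thd_ne_fst, t.thd_ne_snd.symm, t.fst_ne_snd.symm⟩
  left_inv _ := rfl
  right_inv _ := rfl

/-- The passage to the next triple at the first point. -/
def turn (T : TransitionSystem (Fin n)) : Perm (Triple n) where
  toFun t := ⟨t.fst, t.thd, T.next t.fst t.thd t.snd, t.thd_ne_fst.symm,
    T.next_ne_left t.fst_ne_snd.symm, T.next_ne_right t.thd_ne_snd.symm⟩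
  invFun t := ⟨t.fst, T.next t.fst t.snd t.thd, t.snd, (T.next_ne_left t.thd_ne_fst).symm,
    t.fst_ne_snd.symm, (T.next_ne_right t.thd_ne_snd).symm⟩
  left_inv t := by ext <;> simp [T.next_next]
  right_inv t := by ext <;> simp [T.next_next]

lemma flip_shift_flip (t : Triple n) : (shift t.flip).flip = shift⁻¹ t := rfl

lemma flip_turn_flip (T : TransitionSystem (Fin n)) (t : Triple n) :
    (turn T t.flip).flip = (turn T)⁻¹ t := rfl

lemma ncard_eq_three (t : Triple n) : ({t.fst, t.snd, t.thd} : Set (Fin n)).ncard = 3 := by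
  rw [Set.ncard_eq_three]
  exact ⟨_, _, _, t.fst_ne_snd, t.thd_ne_fst.symm, t.thd_ne_snd.symm, rfl⟩

lemma card_eq (n : ℕ) : Nat.card (Triple n) = n * (n - 1) * (n - 2) := by
  let e : Triple n ≃ (Fin 3 ↪ Fin n) :=
    { toFun := fun t => ⟨![t.fst, t.snd, t.thd], by
        have h1 := t.fst_ne_snd
        have h2 := t.thd_ne_fst
        have h3 := t.thd_ne_snd
        intro i j hij
        fin_cases i <;> fin_cases j <;> simp_all [eq_comm]⟩
      invFun := fun f => ⟨f 0, f 1, f 2, fun h => by simpa using f.injective h,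
        fun h => by simpa using f.injective h, fun h => by simpa using f.injective h⟩
      left_inv := fun t => rfl
      right_inv := fun f => by ext i; fin_cases i <;> rfl }
  rw [Nat.card_congr e, Nat.card_eq_fintype_card, Fintype.card_embedding_eq]
  simp only [Fintype.card_fin, Nat.descFactorial, Nat.sub_zero, mul_one]
  ring

instance : Finite (Triple n) :=
  Finite.of_injective (fun t => (t.fst, t.snd, t.thd)) fun s t h => by
    simp only [Prod.mk.injEq] at h
    exact Triple.ext h.1 h.2.1 h.2.2

end Triple

/-- The Levi graph of the complete 3-uniform hypergraph. -/
abbrev leviGraphThree (n : ℕ) := leviGraph (completeUniformHypergraph n 3)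

namespace LeviGraphThree

variable {n : ℕ}

/-- A point as a vertex of the Levi graph. -/
def point (v : Fin n) : (completeUniformHypergraph n 3).vertexSet ⊕
    (completeUniformHypergraph n 3).edgeSet := .inl ⟨v, trivial⟩

/-- A hyperedge as a vertex of the Levi graph. -/
def block (t : Triple n) : (completeUniformHypergraph n 3).vertexSet ⊕
    (completeUniformHypergraph n 3).edgeSet := .inr ⟨{t.fst, t.snd, t.thd}, t.ncard_eq_three⟩

lemma point_injective : Function.Injective (point (n := n)) := fun _ _ h =>
  congrArg Subtype.val (Sum.inl_injective h)

lemma block_eq_iff {s t : Triple n} : block s = block t ↔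
    ({s.fst, s.snd, s.thd} : Set (Fin n)) = {t.fst, t.snd, t.thd} :=
  ⟨fun h => congrArg Subtype.val (Sum.inr_injective h), fun h => congrArg Sum.inr (Subtype.ext h)⟩

lemma exists_block (e : (completeUniformHypergraph n 3).edgeSet) :
    ∃ t : Triple n, block t = .inr e := by
  obtain ⟨e, he⟩ := e
  obtain ⟨a, b, c, h1, h2, h3, rfl⟩ := Set.ncard_eq_three.1 he
  exact ⟨⟨a, b, c, h1, h2.symm, h3.symm⟩, rfl⟩

/-- The dart from the first point of a triple to the triple. -/
def pointDart (t : Triple n) : (leviGraphThree n).Dart :=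
  ⟨(point t.fst, block t), show t.fst ∈ ({t.fst, t.snd, t.thd} : Set (Fin n)) by simp⟩

/-- The dart from a triple to its first point. -/
def blockDart (t : Triple n) : (leviGraphThree n).Dart := (pointDart t).symm

@[simp] lemma symm_pointDart (t : Triple n) : (pointDart t).symm = blockDart t := rfl
@[simp] lemma symm_blockDart (t : Triple n) : (blockDart t).symm = pointDart t := rfl

lemma block_flip (t : Triple n) : block t.flip = block t := by
  rw [block_eq_iff]
  simp only [Triple.flip, Set.pair_comm]

lemma block_shift (t : Triple n) : block (Triple.shift t) = block t := by
  rw [block_eq_iff]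
  ext; simp only [Triple.shift, coe_fn_mk, Set.mem_insert_iff, Set.mem_singleton_iff]; tauto

@[simp] lemma pointDart_flip (t : Triple n) : pointDart t.flip = pointDart t := by
  ext
  · rfl
  · exact block_flip t

@[simp] lemma blockDart_flip (t : Triple n) : blockDart t.flip = blockDart t := by
  rw [← symm_pointDart, pointDart_flip, symm_pointDart]

lemma pointDart_eq_iff {s t : Triple n} : pointDart s = pointDart t ↔ s = t ∨ s = t.flip := by
  constructor
  · intro h
    have h1 : s.fst = t.fst := point_injective (congrArg (fun d => d.fst) h)
    have h2 : block s = block t := congrArg (fun d => d.snd) h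
    rw [block_eq_iff] at h2
    obtain ⟨a, b, c, p, q, r⟩ := s
    obtain ⟨a', b', c', p', q', r'⟩ := t
    simp only at h1 h2
    subst h1
    have hb : b ∈ ({a, b', c'} : Set (Fin n)) := h2 ▸ (by simp)
    have hc : c ∈ ({a, b', c'} : Set (Fin n)) := h2 ▸ (by simp)
    simp only [Set.mem_insert_iff, Set.mem_singleton_iff, p.symm, q, false_or] at hb hc
    simp only [Triple.flip, Triple.mk.injEq, true_and]
    rcases hb with rfl | rfl <;> rcases hc with rfl | rfl
    · exact absurd rfl r
    · exact .inl ⟨rfl, rfl⟩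
    · exact .inr ⟨rfl, rfl⟩
    · exact absurd rfl r
  · rintro (rfl | rfl)
    · rfl
    · exact pointDart_flip t

lemma blockDart_eq_iff {s t : Triple n} : blockDart s = blockDart t ↔ s = t ∨ s = t.flip := by
  rw [← pointDart_eq_iff, ← symm_pointDart, ← symm_pointDart]
  exact SimpleGraph.Dart.symm_involutive.injective.eq_iff

lemma pointDart_ne_blockDart (s t : Triple n) : pointDart s ≠ blockDart t := fun h => by
  have := congrArg (fun d => d.fst) h
  simp [pointDart, blockDart, point, block] at this

lemma exists_dart (d : (leviGraphThree n).Dart) :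
    ∃ t : Triple n, d = pointDart t ∨ d = blockDart t := by
  obtain ⟨⟨x, y⟩, h⟩ := d
  have key : ∀ (v : (completeUniformHypergraph n 3).vertexSet)
      (e : (completeUniformHypergraph n 3).edgeSet) (h : (leviGraphThree n).Adj (.inl v) (.inr e)),
      ∃ t : Triple n, (⟨(.inl v, .inr e), h⟩ : (leviGraphThree n).Dart) = pointDart t := by
    intro v e h
    have hv : (v : Fin n) ∈ (e : Set (Fin n)) := h
    obtain ⟨v, _⟩ := v
    obtain ⟨⟨a, b, c, p, q, r⟩, ht⟩ := exists_block e
    have he : e = ⟨{a, b, c}, _⟩ := (Sum.inr_injective ht).symm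
    simp only [he, Set.mem_insert_iff, Set.mem_singleton_iff] at hv
    rcases hv with rfl | rfl | rfl
    · exact ⟨⟨v, b, c, p, q, r⟩, SimpleGraph.Dart.ext _ _ (Prod.ext rfl ht.symm)⟩
    · refine ⟨Triple.shift ⟨a, v, c, p, q, r⟩, SimpleGraph.Dart.ext _ _ (Prod.ext rfl ?_)⟩
      exact ht.symm.trans (block_shift _).symm
    · refine ⟨Triple.shift (Triple.shift ⟨a, b, v, p, q, r⟩),
        SimpleGraph.Dart.ext _ _ (Prod.ext rfl ?_)⟩
      exact ht.symm.trans ((block_shift _).symm.trans (block_shift _).symm)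
  match x, y, h with
  | .inl v, .inl w, h => exact h.elim
  | .inr e, .inr f, h => exact h.elim
  | .inl v, .inr e, h =>
    obtain ⟨t, ht⟩ := key v e h
    exact ⟨t, .inl ht⟩
  | .inr e, .inl v, h =>
    obtain ⟨t, ht⟩ := key v e h.symm
    refine ⟨t, .inr ?_⟩
    rw [← symm_pointDart, ← ht]
    rfl

end LeviGraphThree

/-! ### The embedding scheme of a directed transition system -/

/-- A transition system together with the directions of the closed trails and cyclic orders of the
triples. -/
structure DirectedTransitions (n : ℕ) where
  T : TransitionSystem (Fin n)
  /-- The triple is passed from the second to the third point in the trail at the first point. -/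
  dir : Triple n → ℤˣ
  /-- The cyclic order of the three points in the rotation at their hyperedge. -/
  ori : Triple n → ℤˣ
  dir_flip : ∀ t, dir t.flip = -dir t
  ori_flip : ∀ t, ori t.flip = -ori t
  dir_turn : ∀ t, dir (Triple.turn T t) = dir t
  ori_shift : ∀ t, ori (Triple.shift t) = ori t
  sameCycle : ∀ s t, s.fst = t.fst → dir s = 1 → dir t = 1 → (Triple.turn T).SameCycle s t

/-- A shift brings the required point to the front. Then only the order of the other two is open,
and the sign decides it. -/
lemma Triple.sameCycle_shift {n : ℕ} (e : Triple n → ℤˣ) (he : ∀ t, e t.flip = -e t)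
    (hs : ∀ t, e (Triple.shift t) = e t) (s t : Triple n)
    (hst : ({s.fst, s.snd, s.thd} : Set (Fin n)) = {t.fst, t.snd, t.thd})
    (h : e s = e t) : (Triple.shift (n := n)).SameCycle s t := by
  have key : ∃ r : Triple n, (Triple.shift (n := n)).SameCycle s r ∧ r.fst = t.fst := by
    have ht : t.fst ∈ ({s.fst, s.snd, s.thd} : Set (Fin n)) := hst ▸ (by simp)
    simp only [Set.mem_insert_iff, Set.mem_singleton_iff] at ht
    rcases ht with ht | ht | ht
    · exact ⟨s, .refl _ _, ht.symm⟩
    · exact ⟨shift s, Perm.sameCycle_apply_right.2 (.refl _ _), ht.symm⟩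
    · exact ⟨shift (shift s), Perm.sameCycle_apply_right.2
        (Perm.sameCycle_apply_right.2 (.refl _ _)), ht.symm⟩
  obtain ⟨r, hr, hrt⟩ := key
  have inv : ∀ s r, (Triple.shift (n := n)).SameCycle s r →
      LeviGraphThree.block r = LeviGraphThree.block s ∧ e r = e s := by
    intro s r h
    obtain ⟨i, rfl⟩ := h.exists_nat_pow_eq
    clear h hr
    induction i with
    | zero => exact ⟨rfl, rfl⟩
    | succ i ih =>
      rw [pow_succ', Perm.mul_apply, LeviGraphThree.block_shift, hs]
      exact ih
  obtain ⟨h1, h2⟩ := inv s r hr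
  have h3 : LeviGraphThree.pointDart r = LeviGraphThree.pointDart t := by
    refine SimpleGraph.Dart.ext _ _ (Prod.ext (congrArg LeviGraphThree.point hrt) ?_)
    exact h1.trans (LeviGraphThree.block_eq_iff.2 hst)
  rcases LeviGraphThree.pointDart_eq_iff.1 h3 with rfl | rfl
  · exact hr
  · rw [he, h] at h2
    exact absurd h2.symm (units_ne_neg_self _)

namespace DirectedTransitions

open LeviGraphThree

variable {n : ℕ} (D : DirectedTransitions n)

/-- The darts correspond to the positive triples at the points and at the hyperedges. -/
noncomputable def dartEquiv :
    {t : Triple n // D.dir t = 1} ⊕ {t : Triple n // D.ori t = 1} ≃ (leviGraphThree n).Dart :=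
  Equiv.ofBijective (Sum.elim (fun t => pointDart t.1) (fun t => blockDart t.1)) <| by
    constructor
    · rintro (⟨s, hs⟩ | ⟨s, hs⟩) (⟨t, ht⟩ | ⟨t, ht⟩) h <;> simp only [Sum.elim_inl, Sum.elim_inr] at h
      · rcases pointDart_eq_iff.1 h with rfl | rfl
        · rfl
        · rw [D.dir_flip, ht] at hs
          exact absurd hs (by decide)
      · exact absurd h (pointDart_ne_blockDart _ _)
      · exact absurd h.symm (pointDart_ne_blockDart _ _)
      · rcases blockDart_eq_iff.1 h with rfl | rfl
        · rfl
        · rw [D.ori_flip, ht] at hs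
          exact absurd hs (by decide)
    · intro d
      obtain ⟨t, rfl | rfl⟩ := exists_dart d
      · rcases Int.units_eq_one_or (D.dir t) with h | h
        · exact ⟨.inl ⟨t, h⟩, rfl⟩
        · exact ⟨.inl ⟨t.flip, by rw [D.dir_flip, h, neg_neg]⟩, pointDart_flip t⟩
      · rcases Int.units_eq_one_or (D.ori t) with h | h
        · exact ⟨.inr ⟨t, h⟩, rfl⟩
        · exact ⟨.inr ⟨t.flip, by rw [D.ori_flip, h, neg_neg]⟩, blockDart_flip t⟩

lemma dartEquiv_inl (t : {t : Triple n // D.dir t = 1}) :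
    D.dartEquiv (.inl t) = pointDart t.1 := rfl

lemma dartEquiv_inr (t : {t : Triple n // D.ori t = 1}) :
    D.dartEquiv (.inr t) = blockDart t.1 := rfl

/-- The rotation system. -/
noncomputable def rotation : Perm (leviGraphThree n).Dart :=
  D.dartEquiv.permCongr (Perm.sumCongr
    ((Triple.turn D.T).subtypePerm (p := fun t => D.dir t = 1) fun t => by rw [D.dir_turn])
    ((Triple.shift).subtypePerm (p := fun t => D.ori t = 1) fun t => by rw [D.ori_shift]))

lemma rotation_pointDart {t : Triple n} (ht : D.dir t = 1) :
    D.rotation (pointDart t) = pointDart (Triple.turn D.T t) := by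
  rw [← D.dartEquiv_inl ⟨t, ht⟩, rotation, permCongr_apply, symm_apply_apply]
  rfl

lemma rotation_blockDart {t : Triple n} (ht : D.ori t = 1) :
    D.rotation (blockDart t) = blockDart (Triple.shift t) := by
  rw [← D.dartEquiv_inr ⟨t, ht⟩, rotation, permCongr_apply, symm_apply_apply]
  rfl

lemma dir_turn_inv (t : Triple n) : D.dir ((Triple.turn D.T)⁻¹ t) = D.dir t := by
  have := D.dir_turn ((Triple.turn D.T)⁻¹ t)
  rw [← this]; simp

lemma ori_shift_inv (t : Triple n) : D.ori ((Triple.shift)⁻¹ t) = D.ori t := by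
  have := D.ori_shift ((Triple.shift)⁻¹ t)
  rw [← this]; simp

lemma rotation_inv_pointDart {t : Triple n} (ht : D.dir t = -1) :
    D.rotation⁻¹ (pointDart t) = pointDart (Triple.turn D.T t) := by
  rw [Perm.inv_eq_iff_eq, ← pointDart_flip t, ← pointDart_flip (Triple.turn D.T t)]
  have h := Triple.flip_turn_flip D.T t.flip
  rw [Triple.flip_flip] at h
  rw [h, D.rotation_pointDart (by rw [D.dir_turn_inv, D.dir_flip, ht, neg_neg])]
  simp

lemma rotation_inv_blockDart {t : Triple n} (ht : D.ori t = -1) :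
    D.rotation⁻¹ (blockDart t) = blockDart (Triple.shift t) := by
  rw [Perm.inv_eq_iff_eq, ← blockDart_flip t, ← blockDart_flip (Triple.shift t)]
  have h := Triple.flip_shift_flip t.flip
  rw [Triple.flip_flip] at h
  rw [h, D.rotation_blockDart (by rw [D.ori_shift_inv, D.ori_flip, ht, neg_neg])]
  simp

/-- The exponent makes the formula independent of the direction: it holds for `t` as well as for
`t.flip`, which have the same dart. -/
lemma rotation_zpow_pointDart (t : Triple n) :
    (D.rotation ^ (D.dir t : ℤ)) (pointDart t) = pointDart (Triple.turn D.T t) := by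
  rcases Int.units_eq_one_or (D.dir t) with h | h
  · rw [h, Units.val_one, zpow_one, D.rotation_pointDart h]
  · rw [h, Units.val_neg, Units.val_one, zpow_neg_one, D.rotation_inv_pointDart h]

lemma rotation_zpow_blockDart (t : Triple n) :
    (D.rotation ^ (D.ori t : ℤ)) (blockDart t) = blockDart (Triple.shift t) := by
  rcases Int.units_eq_one_or (D.ori t) with h | h
  · rw [h, Units.val_one, zpow_one, D.rotation_blockDart h]
  · rw [h, Units.val_neg, Units.val_one, zpow_neg_one, D.rotation_inv_blockDart h]

lemma sameCycle_pointDart {s t : Triple n} (hs : D.dir s = 1)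
    (h : (Triple.turn D.T).SameCycle s t) : D.rotation.SameCycle (pointDart s) (pointDart t) := by
  obtain ⟨i, rfl⟩ := h.exists_nat_pow_eq
  have : D.dir (((Triple.turn D.T) ^ i) s) = 1 ∧
      D.rotation.SameCycle (pointDart s) (pointDart (((Triple.turn D.T) ^ i) s)) := by
    clear h
    induction i with
    | zero => exact ⟨hs, .refl _ _⟩
    | succ i ih =>
      rw [pow_succ', Perm.mul_apply, D.dir_turn, ← D.rotation_pointDart ih.1]
      exact ⟨ih.1, Perm.sameCycle_apply_right.2 ih.2⟩
  exact this.2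

lemma sameCycle_blockDart {s t : Triple n} (hs : D.ori s = 1)
    (h : (Triple.shift (n := n)).SameCycle s t) :
    D.rotation.SameCycle (blockDart s) (blockDart t) := by
  obtain ⟨i, rfl⟩ := h.exists_nat_pow_eq
  have : D.ori ((Triple.shift ^ i) s) = 1 ∧
      D.rotation.SameCycle (blockDart s) (blockDart ((Triple.shift ^ i) s)) := by
    clear h
    induction i with
    | zero => exact ⟨hs, .refl _ _⟩
    | succ i ih =>
      rw [pow_succ', Perm.mul_apply, D.ori_shift, ← D.rotation_blockDart ih.1]
      exact ⟨ih.1, Perm.sameCycle_apply_right.2 ih.2⟩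
  exact this.2

/-- The sign of an edge compares the directions at its ends. -/
noncomputable def signature (d : (leviGraphThree n).Dart) : ℤˣ :=
  Sum.elim (fun t => D.ori t.1) (fun t => D.dir t.1) (D.dartEquiv.symm d)

lemma signature_pointDart (t : Triple n) : D.signature (pointDart t) = D.dir t * D.ori t := by
  rcases Int.units_eq_one_or (D.dir t) with h | h
  · rw [← D.dartEquiv_inl ⟨t, h⟩, signature, symm_apply_apply, h, one_mul, Sum.elim_inl]
  · rw [← pointDart_flip, ← D.dartEquiv_inl ⟨t.flip, by rw [D.dir_flip, h, neg_neg]⟩, signature,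
      symm_apply_apply, Sum.elim_inl]
    exact (D.ori_flip t).trans (by rw [h, neg_mul, one_mul])

lemma signature_blockDart (t : Triple n) : D.signature (blockDart t) = D.dir t * D.ori t := by
  rcases Int.units_eq_one_or (D.ori t) with h | h
  · rw [← D.dartEquiv_inr ⟨t, h⟩, signature, symm_apply_apply, h, mul_one, Sum.elim_inr]
  · rw [← blockDart_flip, ← D.dartEquiv_inr ⟨t.flip, by rw [D.ori_flip, h, neg_neg]⟩, signature,
      symm_apply_apply, Sum.elim_inr]
    exact (D.dir_flip t).trans (by rw [h, mul_neg, mul_one])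

/-- The quadrangular embedding that belongs to a directed system. -/
noncomputable def toScheme : EmbeddingScheme (leviGraphThree n) where
  rot := D.rotation
  rot_fst d := by
    obtain ⟨x, rfl⟩ := D.dartEquiv.surjective d
    rcases x with ⟨t, ht⟩ | ⟨t, ht⟩
    · rw [D.dartEquiv_inl, D.rotation_pointDart ht]; rfl
    · rw [D.dartEquiv_inr, D.rotation_blockDart ht]; exact block_shift t
  rot_sameCycle d d' h := by
    obtain ⟨x, rfl⟩ := D.dartEquiv.surjective d
    obtain ⟨y, rfl⟩ := D.dartEquiv.surjective d'
    rcases x with ⟨s, hs⟩ | ⟨s, hs⟩ <;> rcases y with ⟨t, ht⟩ | ⟨t, ht⟩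
    · exact D.sameCycle_pointDart hs (D.sameCycle s t (point_injective h) hs ht)
    · exact absurd h Sum.inl_ne_inr
    · exact absurd h Sum.inr_ne_inl
    · exact D.sameCycle_blockDart hs (Triple.sameCycle_shift D.ori D.ori_flip D.ori_shift s t
        (block_eq_iff.1 h) (hs.trans ht.symm))
  sign := D.signature
  sign_symm d := by
    obtain ⟨t, rfl | rfl⟩ := exists_dart d
    · rw [symm_pointDart, D.signature_blockDart, D.signature_pointDart]
    · rw [symm_blockDart, D.signature_blockDart, D.signature_pointDart]

lemma isOrientable_of_dir_eq_ori (h : D.dir = D.ori) : D.toScheme.IsOrientable := by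
  refine ⟨D.toScheme, ⟨∅, by simp, by simp⟩, fun d => ?_⟩
  obtain ⟨t, rfl | rfl⟩ := exists_dart d
  · exact (D.signature_pointDart t).trans (by rw [h, Int.units_mul_self])
  · exact (D.signature_blockDart t).trans (by rw [h, Int.units_mul_self])

/-- An orientation of the surface yields an alternating sign that changes between neighbouring
triples. -/
lemma exists_isCompatible (h : D.toScheme.IsOrientable) :
    ∃ o : Fin n → Fin n → Fin n → ℤˣ, IsAlternating o ∧ D.T.IsCompatible o := by
  classical
  obtain ⟨ψ, ⟨U, -, hU⟩, hψ⟩ := h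
  let f : (completeUniformHypergraph n 3).vertexSet ⊕ (completeUniformHypergraph n 3).edgeSet →
    ℤˣ := fun x => if x ∈ U then -1 else 1
  -- `f` records the switched vertices; positive signs after switching mean that the corrected
  -- directions agree at both ends of every edge.
  have key : ∀ t : Triple n, D.dir t * f (point t.fst) = D.ori t * f (block t) := by
    intro t
    have h1 := (hU (pointDart t)).1
    have h2 := (hU (pointDart t)).2
    rw [hψ] at h1 h2
    change _ → 1 = D.signature (pointDart t) at h1
    change _ → 1 = -D.signature (pointDart t) at h2
    rw [D.signature_pointDart] at h1 h2
    change (point t.fst ∈ U ↔ block t ∈ U) → _ at h1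
    change ¬ (point t.fst ∈ U ↔ block t ∈ U) → _ at h2
    have e1 : ∀ x y : ℤˣ, 1 = x * y → x = y := by decide
    have e2 : ∀ x y : ℤˣ, 1 = -(x * y) → x = -y := by decide
    by_cases c1 : point t.fst ∈ U <;> by_cases c2 : block t ∈ U
    · simp only [f, if_pos c1, if_pos c2, e1 _ _ (h1 (iff_of_true c1 c2))]
    · simp only [f, if_pos c1, if_neg c2, e2 _ _ (h2 fun h => c2 (h.1 c1)), neg_mul_neg]
    · simp only [f, if_neg c1, if_pos c2, e2 _ _ (h2 fun h => c1 (h.2 c2)), mul_neg, neg_mul]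
    · simp only [f, if_neg c1, if_neg c2, e1 _ _ (h1 (iff_of_false c1 c2))]
  -- By `key` the sign can be read off at the hyperedge, where it is seen to be alternating, or at
  -- the point, where it is seen to be constant along the trail.
  refine ⟨fun v w x => if h : v ≠ w ∧ x ≠ v ∧ x ≠ w then
    D.ori ⟨v, w, x, h.1, h.2.1, h.2.2⟩ * f (block ⟨v, w, x, h.1, h.2.1, h.2.2⟩) else 1, ?_, ?_⟩
  · intro v w x h1 h2 h3
    beta_reduce
    rw [dif_pos ⟨h1.symm, h3, h2⟩, dif_pos ⟨h1, h2, h3⟩, dif_pos ⟨h2.symm, h1.symm, h3.symm⟩]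
    set t : Triple n := ⟨v, w, x, h1, h2, h3⟩ with ht
    have e1 : (⟨v, x, w, h2.symm, h1.symm, h3.symm⟩ : Triple n) = t.flip := rfl
    have e2 : (⟨w, v, x, h1.symm, h3, h2⟩ : Triple n) = (Triple.shift t).flip := rfl
    rw [e1, e2, block_flip, block_flip, block_shift, D.ori_flip, D.ori_flip, D.ori_shift]
    simp
  · intro v w x h1 h2 h3
    have h4 := D.T.next_ne_left (w := w) h2
    have h5 := D.T.next_ne_right (v := v) h3
    beta_reduce
    rw [dif_pos ⟨h1, h4, h5⟩, dif_pos ⟨h1, h2, h3⟩, ← key, ← key]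
    have e : (⟨v, w, D.T.next v w x, h1, h4, h5⟩ : Triple n) =
      Triple.turn D.T (Triple.flip ⟨v, w, x, h1, h2, h3⟩) := rfl
    simp only [e, D.dir_turn, D.dir_flip, neg_mul]

end DirectedTransitions

/-! ### Every face has at least eight flags -/

namespace EmbeddingScheme

variable {V : Type*} {G : SimpleGraph V} (φ : EmbeddingScheme G)

lemma flagAdj_corner (a : G.Dart × ℤˣ) : φ.FlagAdj a ((φ.rot ^ (a.2 : ℤ)) a.1, -a.2) := .inl rfl

lemma flagAdj_side (a : G.Dart × ℤˣ) : φ.FlagAdj a (a.1.symm, -(a.2 * φ.sign a.1)) := .inr rfl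

lemma zpow_rot_fst (i : ℤ) (d : G.Dart) : ((φ.rot ^ i) d).fst = d.fst := by
  have h : ∀ (i : ℕ) (d : G.Dart), ((φ.rot ^ i) d).fst = d.fst := by
    intro i
    induction i with
    | zero => intro d; rfl
    | succ i ih => intro d; rw [pow_succ, Perm.mul_apply, ih, φ.rot_fst]
  rcases Int.eq_nat_or_neg i with ⟨k, rfl | rfl⟩
  · rw [zpow_natCast, h]
  · rw [zpow_neg, zpow_natCast, ← h k ((φ.rot ^ k)⁻¹ d)]
    simp

/-- In a bipartite graph without vertices of degree one, three successive edges `w'v`, `vw`, `wu`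
along a face and the edge after `w'v` on the other side have eight different darts: every
combination of the three properties occurs. -/
lemma exists_flag_of_face (c : V → Bool) (hc : ∀ u w, G.Adj u w → c u ≠ c w)
    (hrot : ∀ d, φ.rot d ≠ d) (a : G.Dart × ℤˣ) (p q r : Prop) : ∃ b : G.Dart × ℤˣ,
      (Quot.mk _ b : φ.Face) = Quot.mk _ a ∧ (c b.1.fst = c a.1.fst ↔ p) ∧
      ((a.1.fst = b.1.fst ∨ a.1.fst = b.1.snd) ↔ q) ∧
      ((a.1.snd = b.1.fst ∨ a.1.snd = b.1.snd) ↔ r) := by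
  have turn : ∀ a : G.Dart × ℤˣ, ∃ b : G.Dart × ℤˣ, (Quot.mk _ b : φ.Face) = Quot.mk _ a ∧
      b.1.fst = a.1.fst ∧ b.1.snd ≠ a.1.snd := by
    intro a
    refine ⟨_, (Quot.sound (φ.flagAdj_corner a)).symm, φ.zpow_rot_fst _ _, fun h => ?_⟩
    have h1 : (φ.rot ^ (a.2 : ℤ)) a.1 = a.1 :=
      SimpleGraph.Dart.ext _ _ (Prod.ext (φ.zpow_rot_fst _ _) h)
    rcases Int.units_eq_one_or a.2 with h2 | h2
    · rw [h2, Units.val_one, zpow_one] at h1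
      exact hrot _ h1
    · rw [h2, Units.val_neg, Units.val_one, zpow_neg_one, Perm.inv_eq_iff_eq] at h1
      exact hrot _ h1.symm
  have side : ∀ a : G.Dart × ℤˣ, ∃ b : G.Dart × ℤˣ, (Quot.mk _ b : φ.Face) = Quot.mk _ a ∧
      b.1.fst = a.1.snd ∧ b.1.snd = a.1.fst := fun a =>
    ⟨_, (Quot.sound (φ.flagAdj_side a)).symm, rfl, rfl⟩
  obtain ⟨a₁, f₁, v₁, w₁⟩ := turn a
  obtain ⟨a₂, f₂, v₂, w₂⟩ := side a
  obtain ⟨a₃, f₃, v₃, w₃⟩ := side a₁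
  obtain ⟨a₄, f₄, v₄, w₄⟩ := turn a₂
  obtain ⟨a₅, f₅, v₅, w₅⟩ := turn a₃
  obtain ⟨a₆, f₆, v₆, w₆⟩ := side a₄
  obtain ⟨a₇, f₇, v₇, w₇⟩ := side a₅
  have hb : ∀ x y z : Bool, x ≠ y → x ≠ z → y = z := by decide
  have c₀ := hc _ _ a.1.adj
  have c₁ := hb _ _ _ (v₁ ▸ hc _ _ a₁.1.adj) c₀
  have c₄ := hb _ _ _ (v₂ ▸ v₄ ▸ hc _ _ a₄.1.adj) c₀.symm
  have c₅ := hb _ _ _ (c₁ ▸ v₃ ▸ v₅ ▸ hc _ _ a₅.1.adj) c₀.symm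
  clear turn side hc hrot hb
  by_cases hp : p <;> by_cases hq : q <;> by_cases hr : r <;>
    simp only [hp, hq, hr, iff_true, iff_false]
  · exact ⟨a, rfl, rfl, .inl rfl, .inr rfl⟩
  · exact ⟨a₁, f₁, by grind, by grind, by grind⟩
  · exact ⟨a₆, by grind, by grind, by grind, by grind⟩
  · exact ⟨a₇, by grind, by grind, by grind, by grind⟩
  · exact ⟨a₂, by grind, by grind, by grind, by grind⟩
  · exact ⟨a₃, by grind, by grind, by grind, by grind⟩
  · exact ⟨a₄, by grind, by grind, by grind, by grind⟩
  · exact ⟨a₅, by grind, by grind, by grind, by grind⟩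

/-- The three properties in `exists_flag_of_face`, taken relative to a representative flag, label
eight different flags of each face. -/
lemma eight_mul_card_face_le [Finite G.Dart] (c : V → Bool) (hc : ∀ u w, G.Adj u w → c u ≠ c w)
    (hrot : ∀ d, φ.rot d ≠ d) : 8 * Nat.card φ.Face ≤ Nat.card (G.Dart × ℤˣ) := by
  classical
  have key : ∀ (F : φ.Face) (i : Prop × Prop × Prop), ∃ b : G.Dart × ℤˣ,
      (Quot.mk _ b : φ.Face) = F ∧ ((c b.1.fst = c F.out.1.fst) ,
      ((F.out.1.fst = b.1.fst ∨ F.out.1.fst = b.1.snd),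
      (F.out.1.snd = b.1.fst ∨ F.out.1.snd = b.1.snd))) = i := by
    rintro F ⟨p, q, r⟩
    obtain ⟨b, h, h1, h2, h3⟩ := φ.exists_flag_of_face c hc hrot F.out p q r
    refine ⟨b, h.trans F.out_eq, ?_⟩
    simp only [h1, h2, h3]
  choose f hf hi using key
  have inj : Function.Injective fun x : φ.Face × (Prop × Prop × Prop) => f x.1 x.2 := by
    rintro ⟨F, i⟩ ⟨F', i'⟩ h
    have h1 : F = F' := (hf F i).symm.trans ((congrArg (Quot.mk _) h).trans (hf F' i'))
    subst h1
    have h2 := hi F i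
    rw [show f F i = f F i' from h, hi F i'] at h2
    rw [h2]
  have := Nat.card_le_card_of_injective _ inj
  simpa [Nat.card_prod, mul_comm] using this

end EmbeddingScheme

namespace LeviGraphThree

variable {n : ℕ}

instance : Finite ((completeUniformHypergraph n 3).vertexSet ⊕
    (completeUniformHypergraph n 3).edgeSet) := inferInstance

instance : Finite (leviGraphThree n).Dart :=
  Finite.of_injective (fun d => d.toProd) fun _ _ h => SimpleGraph.Dart.ext _ _ h

/-- A fixed dart would be the only one at its tail, since the rotation is a single cycle, but for `n
≥ 4` each point is in several triples and each triple has three points. -/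
lemma rot_ne (hn : 4 ≤ n) (ψ : EmbeddingScheme (leviGraphThree n)) (d : (leviGraphThree n).Dart) :
    ψ.rot d ≠ d := by
  intro h
  have key : ∀ d', d.fst = d'.fst → d = d' := fun d' h' => by
    obtain ⟨i, hi⟩ := ψ.rot_sameCycle d d' h'
    rw [← hi, Perm.zpow_apply_eq_self_of_apply_eq_self h]
  obtain ⟨t, rfl | rfl⟩ := exists_dart d
  · obtain ⟨y, hy⟩ : ∃ y, y ∉ ({t.fst, t.snd, t.thd} : Finset (Fin n)) := by
      by_contra! hy
      have := Finset.card_le_card (fun y _ => hy y : Finset.univ ⊆ _)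
      have := Finset.card_le_three (a := t.fst) (b := t.snd) (c := t.thd)
      simp only [Finset.card_univ, Fintype.card_fin] at *
      omega
    simp only [Finset.mem_insert, Finset.mem_singleton, not_or] at hy
    have := key (pointDart ⟨t.fst, t.snd, y, t.fst_ne_snd, hy.1, hy.2.1⟩) rfl
    rcases pointDart_eq_iff.1 this with h1 | h1
    · exact hy.2.2 (congrArg Triple.thd h1).symm
    · exact hy.2.1 (congrArg Triple.snd h1).symm
  · have := key (blockDart (Triple.shift t)) (block_shift t).symm
    exact t.fst_ne_snd (point_injective (congrArg (fun d => d.snd) this))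

lemma eight_mul_card_face_le (hn : 4 ≤ n) (ψ : EmbeddingScheme (leviGraphThree n)) :
    8 * Nat.card ψ.Face ≤ Nat.card ((leviGraphThree n).Dart × ℤˣ) := by
  refine ψ.eight_mul_card_face_le Sum.isLeft ?_ (rot_ne hn ψ)
  rintro (u | u) (w | w) h
  · exact h.elim
  · simp
  · simp
  · exact h.elim

lemma card_vertices (n : ℕ) : 6 * Nat.card ((completeUniformHypergraph n 3).vertexSet ⊕
    (completeUniformHypergraph n 3).edgeSet) = 6 * n + n * (n - 1) * (n - 2) := by
  have h1 : Nat.card (completeUniformHypergraph n 3).vertexSet = n := by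
    change Nat.card (Set.univ : Set (Fin n)) = n
    simp
  have h2 : Nat.card (completeUniformHypergraph n 3).edgeSet = n.choose 3 := by
    have e : {s : Finset (Fin n) // s.card = 3} ≃ (completeUniformHypergraph n 3).edgeSet :=
      Fintype.finsetEquivSet.subtypeEquiv fun s => by
        change s.card = 3 ↔ (s : Set (Fin n)).ncard = 3
        rw [Set.ncard_coe_finset]
    rw [← Nat.card_congr e, Nat.card_eq_fintype_card, Fintype.card_finset_len, Fintype.card_fin]
  have h3 := Nat.descFactorial_eq_factorial_mul_choose n 3
  rw [Nat.card_sum, h1, h2, mul_add]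
  simp only [Nat.descFactorial, Nat.factorial, Nat.sub_zero, mul_one] at h3
  linarith [h3]

end LeviGraphThree

/-! ### The constructed faces have exactly eight flags; minimum genus -/

namespace DirectedTransitions

open LeviGraphThree

variable {n : ℕ} (D : DirectedTransitions n)

/-- The flags at the points and at the hyperedges, indexed by triples. -/
noncomputable def flagEquiv : Triple n × Bool ≃ (leviGraphThree n).Dart × ℤˣ :=
  Equiv.ofBijective (fun x => bif x.2 then (blockDart x.1, -D.ori x.1)
    else (pointDart x.1, D.dir x.1)) <| by
    constructor
    · rintro ⟨s, _ | _⟩ ⟨t, _ | _⟩ h <;>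
        simp only [cond_true, cond_false, Prod.mk.injEq, neg_inj] at h
      · rcases pointDart_eq_iff.1 h.1 with rfl | rfl
        · rfl
        · exact absurd (h.2.symm.trans (D.dir_flip t)) (units_ne_neg_self _)
      · exact absurd h.1 (pointDart_ne_blockDart _ _)
      · exact absurd h.1.symm (pointDart_ne_blockDart _ _)
      · rcases blockDart_eq_iff.1 h.1 with rfl | rfl
        · rfl
        · exact absurd (h.2.symm.trans (D.ori_flip t)) (units_ne_neg_self _)
    · rintro ⟨d, s⟩
      obtain ⟨t, rfl | rfl⟩ := exists_dart d
      · by_cases h : s = D.dir t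
        · exact ⟨(t, false), by rw [h]; rfl⟩
        · exact ⟨(t.flip, false), Prod.ext (pointDart_flip t)
            ((D.dir_flip t).trans (Int.units_ne_iff_eq_neg.1 h).symm)⟩
      · by_cases h : s = D.ori t
        · exact ⟨(t.flip, true), Prod.ext (blockDart_flip t) (by simp [D.ori_flip, h])⟩
        · exact ⟨(t, true), by rw [Int.units_ne_iff_eq_neg.1 h]; rfl⟩

lemma flagEquiv_false (t : Triple n) : D.flagEquiv (t, false) = (pointDart t, D.dir t) := rfl

lemma flagEquiv_true (t : Triple n) : D.flagEquiv (t, true) = (blockDart t, -D.ori t) := rfl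

/-- The two unordered pairs of points in the face of the flags of a triple. -/
def corner (t : Triple n) : Sym2 (Fin n) × Sym2 (Fin n) :=
  (s(t.fst, t.thd), s(t.snd, D.T.next t.fst t.thd t.snd))

/-- In the quadrangle `v, vwx, x, vxy` the corner of `(v, w, x)` is `{v, x}` and `{w, y}`. Turning
at `v` exchanges `w` and `y`, turning at the hyperedge exchanges `v` and `x`, and passing along an
edge keeps the triple. -/
lemma corner_flagAdj {a b : (leviGraphThree n).Dart × ℤˣ} (h : D.toScheme.FlagAdj a b) :
    D.corner (D.flagEquiv.symm b).1 = D.corner (D.flagEquiv.symm a).1 := by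
  obtain ⟨⟨t, i⟩, rfl⟩ := D.flagEquiv.surjective a
  rw [symm_apply_apply]
  cases i <;> rcases h with rfl | rfl
  · have : ((D.toScheme.rot ^ ((D.flagEquiv (t, false)).2 : ℤ)) (D.flagEquiv (t, false)).1,
        -(D.flagEquiv (t, false)).2) = D.flagEquiv ((Triple.turn D.T t).flip, false) := by
      rw [flagEquiv_false, flagEquiv_false, D.dir_flip, D.dir_turn, pointDart_flip]
      exact Prod.ext (D.rotation_zpow_pointDart t) rfl
    rw [this, symm_apply_apply]
    simp only [corner, Triple.flip, Triple.turn, coe_fn_mk, D.T.next_next]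
    rw [Sym2.eq_swap (a := t.snd)]
  · have : ((D.flagEquiv (t, false)).1.symm, -((D.flagEquiv (t, false)).2 *
        D.toScheme.sign (D.flagEquiv (t, false)).1)) = D.flagEquiv (t, true) := by
      rw [flagEquiv_false, flagEquiv_true]
      refine Prod.ext rfl ?_
      change -(D.dir t * D.signature (pointDart t)) = _
      rw [D.signature_pointDart, ← mul_assoc, Int.units_mul_self, one_mul]
    rw [this, symm_apply_apply]
  · have : ((D.toScheme.rot ^ ((D.flagEquiv (t, true)).2 : ℤ)) (D.flagEquiv (t, true)).1,
        -(D.flagEquiv (t, true)).2) = D.flagEquiv (Triple.shift t.flip, true) := by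
      rw [flagEquiv_true, flagEquiv_true, D.ori_shift, ← D.ori_flip]
      exact Prod.ext ((congrArg _ (blockDart_flip t).symm).trans
        (D.rotation_zpow_blockDart t.flip)) rfl
    rw [this, symm_apply_apply]
    simp only [corner, Triple.flip, Triple.shift, coe_fn_mk]
    rw [Sym2.eq_swap (a := t.thd), D.T.next_comm]
  · have : ((D.flagEquiv (t, true)).1.symm, -((D.flagEquiv (t, true)).2 *
        D.toScheme.sign (D.flagEquiv (t, true)).1)) = D.flagEquiv (t, false) := by
      rw [flagEquiv_false, flagEquiv_true]
      refine Prod.ext rfl ?_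
      change -(-D.ori t * D.signature (blockDart t)) = _
      rw [D.signature_blockDart, neg_mul, neg_neg, mul_comm, mul_assoc, Int.units_mul_self,
        mul_one]
    rw [this, symm_apply_apply]

include D in
lemma card_flag : Nat.card ((leviGraphThree n).Dart × ℤˣ) = 2 * Nat.card (Triple n) := by
  rw [← Nat.card_congr D.flagEquiv, Nat.card_prod]
  simp [mul_comm]

/-- A flag in a given face is determined by its kind, point or hyperedge, and by the choice of the
first and second point of its triple from the two pairs of the corner. -/
lemma card_flag_le : Nat.card ((leviGraphThree n).Dart × ℤˣ) ≤ 8 * Nat.card D.toScheme.Face := by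
  classical
  have : Finite D.toScheme.Face := Quot.finite _
  let rep : D.toScheme.Face → Triple n := fun F => (D.flagEquiv.symm F.out).1
  have hrep : ∀ x : Triple n × Bool,
      D.corner (rep (Quot.mk _ (D.flagEquiv x))) = D.corner x.1 := by
    intro x
    let f : D.toScheme.Face → Sym2 (Fin n) × Sym2 (Fin n) :=
      Quot.lift (fun a => D.corner (D.flagEquiv.symm a).1) fun a b h => (D.corner_flagAdj h).symm
    have h1 : f (Quot.mk _ (Quot.out (Quot.mk D.toScheme.FlagAdj (D.flagEquiv x)))) =
      f (Quot.mk _ (D.flagEquiv x)) := congrArg f (Quot.out_eq _)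
    exact h1.trans (congrArg (fun y => D.corner y.1) (symm_apply_apply _ x))
  -- The two choices are encoded by comparison with a representative triple of the face.
  let g : Triple n × Bool → D.toScheme.Face × Bool × Prop × Prop := fun x =>
    (Quot.mk _ (D.flagEquiv x), x.2, x.1.fst = (rep (Quot.mk _ (D.flagEquiv x))).fst,
      x.1.snd = (rep (Quot.mk _ (D.flagEquiv x))).snd)
  have hg : Function.Injective g := by
    intro x y h
    obtain ⟨h1, h2⟩ := Prod.ext_iff.1 h
    obtain ⟨h2, h3⟩ := Prod.ext_iff.1 h2
    obtain ⟨h3, h4⟩ := Prod.ext_iff.1 h3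
    simp only [g] at h1 h2 h3 h4
    have hx := hrep x
    have hy := hrep y
    rw [← h1] at h3 h4 hy
    generalize rep (Quot.mk _ (D.flagEquiv x)) = r at hx hy h3 h4
    obtain ⟨⟨v, w, u, p1, p2, p3⟩, i⟩ := x
    obtain ⟨⟨v', w', u', p1', p2', p3'⟩, i'⟩ := y
    simp only [corner, Prod.mk.injEq, Sym2.eq_iff, eq_iff_iff] at *
    simp only [Triple.mk.injEq]
    grind
  have := Nat.card_le_card_of_injective _ hg
  rw [Nat.card_congr D.flagEquiv] at this
  simpa [Nat.card_prod, mul_comm] using this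

end DirectedTransitions

namespace DirectedTransitions

open LeviGraphThree

variable {n : ℕ} (D : DirectedTransitions n)

/-- The bound of eight flags per face holds for all embeddings, so no competitor of either kind has
more faces. -/
lemma isMinimumGenus (hn : 4 ≤ n) : D.toScheme.IsMinimumGenus := by
  intro ψ _
  have h1 := LeviGraphThree.eight_mul_card_face_le hn ψ
  have h2 := D.card_flag_le
  simp only [EmbeddingScheme.eulerGenus]
  omega

/-- With `N = n (n - 1) (n - 2)` ordered triples there are `n + N / 6` vertices, `N / 2` edges and,
from `2 N` flags, `N / 4` faces. -/
lemma twelve_mul_eulerGenus (hn : 4 ≤ n) :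
    12 * D.toScheme.eulerGenus = ((n : ℤ) - 2) * ((n : ℤ) + 3) * ((n : ℤ) - 4) := by
  classical
  have h1 := LeviGraphThree.eight_mul_card_face_le hn D.toScheme
  have h2 := D.card_flag_le
  have h3 := D.card_flag
  have h4 := card_vertices n
  have h5 : Nat.card (leviGraphThree n).Dart = 2 * Nat.card (leviGraphThree n).edgeSet := by
    have := Fintype.ofFinite ((completeUniformHypergraph n 3).vertexSet ⊕
      (completeUniformHypergraph n 3).edgeSet)
    rw [Nat.card_eq_fintype_card, Nat.card_eq_fintype_card,
      SimpleGraph.dart_card_eq_twice_card_edges, ← SimpleGraph.edgeFinset_card]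
  have h6 : Nat.card ((leviGraphThree n).Dart × ℤˣ) = 2 * Nat.card (leviGraphThree n).Dart := by
    rw [Nat.card_prod]
    simp [mul_comm]
  have h7 := Triple.card_eq n
  have h8 : ((n * (n - 1) * (n - 2) : ℕ) : ℤ) = n * (n - 1) * (n - 2) := by
    rw [Nat.cast_mul, Nat.cast_mul, Nat.cast_sub (by omega), Nat.cast_sub (by omega)]
    rfl
  simp only [EmbeddingScheme.eulerGenus]
  rw [← h7] at h4 h8
  have h9 : ((n : ℤ) - 2) * ((n : ℤ) + 3) * ((n : ℤ) - 4) =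
      n * (n - 1) * (n - 2) - 12 * n + 24 := by ring
  rw [h9, ← h8]
  omega

end DirectedTransitions

/-! ### Isomorphic embeddings and renaming of the points -/

namespace EmbeddingScheme

lemma Isomorphic.refl {V : Type*} {G : SimpleGraph V} (φ : EmbeddingScheme G) :
    φ.Isomorphic φ :=
  ⟨.refl, ∅, fun _ => ⟨False.elim, fun _ => rfl⟩, fun _ => ⟨fun _ => rfl, fun h => (h Iff.rfl).elim⟩⟩

end EmbeddingScheme

namespace LeviGraphThree

variable {n : ℕ}

lemma adj_point_block (v : Fin n) (t : Triple n) : (leviGraphThree n).Adj (point v) (block t) ↔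
    v = t.fst ∨ v = t.snd ∨ v = t.thd := by
  change v ∈ ({t.fst, t.snd, t.thd} : Set (Fin n)) ↔ _
  simp

/-- An automorphism maps points to points. -/
lemma exists_point (hn : 6 ≤ n) (α : leviGraphThree n ≃g leviGraphThree n) (v : Fin n) :
    ∃ w, α (point v) = point w := by
  rcases h : α (point v) with w | e
  · exact ⟨w.1, rfl⟩
  exfalso
  obtain ⟨b, hb⟩ : ∃ b, b ≠ v := by
    have : Nontrivial (Fin n) := Fin.nontrivial_iff_two_le.2 (by omega)
    exact exists_ne v
  -- The `n - 2 ≥ 4` triples through `v` and `b` are neighbours of `v`; they would be mapped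
  -- injectively into the three points of a hyperedge.
  let t : {y // y ∉ ({v, b} : Finset (Fin n))} → Triple n := fun y =>
    ⟨v, b, y.1, hb.symm, fun h => y.2 (by simp [h]), fun h => y.2 (by simp [h])⟩
  have key : ∀ y, ∃ w : e.1, α (block (t y)) = point w.1 := by
    intro y
    have hadj := α.map_adj_iff.2 ((adj_point_block v (t y)).2 (.inl rfl))
    rw [h] at hadj
    rcases h' : α (block (t y)) with w | f
    · rw [h'] at hadj
      exact ⟨⟨w.1, hadj⟩, rfl⟩
    · rw [h'] at hadj
      exact hadj.elim
  choose f hf using key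
  have hinj : Function.Injective f := by
    intro y y' hy
    have h1 : block (t y) = block (t y') := α.injective (by rw [hf, hf, hy])
    have h2 : pointDart (t y) = pointDart (t y') :=
      SimpleGraph.Dart.ext _ _ (Prod.ext rfl h1)
    rcases pointDart_eq_iff.1 h2 with h3 | h3
    · exact Subtype.ext (congrArg Triple.thd h3)
    · have h4 : b = y'.1 := congrArg Triple.snd h3
      exact absurd y'.2 (by simp [← h4])
  have h1 := Nat.card_le_card_of_injective f hinj
  have h2 : Nat.card e.1 = 3 := e.2
  have h3 : Nat.card {y // y ∉ ({v, b} : Finset (Fin n))} = n - 2 := by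
    rw [Nat.card_eq_fintype_card, Fintype.card_subtype_compl, Fintype.card_coe,
      Finset.card_pair hb.symm, Fintype.card_fin]
  omega

end LeviGraphThree

/-- Renaming of the points of a triple. -/
def Triple.map {n : ℕ} (σ : Perm (Fin n)) (t : Triple n) : Triple n :=
  ⟨σ t.fst, σ t.snd, σ t.thd, σ.injective.ne t.fst_ne_snd, σ.injective.ne t.thd_ne_fst,
    σ.injective.ne t.thd_ne_snd⟩

namespace LeviGraphThree

variable {n : ℕ}

/-- Automorphisms come from permutations of the points. -/
lemma exists_perm (hn : 6 ≤ n) (α : leviGraphThree n ≃g leviGraphThree n) :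
    ∃ σ : Perm (Fin n), ∀ t, autDart α (pointDart t) = pointDart (t.map σ) := by
  choose σ hσ using exists_point hn α
  have hinj : Function.Injective σ := fun v w h =>
    point_injective (α.injective (by rw [hσ, hσ, h]))
  refine ⟨Equiv.ofBijective σ (Finite.injective_iff_bijective.1 hinj), fun t =>
    SimpleGraph.Dart.ext _ _ (Prod.ext (hσ t.fst) ?_)⟩
  change α (block t) = _
  have key : ∀ v, v = t.fst ∨ v = t.snd ∨ v = t.thd →
      (leviGraphThree n).Adj (point (σ v)) (α (block t)) := fun v hv => by
    rw [← hσ]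
    exact α.map_adj_iff.2 ((adj_point_block v t).2 hv)
  have h1 := key t.fst (.inl rfl)
  have h2 := key t.snd (.inr (.inl rfl))
  have h3 := key t.thd (.inr (.inr rfl))
  rcases hα : α (block t) with w | e
  · rw [hα] at h1
    exact h1.elim
  · rw [hα] at h1 h2 h3
    refine congrArg Sum.inr (Subtype.ext (Eq.symm ?_))
    have hfin : e.1.Finite := Set.toFinite _
    refine Set.eq_of_subset_of_ncard_le ?_ ?_ hfin
    · rintro x (rfl | rfl | rfl)
      exacts [h1, h2, h3]
    · exact (show e.1.ncard = 3 from e.2).le.trans (Triple.ncard_eq_three _).ge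

end LeviGraphThree

namespace TransitionSystem

variable {V : Type*}

lemma ext_next {T T' : TransitionSystem V} (h : ∀ v w x, T.next v w x = T'.next v w x) :
    T = T' := by
  obtain ⟨f⟩ := T
  obtain ⟨f'⟩ := T'
  obtain rfl : f = f' := funext fun v => funext fun w => funext fun x => h v w x
  rfl

/-- Permutations of the points act on transition systems. -/
instance : MulAction (Perm V) (TransitionSystem V) where
  smul σ T :=
    { next := fun v w x => σ (T.next (σ⁻¹ v) (σ⁻¹ w) (σ⁻¹ x))
      next_comm := fun v w x => by rw [T.next_comm]
      next_next := fun v w x => by simp [T.next_next]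
      next_left := fun v w => by simp [T.next_left]
      next_self := fun v x => by simp [T.next_self] }
  one_smul T := rfl
  mul_smul σ τ T := rfl

lemma smul_next (σ : Perm V) (T : TransitionSystem V) (v w x : V) :
    (σ • T).next v w x = σ (T.next (σ⁻¹ v) (σ⁻¹ w) (σ⁻¹ x)) := rfl

end TransitionSystem

namespace EmbeddingScheme

variable {V : Type*} {G : SimpleGraph V} {φ ψ : EmbeddingScheme G}

/-- Switching at most reverses a local rotation, so the unordered pair of predecessor and successor
is an invariant. From it the transitions are recovered. -/
lemma Equivalent.neighbours_eq (h : φ.Equivalent ψ) (d : G.Dart) :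
    s(ψ.rot d, ψ.rot⁻¹ d) = s(φ.rot d, φ.rot⁻¹ d) := by
  obtain ⟨U, hU, -⟩ := h
  have hfst : (ψ.rot⁻¹ d).fst = d.fst := by
    have := ψ.rot_fst (ψ.rot⁻¹ d)
    simpa using this.symm
  have h1 := hU (ψ.rot⁻¹ d)
  rw [hfst] at h1
  by_cases hd : d.fst ∈ U
  · have h2 := h1.1 hd
    rw [show ψ.rot (ψ.rot⁻¹ d) = d from ψ.rot.apply_symm_apply d, Perm.eq_inv_iff_eq] at h2
    rw [(hU d).1 hd, ← h2, Sym2.eq_swap]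
  · have h2 := h1.2 hd
    rw [show ψ.rot (ψ.rot⁻¹ d) = d from ψ.rot.apply_symm_apply d] at h2
    rw [(hU d).2 hd, ← Perm.inv_eq_iff_eq.2 h2]

end EmbeddingScheme

namespace DirectedTransitions

open LeviGraphThree

variable {n : ℕ} (D D' : DirectedTransitions n)

lemma neighbours_pointDart (t : Triple n) :
    s(D.toScheme.rot (pointDart t), D.toScheme.rot⁻¹ (pointDart t)) =
      s(pointDart (Triple.turn D.T t), pointDart (Triple.turn D.T t.flip)) := by
  change s(D.rotation _, D.rotation⁻¹ _) = _
  have h1 := D.rotation_zpow_pointDart t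
  have h2 := D.rotation_zpow_pointDart t.flip
  rw [D.dir_flip, pointDart_flip, Units.val_neg, zpow_neg] at h2
  rw [← h1, ← h2]
  rcases Int.units_eq_one_or (D.dir t) with h | h
  · rw [h, Units.val_one, zpow_one]
  · rw [h, Units.val_neg, Units.val_one, zpow_neg_one, inv_inv, Sym2.eq_swap]

/-- Isomorphic embeddings have conjugate transition systems. -/
lemma mem_orbit_of_isomorphic (hn : 6 ≤ n)
    (hne : ∀ v w x, v ≠ w → x ≠ v → x ≠ w → D'.T.next v w x ≠ x)
    (h : D.toScheme.Isomorphic D'.toScheme) : D'.T ∈ MulAction.orbit (Perm (Fin n)) D.T := by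
  obtain ⟨α, hα⟩ := h
  obtain ⟨σ, hσ⟩ := exists_perm hn α
  have key : ∀ t : Triple n, D'.T.next (σ t.fst) (σ t.thd) (σ t.snd) =
      σ (D.T.next t.fst t.thd t.snd) := by
    intro t
    have h1 := congrArg (Sym2.map (autDart α)) (hα.neighbours_eq (pointDart t))
    rw [D.neighbours_pointDart, Sym2.map_mk, Sym2.map_mk] at h1
    have h2 : s(autDart α ((D'.toScheme.comp α).rot (pointDart t)),
        autDart α ((D'.toScheme.comp α).rot⁻¹ (pointDart t))) =
        s(D'.toScheme.rot (autDart α (pointDart t)),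
          D'.toScheme.rot⁻¹ (autDart α (pointDart t))) := by
      simp [EmbeddingScheme.comp, mul_inv_rev, mul_assoc]
    rw [h2, hσ, hσ, hσ, D'.neighbours_pointDart, Sym2.eq_iff] at h1
    have ne := (t.map σ).thd_ne_snd
    -- Of the four ways to identify the neighbouring triples, only the first can occur; the last is
    -- excluded because the involutions have no fixed points off the pair.
    rcases h1 with ⟨h1, -⟩ | ⟨-, h1⟩
    · rcases pointDart_eq_iff.1 h1 with h3 | h3
      · exact congrArg Triple.thd h3
      · exact absurd (congrArg Triple.thd h3) (D'.T.next_ne_right ne.symm)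
    · rcases pointDart_eq_iff.1 h1 with h3 | h3
      · exact absurd (congrArg Triple.snd h3).symm ne
      · exact absurd (congrArg Triple.thd h3) (hne _ _ _ (t.map σ).fst_ne_snd
          (t.map σ).thd_ne_fst ne)
  refine ⟨σ, TransitionSystem.ext_next fun v w x => ?_⟩
  obtain ⟨v, rfl⟩ := σ.surjective v
  obtain ⟨w, rfl⟩ := σ.surjective w
  obtain ⟨x, rfl⟩ := σ.surjective x
  change (σ • D.T).next _ _ _ = _
  have inv : ∀ v, σ⁻¹ (σ v) = v := σ.symm_apply_apply
  rw [TransitionSystem.smul_next, inv, inv, inv]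
  by_cases h1 : v = w
  · rw [h1, D.T.next_self, D'.T.next_self]
  by_cases h2 : x = v
  · rw [h2, D.T.next_left, D'.T.next_left]
  by_cases h3 : x = w
  · rw [h3, D.T.next_right, D'.T.next_right]
  exact (key ⟨v, x, w, Ne.symm h2, Ne.symm h1, Ne.symm h3⟩).symm

end DirectedTransitions

/-- Representatives of the orbits that meet a set of transition systems. -/
lemma TransitionSystem.exists_subset_orbit {n : ℕ} (S : Finset (TransitionSystem (Fin n))) :
    ∃ S' ⊆ S, S.card ≤ n.factorial * S'.card ∧
      ∀ T ∈ S', ∀ T' ∈ S', T' ∈ MulAction.orbit (Perm (Fin n)) T → T = T' := by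
  classical
  let c : TransitionSystem (Fin n) → Set (TransitionSystem (Fin n)) :=
    MulAction.orbit (Perm (Fin n))
  have hc : ∀ b : {b // b ∈ S.image c}, ∃ T ∈ S, c T = b.1 := fun b => Finset.mem_image.1 b.2
  choose g hgS hg using hc
  have hinj : Function.Injective g := fun b b' h => Subtype.ext (by rw [← hg, ← hg, h])
  refine ⟨(S.image c).attach.image g, ?_, ?_, ?_⟩
  · intro T hT
    obtain ⟨b, -, rfl⟩ := Finset.mem_image.1 hT
    exact hgS b
  · rw [Finset.card_image_of_injective _ hinj, Finset.card_attach]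
    refine Finset.card_le_mul_card_image S _ fun b hb => ?_
    obtain ⟨T, hT, rfl⟩ := Finset.mem_image.1 hb
    calc (S.filter fun T' => c T' = c T).card ≤
        ((Finset.univ : Finset (Perm (Fin n))).image fun σ => σ • T).card := by
          refine Finset.card_le_card fun T' hT' => ?_
          obtain ⟨σ, hσ⟩ := MulAction.orbit_eq_iff.1 (Finset.mem_filter.1 hT').2
          exact Finset.mem_image.2 ⟨σ, Finset.mem_univ _, hσ⟩
      _ ≤ (Finset.univ : Finset (Perm (Fin n))).card := Finset.card_image_le
      _ = n.factorial := by rw [Finset.card_univ, Fintype.card_perm, Fintype.card_fin]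
  · intro T hT T' hT' h
    obtain ⟨b, -, rfl⟩ := Finset.mem_image.1 hT
    obtain ⟨b', -, rfl⟩ := Finset.mem_image.1 hT'
    have : c (g b') = c (g b) := MulAction.orbit_eq_iff.2 h
    rw [hg, hg] at this
    rw [Subtype.ext this]

/-! ### Choosing directions for the trails -/

lemma Triple.sameCycle_turn {n : ℕ} (T : TransitionSystem (Fin n)) {s t : Triple n}
    (h : s.fst = t.fst) (hc : (T.turn s.fst).SameCycle (s.snd, s.thd) (t.snd, t.thd)) :
    (Triple.turn T).SameCycle s t := by
  obtain ⟨i, hi⟩ := hc.exists_nat_pow_eq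
  refine ⟨i, ?_⟩
  rw [zpow_natCast]
  have key : ∀ i : ℕ, ((Triple.turn T ^ i) s).fst = s.fst ∧
      (((Triple.turn T ^ i) s).snd, ((Triple.turn T ^ i) s).thd) =
        (T.turn s.fst ^ i) (s.snd, s.thd) := by
    intro i
    induction i with
    | zero => exact ⟨rfl, rfl⟩
    | succ i ih =>
      rw [pow_succ', Perm.mul_apply, pow_succ', Perm.mul_apply, ← ih.2]
      refine ⟨ih.1, ?_⟩
      rw [← ih.1]
      rfl
  obtain ⟨h1, h2⟩ := key i
  rw [hi, Prod.mk.injEq] at h2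
  exact Triple.ext (h1.trans h) h2.1 h2.2

namespace TransitionSystem

/-- If a trail led from an arc to its reverse, so it would from the next arc to the reverse of that,
in two steps fewer. In the end an arc would be its own reverse, or a transition would have a fixed
point. -/
lemma not_sameCycle_swap {V : Type*} [Finite V] {T : TransitionSystem V}
    (hne : ∀ v w x, v ≠ w → x ≠ v → x ≠ w → T.next v w x ≠ x) {v : V} {a : V × V}
    (ha : IsArc v a) : ¬ (T.turn v).SameCycle a a.swap := by
  intro h
  obtain ⟨i, hi⟩ := h.exists_nat_pow_eq
  clear h
  induction i using Nat.twoStepInduction generalizing a with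
  | zero => exact ha.2.2 (congrArg Prod.fst hi)
  | one => exact hne _ _ _ ha.2.1.symm ha.1 ha.2.2 (congrArg Prod.snd hi)
  | more i ih =>
    refine ih (T.isArc_turn ha) ?_
    rw [← Perm.mul_apply, ← pow_succ]
    apply (T.turn v).injective
    rw [← Perm.mul_apply, ← pow_succ', hi]
    simp [T.next_next, Prod.swap]

variable {n : ℕ} {T : TransitionSystem (Fin n)} {o : Fin n → Fin n → Fin n → ℤˣ}

lemma alternating_flip (ho : IsAlternating o) (t : Triple n) :
    o t.fst t.thd t.snd = -o t.fst t.snd t.thd :=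
  (ho _ _ _ t.fst_ne_snd t.thd_ne_fst t.thd_ne_snd).2

lemma alternating_shift (ho : IsAlternating o) (t : Triple n) :
    o t.snd t.thd t.fst = o t.fst t.snd t.thd := by
  rw [(ho _ _ _ t.fst_ne_snd.symm t.thd_ne_snd t.thd_ne_fst).2,
    (ho _ _ _ t.fst_ne_snd t.thd_ne_fst t.thd_ne_snd).1, neg_neg]

/-- The same sign serves at the points and at the hyperedges, so all edges will be positive. -/
lemma IsOriented.exists_directed (ho : IsAlternating o) (hT : T.IsOriented o) :
    ∃ D : DirectedTransitions n, D.T = T ∧ D.dir = D.ori :=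
  ⟨{  T := T
      dir := fun t => o t.fst t.snd t.thd
      ori := fun t => o t.fst t.snd t.thd
      dir_flip := alternating_flip ho
      ori_flip := alternating_flip ho
      dir_turn := fun t =>
        sign_turn ho hT.compatible (a := (t.snd, t.thd)) ⟨t.fst_ne_snd.symm, t.thd_ne_fst,
          t.thd_ne_snd.symm⟩
      ori_shift := alternating_shift ho
      sameCycle := fun s t h hs ht => Triple.sameCycle_turn T h <|
        hT.unicursal _ _ _ ⟨s.fst_ne_snd.symm, s.thd_ne_fst, s.thd_ne_snd.symm⟩
          (h ▸ ⟨t.fst_ne_snd.symm, t.thd_ne_fst, t.thd_ne_snd.symm⟩) (hs.trans (h ▸ ht.symm)) },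
    rfl, rfl⟩

/-- An arbitrary root arc at each point picks one of the two directions of its trail. The cyclic
orders of the hyperedges are arbitrary as well: any alternating sign will do. -/
lemma IsUnicursal.exists_directed (ho : IsAlternating o) (hT : T.IsUnicursal)
    (hne : ∀ v w x, v ≠ w → x ≠ v → x ≠ w → T.next v w x ≠ x) :
    ∃ D : DirectedTransitions n, D.T = T := by
  classical
  let r : Fin n → Fin n × Fin n := fun v =>
    if h : ∃ a, IsArc v a then h.choose else (v, v)
  have hr : ∀ v a, IsArc v a → IsArc v (r v) := fun v a ha => by
    have h : ∃ a, IsArc v a := ⟨a, ha⟩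
    simp only [r, dif_pos h]
    exact h.choose_spec
  have harc : ∀ t : Triple n, IsArc t.fst (t.snd, t.thd) := fun t =>
    ⟨t.fst_ne_snd.symm, t.thd_ne_fst, t.thd_ne_snd.symm⟩
  let P : Triple n → Prop := fun t => (T.turn t.fst).SameCycle (r t.fst) (t.snd, t.thd)
  have hP : ∀ t, P t.flip ↔ ¬ P t := by
    intro t
    constructor
    · intro h1 h2
      exact not_sameCycle_swap hne (harc t) (h2.symm.trans h1)
    · intro h
      exact (hT t.fst _ _ (hr _ _ (harc t)) (harc t)).resolve_left h
  refine ⟨{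
    T := T
    dir := fun t => if P t then 1 else -1
    ori := fun t => o t.fst t.snd t.thd
    dir_flip := fun t => by by_cases h : P t <;> simp [hP, h]
    ori_flip := alternating_flip ho
    dir_turn := fun t => by
      have : P (Triple.turn T t) ↔ P t :=
        Perm.sameCycle_apply_right (f := T.turn t.fst) (y := (t.snd, t.thd))
      simp only [this]
    ori_shift := alternating_shift ho
    sameCycle := fun s t h hs ht => ?_ }, rfl⟩
  have key : ∀ t, (if P t then (1 : ℤˣ) else -1) = 1 → P t := fun t ht => by
    by_contra h
    rw [if_neg h] at ht
    exact absurd ht (by decide)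
  have h1 := key s hs
  have h2 := key t ht
  simp only [P, ← h] at h1 h2
  exact Triple.sameCycle_turn T h (h1.symm.trans h2)

end TransitionSystem

/-! ### From many systems to many embeddings -/

/-- Many orbits of transition systems give many pairwise non-isomorphic embeddings. -/
lemma exists_finset_scheme {n : ℕ} (hn : 6 ≤ n) (S : Finset (TransitionSystem (Fin n)))
    (p : EmbeddingScheme (leviGraphThree n) → Prop)
    (hS : ∀ T ∈ S, (∀ v w x, v ≠ w → x ≠ v → x ≠ w → T.next v w x ≠ x) ∧
      ∃ D : DirectedTransitions n, D.T = T ∧ p D.toScheme) :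
    ∃ S' : Finset (EmbeddingScheme (leviGraphThree n)), S.card ≤ n.factorial * S'.card ∧
      (∀ φ ∈ S', p φ ∧ φ.IsMinimumGenus ∧
        12 * φ.eulerGenus = ((n : ℤ) - 2) * ((n : ℤ) + 3) * ((n : ℤ) - 4)) ∧
      ∀ φ ∈ S', ∀ ψ ∈ S', φ ≠ ψ → ¬ φ.Isomorphic ψ := by
  classical
  obtain ⟨R, hRS, hR, horb⟩ := TransitionSystem.exists_subset_orbit S
  have h1 : ∀ T : {T // T ∈ R}, ∃ D : DirectedTransitions n, D.T = T.1 ∧ p D.toScheme :=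
    fun T => (hS T.1 (hRS T.2)).2
  choose D hD hp using h1
  have iso : ∀ T T' : {T // T ∈ R}, (D T).toScheme.Isomorphic (D T').toScheme → T = T' := by
    intro T T' h
    have h2 := DirectedTransitions.mem_orbit_of_isomorphic (D T) (D T') hn
      (by rw [hD]; exact (hS _ (hRS T'.2)).1) h
    rw [hD, hD] at h2
    exact Subtype.ext (horb _ T.2 _ T'.2 h2)
  refine ⟨R.attach.image fun T => (D T).toScheme, ?_, ?_, ?_⟩
  · rwa [Finset.card_image_of_injective, Finset.card_attach]
    intro T T' h
    have h' : (D T).toScheme = (D T').toScheme := h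
    exact iso T T' (h' ▸ EmbeddingScheme.Isomorphic.refl _)
  · intro φ hφ
    obtain ⟨T, -, rfl⟩ := Finset.mem_image.1 hφ
    exact ⟨hp T, (D T).isMinimumGenus (by omega), (D T).twelve_mul_eulerGenus (by omega)⟩
  · intro φ hφ ψ hψ hne h
    obtain ⟨T, -, rfl⟩ := Finset.mem_image.1 hφ
    obtain ⟨T', -, rfl⟩ := Finset.mem_image.1 hψ
    exact hne (by rw [iso T T' h])

/-- The pairs of points other than one. -/
def pairsOff {n : ℕ} (e : Sym2 (Fin n)) : Finset (Sym2 (Fin n)) :=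
  (Finset.univ.filter fun f => ¬ f.IsDiag).erase e

lemma card_pairsOff {n : ℕ} {e : Sym2 (Fin n)} (he : ¬ e.IsDiag) :
    (pairsOff e).card = n.choose 2 - 1 := by
  rw [pairsOff, Finset.card_erase_of_mem (by simpa using he), ← Fintype.card_subtype,
    Sym2.card_subtype_not_diag, Fintype.card_fin]

lemma exists_orientable {n : ℕ} (hn : Even n) (h6 : 6 ≤ n) {A : ℕ} (hA : 6 * A + 4 ≤ n) :
    ∃ S : Finset (EmbeddingScheme (leviGraphThree n)),
      A ^ (n.choose 2 - 1) ≤ n.factorial * S.card ∧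
      (∀ φ ∈ S, φ.IsOrientable ∧ φ.IsMinimumGenus ∧
        12 * φ.eulerGenus = ((n : ℤ) - 2) * ((n : ℤ) + 3) * ((n : ℤ) - 4)) ∧
      ∀ φ ∈ S, ∀ ψ ∈ S, φ ≠ ψ → ¬ φ.Isomorphic ψ := by
  obtain ⟨T, hT⟩ := TransitionSystem.exists_isOriented hn (by omega)
  have ho := isAlternating_paritySign n
  have h01 : (⟨0, by omega⟩ : Fin n) ≠ ⟨1, by omega⟩ := by simp
  obtain ⟨S, hc, hS, -⟩ := TransitionSystem.IsOriented.exists_finset ho hT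
    (by rwa [Fintype.card_fin]) (pairsOff s(⟨0, by omega⟩, ⟨1, by omega⟩)) fun e he =>
      (Finset.mem_filter.1 (Finset.mem_of_mem_erase he)).2
  rw [card_pairsOff (by simp)] at hc
  obtain ⟨S', h1, h2⟩ := exists_finset_scheme h6 S (fun φ => φ.IsOrientable) fun T hT =>
    ⟨fun v w x => (hS T hT).compatible.next_ne, by
      obtain ⟨D, h1, h2⟩ := (hS T hT).exists_directed ho
      exact ⟨D, h1, D.isOrientable_of_dir_eq_ori h2⟩⟩
  exact ⟨S', hc.trans h1, h2⟩

/-- The systems vary at all pairs but one, and the twist takes place at the pair left out. So the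
twisted systems are still distinct. -/
lemma exists_nonorientable {n : ℕ} (hn : Even n) (h6 : 6 ≤ n) {A : ℕ} (hA : 6 * A + 4 ≤ n) :
    ∃ S : Finset (EmbeddingScheme (leviGraphThree n)),
      A ^ (n.choose 2 - 1) ≤ n.factorial * S.card ∧
      (∀ φ ∈ S, ¬ φ.IsOrientable ∧ φ.IsMinimumGenus ∧
        12 * φ.eulerGenus = ((n : ℤ) - 2) * ((n : ℤ) + 3) * ((n : ℤ) - 4)) ∧
      ∀ φ ∈ S, ∀ ψ ∈ S, φ ≠ ψ → ¬ φ.Isomorphic ψ := by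
  classical
  obtain ⟨T, hT⟩ := TransitionSystem.exists_isOriented hn (by omega)
  have ho := isAlternating_paritySign n
  have h01 : (⟨0, by omega⟩ : Fin n) ≠ ⟨1, by omega⟩ := by simp
  obtain ⟨S, hc, hS, hinj⟩ := TransitionSystem.IsOriented.exists_finset ho hT
    (by rwa [Fintype.card_fin]) (pairsOff s(⟨0, by omega⟩, ⟨1, by omega⟩)) fun e he =>
      (Finset.mem_filter.1 (Finset.mem_of_mem_erase he)).2
  rw [card_pairsOff (by simp)] at hc
  have htw := fun T : {T // T ∈ S} => TransitionSystem.IsOriented.exists_twist ho (hS T.1 T.2) h01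
    (by rwa [Fintype.card_fin])
  choose f hf1 hf2 hf3 hf4 using htw
  have hf : Function.Injective f := fun T T' h => Subtype.ext <|
    hinj _ T.2 _ T'.2 fun a b x hab => by
      have hne := Finset.ne_of_mem_erase hab
      rw [← hf4 T a b x hne, ← hf4 T' a b x hne, h]
  obtain ⟨S', h1, h2⟩ := exists_finset_scheme h6 (S.attach.image f) (fun φ => ¬ φ.IsOrientable)
    fun T hT => by
      obtain ⟨T, -, rfl⟩ := Finset.mem_image.1 hT
      refine ⟨hf2 T, ?_⟩
      obtain ⟨D, h1⟩ := (hf1 T).exists_directed ho (hf2 T)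
      refine ⟨D, h1, fun h => ?_⟩
      obtain ⟨o', h2, h3⟩ := D.exists_isCompatible h
      exact hf3 T o' h2 (h1 ▸ h3)
  rw [Finset.card_image_of_injective _ hf, Finset.card_attach] at h1
  exact ⟨S', hc.trans h1, h2⟩

lemma exists_orientable_singleton {n : ℕ} (hn : Even n) (h4 : 4 ≤ n) :
    ∃ φ : EmbeddingScheme (leviGraphThree n), φ.IsOrientable ∧ φ.IsMinimumGenus ∧
      12 * φ.eulerGenus = ((n : ℤ) - 2) * ((n : ℤ) + 3) * ((n : ℤ) - 4) := by
  obtain ⟨T, hT⟩ := TransitionSystem.exists_isOriented hn h4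
  obtain ⟨D, -, h⟩ := hT.exists_directed (isAlternating_paritySign n)
  exact ⟨D.toScheme, D.isOrientable_of_dir_eq_ori h, D.isMinimumGenus h4,
    D.twelve_mul_eulerGenus h4⟩

lemma exists_nonorientable_singleton {n : ℕ} (hn : Even n) (h6 : 6 ≤ n) :
    ∃ φ : EmbeddingScheme (leviGraphThree n), ¬ φ.IsOrientable ∧ φ.IsMinimumGenus ∧
      12 * φ.eulerGenus = ((n : ℤ) - 2) * ((n : ℤ) + 3) * ((n : ℤ) - 4) := by
  obtain ⟨T, hT⟩ := TransitionSystem.exists_isOriented hn (by omega)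
  have ho := isAlternating_paritySign n
  have h01 : (⟨0, by omega⟩ : Fin n) ≠ ⟨1, by omega⟩ := by simp
  obtain ⟨T', h1, h2, h3, -⟩ := TransitionSystem.IsOriented.exists_twist ho hT h01
    (by rwa [Fintype.card_fin])
  obtain ⟨D, rfl⟩ := h1.exists_directed ho h2
  refine ⟨D.toScheme, fun h => ?_, D.isMinimumGenus (by omega), D.twelve_mul_eulerGenus (by omega)⟩
  obtain ⟨o', h4, h5⟩ := D.exists_isCompatible h
  exact h3 o' h4 h5

/-! ### The numerical estimate and the conclusion -/

/-- For `n = 2 * m` the number `A` of choices is at least `n / 12`, and `20736 = 12 ^ 4`, so `A ^ 4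
≥ n ^ 3`. As `n! ≤ n ^ n`, after taking fourth powers it remains to compare `4 (m ^ 2 + n)` with `3
(n.choose 2 - 1)`. -/
lemma pow_mul_factorial_le {m : ℕ} (hm : 20736 ≤ 2 * m) :
    (2 * m) ^ (m ^ 2) * (2 * m).factorial ≤ ((2 * m - 4) / 6) ^ ((2 * m).choose 2 - 1) := by
  set n := 2 * m with hn
  set A := (n - 4) / 6 with hA
  have hA1 : n ≤ 12 * A := by omega
  have hA4 : n ^ 3 ≤ A ^ 4 := by
    have h1 : n ^ 4 ≤ (12 * A) ^ 4 := Nat.pow_le_pow_left hA1 4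
    have h2 : 20736 * n ^ 3 ≤ n * n ^ 3 := Nat.mul_le_mul_right _ hm
    have h3 : (12 * A) ^ 4 = 20736 * A ^ 4 := by ring
    have h4 : n * n ^ 3 = n ^ 4 := by ring
    omega
  -- The shift removes the natural subtractions, and the polynomial inequality in `k` then holds
  -- coefficient by coefficient.
  obtain ⟨k, rfl⟩ : ∃ k, m = k + 8 := ⟨m - 8, by omega⟩
  have hc : n.choose 2 - 1 = 2 * k ^ 2 + 31 * k + 119 := by
    have h1 : n.choose 2 = 2 * k ^ 2 + 31 * k + 120 := by
      rw [Nat.choose_two_right]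
      have : n * (n - 1) = (2 * k ^ 2 + 31 * k + 120) * 2 := by
        rw [hn, show 2 * (k + 8) - 1 = 2 * k + 15 by omega]
        ring
      omega
    omega
  clear_value A n
  calc n ^ ((k + 8) ^ 2) * n.factorial ≤ n ^ ((k + 8) ^ 2) * n ^ n :=
        Nat.mul_le_mul_left _ n.factorial_le_pow
    _ = n ^ ((k + 8) ^ 2 + n) := (pow_add _ _ _).symm
    _ ≤ A ^ (n.choose 2 - 1) := by
      rw [hc]
      refine (Nat.pow_le_pow_iff_left (n := 4) (by norm_num)).1 ?_
      rw [← pow_mul, ← pow_mul, mul_comm (2 * k ^ 2 + 31 * k + 119) 4, pow_mul A]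
      calc n ^ (((k + 8) ^ 2 + n) * 4) ≤ n ^ (3 * (2 * k ^ 2 + 31 * k + 119)) :=
            Nat.pow_le_pow_right (by omega) (by rw [hn]; ring_nf; nlinarith)
        _ = (n ^ 3) ^ (2 * k ^ 2 + 31 * k + 119) := pow_mul _ _ _
        _ ≤ (A ^ 4) ^ (2 * k ^ 2 + 31 * k + 119) := Nat.pow_le_pow_left hA4 _

lemma two_rpow_eq {m : ℕ} (hm : 0 < m) :
    (2 : ℝ) ^ (((1 : ℝ) / 4 - 0) * ((2 * m : ℕ) : ℝ) ^ 2 * Real.logb 2 ((2 * m : ℕ) : ℝ)) =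
      (((2 * m) ^ (m ^ 2) : ℕ) : ℝ) := by
  have h1 : ((1 : ℝ) / 4 - 0) * ((2 * m : ℕ) : ℝ) ^ 2 * Real.logb 2 ((2 * m : ℕ) : ℝ) =
      Real.logb 2 ((2 * m : ℕ) : ℝ) * ((m ^ 2 : ℕ) : ℝ) := by
    push_cast
    ring
  rw [h1, Real.rpow_mul (by norm_num), Real.rpow_logb (by norm_num) (by norm_num)
    (by exact_mod_cast (by omega : 0 < 2 * m)), Real.rpow_natCast]
  push_cast
  rfl

theorem theorem1p3 :
    ∃ ε : ℕ → ℝ, Tendsto ε atTop (𝓝 0) ∧ ∀ n : ℕ, Even n →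
      (4 ≤ n →
        ∃ S : Finset (EmbeddingScheme (leviGraph (completeUniformHypergraph n 3))),
          (2 : ℝ) ^ (((1 : ℝ) / 4 - ε n) * (n : ℝ) ^ 2 * Real.logb 2 (n : ℝ)) ≤ (S.card : ℝ) ∧
          (∀ φ ∈ S, φ.IsOrientable ∧ φ.IsMinimumGenus ∧
            12 * φ.eulerGenus = ((n : ℤ) - 2) * ((n : ℤ) + 3) * ((n : ℤ) - 4)) ∧
          (∀ φ ∈ S, ∀ ψ ∈ S, φ ≠ ψ → ¬ φ.Isomorphic ψ)) ∧
      (6 ≤ n →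
        ∃ S : Finset (EmbeddingScheme (leviGraph (completeUniformHypergraph n 3))),
          (2 : ℝ) ^ (((1 : ℝ) / 4 - ε n) * (n : ℝ) ^ 2 * Real.logb 2 (n : ℝ)) ≤ (S.card : ℝ) ∧
          (∀ φ ∈ S, ¬ φ.IsOrientable ∧ φ.IsMinimumGenus ∧
            12 * φ.eulerGenus = ((n : ℤ) - 2) * ((n : ℤ) + 3) * ((n : ℤ) - 4)) ∧
          (∀ φ ∈ S, ∀ ψ ∈ S, φ ≠ ψ → ¬ φ.Isomorphic ψ)) := by
  -- For small `n` the value `1 / 4` turns the bound into `1`, and a single embedding is enough;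
  -- beyond that no error term is needed.
  refine ⟨fun n => if n < 20736 then 1 / 4 else 0, ?_, fun n hn => ?_⟩
  · refine tendsto_const_nhds.congr' ?_
    filter_upwards [eventually_ge_atTop 20736] with n h
    rw [if_neg (by omega)]
  have single : ∀ φ : EmbeddingScheme (leviGraphThree n), ∀ χ ∈ ({φ} : Finset _),
      ∀ ψ ∈ ({φ} : Finset _), χ ≠ ψ → ¬ χ.Isomorphic ψ := fun φ χ hχ ψ hψ h =>
    absurd ((Finset.mem_singleton.1 hχ).trans (Finset.mem_singleton.1 hψ).symm) h
  by_cases hlt : n < 20736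
  · have h0 : (2 : ℝ) ^ (((1 : ℝ) / 4 - (if n < 20736 then 1 / 4 else 0)) * (n : ℝ) ^ 2 *
        Real.logb 2 (n : ℝ)) = 1 := by rw [if_pos hlt, sub_self, zero_mul, zero_mul, Real.rpow_zero]
    refine ⟨fun h4 => ?_, fun h6 => ?_⟩
    · obtain ⟨φ, hφ⟩ := exists_orientable_singleton hn h4
      exact ⟨{φ}, by rw [h0]; simp, fun χ hχ => Finset.mem_singleton.1 hχ ▸ hφ, single φ⟩
    · obtain ⟨φ, hφ⟩ := exists_nonorientable_singleton hn h6
      exact ⟨{φ}, by rw [h0]; simp, fun χ hχ => Finset.mem_singleton.1 hχ ▸ hφ, single φ⟩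
  · obtain ⟨m, rfl⟩ := hn.two_dvd
    have bound : ∀ c : ℕ, ((2 * m - 4) / 6) ^ ((2 * m).choose 2 - 1) ≤ (2 * m).factorial * c →
        (2 : ℝ) ^ (((1 : ℝ) / 4 - (if 2 * m < 20736 then 1 / 4 else 0)) *
          ((2 * m : ℕ) : ℝ) ^ 2 * Real.logb 2 ((2 * m : ℕ) : ℝ)) ≤ c := by
      intro c hc
      rw [if_neg hlt, two_rpow_eq (by omega), Nat.cast_le]
      have := (pow_mul_factorial_le (not_lt.1 hlt)).trans hc
      rw [mul_comm] at this
      exact Nat.le_of_mul_le_mul_left this (Nat.factorial_pos _)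
    have h6 : 6 ≤ 2 * m := by omega
    refine ⟨fun _ => ?_, fun _ => ?_⟩
    · obtain ⟨S, hS, h⟩ := exists_orientable hn h6 (A := (2 * m - 4) / 6) (by omega)
      exact ⟨S, bound _ hS, h⟩
    · obtain ⟨S, hS, h⟩ := exists_nonorientable hn h6 (A := (2 * m - 4) / 6) (by omega)
      exact ⟨S, bound _ hS, h⟩
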